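/- **Setting.** Let $S$ be a connected smooth manifold with a smooth Riemannian metric $\gamma$, a smooth one-form $\boldsymbol s$ and a smooth function $h$. The associated near-horizon geometry is $\mathbb R_u\times\mathbb R_v\times S$ with the Lorentzian metric $$g_{\rm NHG}=2\,dv\Big(du+2u\,s_A\,dx^A+\tfrac12u^2h\,dv\Big)+\gamma_{AB}\,dx^A dx^B .$$ A Killing vector $Z$ is a *generator* of the hypersurface $\{u=0\}$ if on a relatively open dense subset of it $Z$ is nowhere zero, null and tangent to it, with $\nabla_ZZ=\kappa Z$ there for a constant $\kappa$ (the surface gravity); it is *degenerate* if $\kappa=0$. For example, $\eta=\partial_v$ is a degenerate generator. The near-horizon geometry of a spacetime metric $g$ with respect to a degenerate generator $Z$ of $\{u=0\}$ without zeros there is the near-horizon geometry built from the following data, computed on a cut $\{u=0,\ v=\varphi(x)\}$, with $\varphi$ a smooth function: the first fundamental form $\gamma$ of the cut; the torsion one-form $\boldsymbol s(X)=g(\ell,\nabla_XZ)$, where $\ell$ is the null normal of the cut with $g(\ell,Z)=-1$; and $h=2|\boldsymbol s|_\gamma^2-{\rm div}\,s+\tfrac12R-\tfrac12{\rm tr}_\gamma{\rm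 Ric}$, with $R$ and ${\rm Ric}$ the scalar curvature and the Ricci tensor of $g$. **Proposition.** Let $\zeta$ be a Killing vector of $g_{\rm NHG}$ that is a degenerate generator of $\{u=0\}$ and linearly independent of $\eta=\partial_v$. Let $f:S\to\mathbb R$ be the function with $\zeta=f\eta$ on the cut $\{u=v=0\}$, and let $W\subset S$ be a non-empty connected open set on which $f$ has no zeros (for instance a connected component of $\{f\neq0\}$). Then, over $W$, the near-horizon geometry $g_{\rm NHG}(\zeta)$ of $g_{\rm NHG}$ with respect to $\zeta$ exists, its data being smooth and independent of the cut; write it on $\mathbb R_U\times\mathbb R_V\times W$ as $$g_{\rm NHG}(\zeta)=2\,dV\Big(dU+2U\,S_A\,dy^A+\tfrac12U^2H\,dV\Big)+\tilde\gamma_{AB}\,dy^Ady^B .$$ Let $F$ be the function independent of $U$ and $V$ that equals $f$ on the cut $\{U=V=0\}\cong W$. Then: 1. The vector fields $$\tilde\xi=V\partial_V-U\partial_U,\qquad \tilde\eta=\partial_V,\qquad \tilde\zeta=\frac1F\,\partial_V+\frac{U^2}{2}\,\Delta\Big(\frac1F\Big)\partial_U-U\,{\rm grad}\,\frac1F$$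 ($\Delta$ and ${\rm grad}$ those of $\tilde\gamma$) are linearly independent Killing vectors of $g_{\rm NHG}(\zeta)$ and generators of the multiple Killing horizon $\{U=0\}$; $\tilde\eta$ and $\tilde\zeta$ are degenerate, and $\tilde\xi$ has surface gravity $1$. 2. The near-horizon geometry of $g_{\rm NHG}(\zeta)$ with respect to $\tilde\zeta$ is the original metric: whichever cut is used, its data are $\gamma,\boldsymbol s,h$ over $W$. -/

import Mathlib

set_option maxSynthPendingDepth 3

open Set
open scoped Manifold ContDiff

noncomputable section

namespace NHG

/-! ### Pseudo-Riemannian calculus in a finite-dimensional vector space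

`G : V → V →L[ℝ] V →L[ℝ] ℝ` is a metric on (an open subset of) `V`, in coordinates. -/

section Local

variable {V V' : Type*} [NormedAddCommGroup V] [NormedSpace ℝ V]
  [NormedAddCommGroup V'] [NormedSpace ℝ V']

/-- The bilinear form `(a, b) ↦ B (A a) (A b)`. -/
def pullbackForm (B : V →L[ℝ] V →L[ℝ] ℝ) (A : V' →L[ℝ] V) : V' →L[ℝ] V' →L[ℝ] ℝ :=
  B.bilinearComp A A

/-- The trace `g^{ab} B_{ab}` of a bilinear form `B` with respect to a nondegenerate form `g`. -/
def traceWith (g B : V →L[ℝ] V →L[ℝ] ℝ) : ℝ :=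
  LinearMap.trace ℝ V ((g.inverse ∘L B : V →L[ℝ] V) : V →ₗ[ℝ] V)

/-- Christoffel symbols of the first kind,
`(a, b, c) ↦ (∂_a G(b, c) + ∂_b G(a, c) - ∂_c G(a, b)) / 2`. -/
def christoffelLower (G : V → V →L[ℝ] V →L[ℝ] ℝ) (y : V) : V →L[ℝ] V →L[ℝ] V →L[ℝ] ℝ :=
  let dG : V →L[ℝ] V →L[ℝ] V →L[ℝ] ℝ := fderiv ℝ G y
  let fl : (V →L[ℝ] V →L[ℝ] ℝ) →L[ℝ] (V →L[ℝ] V →L[ℝ] ℝ) :=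
    (ContinuousLinearMap.flipₗᵢ ℝ V V ℝ).toContinuousLinearEquiv
  (1 / 2 : ℝ) • (dG + dG.flip - fl ∘L dG.flip)

theorem christoffelLower_apply (G : V → V →L[ℝ] V →L[ℝ] ℝ) (y a b c : V) :
    christoffelLower G y a b c =
      (1 / 2) * (fderiv ℝ G y a b c + fderiv ℝ G y b a c - fderiv ℝ G y c a b) := by
  simp [christoffelLower]

/-- Christoffel symbols of the second kind: `G (Γ(a, b), c) = christoffelLower G a b c`. -/
def christoffel (G : V → V →L[ℝ] V →L[ℝ] ℝ) (y : V) : V →L[ℝ] V →L[ℝ] V :=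
  (ContinuousLinearMap.compL ℝ V (V →L[ℝ] ℝ) V (G y).inverse) ∘L (christoffelLower G y)

theorem christoffel_apply (G : V → V →L[ℝ] V →L[ℝ] ℝ) (y a b : V) :
    christoffel G y a b = (G y).inverse (christoffelLower G y a b) := rfl

/-- The linear map `a ↦ R(a, b) c`, with `R` the Riemann tensor of `G`. -/
def riemannOp (G : V → V →L[ℝ] V →L[ℝ] ℝ) (y b c : V) : V →L[ℝ] V :=
  ((fderiv ℝ (christoffel G) y).flip b).flip c - (fderiv ℝ (christoffel G) y b).flip c
    + (christoffel G y).flip (christoffel G y b c)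
    - (christoffel G y b) ∘L ((christoffel G y).flip c)

theorem riemannOp_apply (G : V → V →L[ℝ] V →L[ℝ] ℝ) (y a b c : V) :
    riemannOp G y b c a =
      fderiv ℝ (christoffel G) y a b c - fderiv ℝ (christoffel G) y b a c
        + christoffel G y a (christoffel G y b c) - christoffel G y b (christoffel G y a c) := by
  simp [riemannOp]

/-- The Ricci tensor `Ric(b, c) = tr (a ↦ R(a, b) c)`. -/
def ricciLocal [FiniteDimensional ℝ V] (G : V → V →L[ℝ] V →L[ℝ] ℝ) (y : V) :
    V →L[ℝ] V →L[ℝ] ℝ :=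
  (LinearMap.mk₂ ℝ (fun b c => LinearMap.trace ℝ V (riemannOp G y b c : V →ₗ[ℝ] V))
    (fun b b' c => by
      rw [← map_add]; congr 1; ext a; simp [riemannOp_apply]; abel)
    (fun r b c => by
      rw [← map_smul]; congr 1; ext a; simp [riemannOp_apply, smul_sub, smul_add])
    (fun b c c' => by
      rw [← map_add]; congr 1; ext a; simp [riemannOp_apply]; abel)
    (fun r b c => by
      rw [← map_smul]; congr 1; ext a;
      simp [riemannOp_apply, smul_sub, smul_add])).toContinuousBilinearMap

theorem ricciLocal_apply [FiniteDimensional ℝ V] (G : V → V →L[ℝ] V →L[ℝ] ℝ) (y b c : V) :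
    ricciLocal G y b c = LinearMap.trace ℝ V (riemannOp G y b c : V →ₗ[ℝ] V) := rfl

end Local

/-! ### Tensor fields on a manifold

Every tensor at a point `p` is computed in the preferred chart at `p`; the tangent space at `p`
is the model space `V` through the differential of exactly this chart. -/

section Manifold

variable {V H M : Type*} [NormedAddCommGroup V] [NormedSpace ℝ V] [TopologicalSpace H]
  (I : ModelWithCorners ℝ V H) [TopologicalSpace M] [ChartedSpace H M]

/-- Fields of bilinear forms on tangent spaces (covariant 2-tensors). -/
abbrev FormField := ∀ p : M, TangentSpace I p →L[ℝ] TangentSpace I p →L[ℝ] ℝ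

/-- One-forms. -/
abbrev CovectorField := ∀ p : M, TangentSpace I p →L[ℝ] ℝ

/-- Vector fields. -/
abbrev VecField := ∀ p : M, TangentSpace I p

variable {I}

/-- Smoothness of a vector field on a set. -/
def SmoothVec [IsManifold I ∞ M] (Z : VecField I (M := M)) (U : Set M) : Prop :=
  ContMDiffOn I I.tangent ∞ (fun p => (⟨p, Z p⟩ : TangentBundle I M)) U

/-- Smoothness of a one-form on a set. -/
def SmoothCovec [IsManifold I ∞ M] (σ : CovectorField I (M := M)) (U : Set M) : Prop :=
  ContMDiffOn I (I.prod 𝓘(ℝ, V →L[ℝ] ℝ)) ∞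
    (fun p => Bundle.TotalSpace.mk' (V →L[ℝ] ℝ)
      (E := fun p : M => TangentSpace I p →L[ℝ] ℝ) p (σ p)) U

/-- Smoothness of a field of bilinear forms on a set. -/
def SmoothForm [IsManifold I ∞ M] (g : FormField I (M := M)) (U : Set M) : Prop :=
  ContMDiffOn I (I.prod 𝓘(ℝ, V →L[ℝ] V →L[ℝ] ℝ)) ∞
    (fun p => Bundle.TotalSpace.mk' (V →L[ℝ] V →L[ℝ] ℝ)
      (E := fun p : M => TangentSpace I p →L[ℝ] TangentSpace I p →L[ℝ] ℝ) p (g p)) U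

/-- The differential of the inverse of the preferred chart at `p₀`, at the coordinate point `y`. -/
def chartFrame (p₀ : M) (y : V) : V →L[ℝ] V :=
  mfderivWithin 𝓘(ℝ, V) I (extChartAt I p₀).symm (range I) y

/-- Coordinate expression of a field of bilinear forms in the preferred chart at `p₀`. -/
def chartForm (g : FormField I (M := M)) (p₀ : M) (y : V) : V →L[ℝ] V →L[ℝ] ℝ :=
  pullbackForm (V := V) (V' := V) (g ((extChartAt I p₀).symm y)) (chartFrame (I := I) p₀ y)

/-- Coordinate expression of a one-form in the preferred chart at `p₀`. -/
def chartCovec (σ : CovectorField I (M := M)) (p₀ : M) (y : V) : V →L[ℝ] ℝ :=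
  ContinuousLinearMap.comp (M₂ := V) (σ ((extChartAt I p₀).symm y)) (chartFrame (I := I) p₀ y)

/-- Coordinate expression of a vector field in the preferred chart at `p₀`. -/
def chartVec (Z : VecField I (M := M)) (p₀ : M) (y : V) : V :=
  VectorField.mpullbackWithin 𝓘(ℝ, V) I (extChartAt I p₀).symm Z (range I) y

/-- The Levi-Civita covariant derivative `∇_X Z` at `p`. -/
def covDeriv (g : FormField I (M := M)) (Z : VecField I (M := M)) (p : M) (X : TangentSpace I p) :
    TangentSpace I p :=
  let y : V := extChartAt I p p
  let X' : V := X
  let Zp : V := Z p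
  (fderiv ℝ (chartVec Z p) y X' + christoffel (chartForm g p) y X' Zp : V)

/-- The Lie derivative `(L_Z g)(a, b)` at `p`:
`Z^c ∂_c g_{ab} + g_{cb} ∂_a Z^c + g_{ac} ∂_b Z^c` in coordinates. -/
def lieDeriv (g : FormField I (M := M)) (Z : VecField I (M := M)) (p : M)
    (a b : TangentSpace I p) : ℝ :=
  let y : V := extChartAt I p p
  let G : V → V →L[ℝ] V →L[ℝ] ℝ := chartForm g p
  let Y : V → V := chartVec Z p
  let a' : V := a
  let b' : V := b
  fderiv ℝ G y (Y y) a' b' + G y (fderiv ℝ Y y a') b' + G y a' (fderiv ℝ Y y b')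

/-- Killing vector fields of `g` on a set: smooth, with `L_Z g = 0`. -/
def IsKillingOn [IsManifold I ∞ M] (g : FormField I (M := M)) (Z : VecField I (M := M))
    (U : Set M) : Prop :=
  SmoothVec Z U ∧ ∀ p ∈ U, ∀ a b, lieDeriv g Z p a b = 0

/-- The Ricci tensor of `g` at `p`. -/
def ricci [FiniteDimensional ℝ V] (g : FormField I (M := M)) : FormField I (M := M) :=
  fun p => ricciLocal (V := V) (chartForm g p) (extChartAt I p p)

/-- The trace of the field of forms `B` with respect to the metric `g`. -/
def formTrace (g B : FormField I (M := M)) (p : M) : ℝ := traceWith (V := V) (g p) (B p)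

/-- The scalar curvature of `g` at `p`. -/
def scalarCurvature [FiniteDimensional ℝ V] (g : FormField I (M := M)) (p : M) : ℝ :=
  formTrace g (ricci g) p

/-- The vector field `σ^♯` metrically related to the one-form `σ`. -/
def sharp (g : FormField I (M := M)) (σ : CovectorField I (M := M)) : VecField I (M := M) :=
  fun p => (g p).inverse (σ p)

/-- The covariant derivative `(∇σ)(a, b) = (∇_a σ)(b)` of a one-form. -/
def covDerivCovec (g : FormField I (M := M)) (σ : CovectorField I (M := M)) :
    FormField I (M := M) :=
  fun p =>
    let y : V := extChartAt I p p
    (fderiv ℝ (chartCovec σ p) y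
      - (ContinuousLinearMap.compL ℝ V V ℝ (chartCovec σ p y)) ∘L (christoffel (chartForm g p) y) :
      V →L[ℝ] V →L[ℝ] ℝ)

/-- The divergence of (the vector field metrically related to) a one-form. -/
def divergence (g : FormField I (M := M)) (σ : CovectorField I (M := M)) (p : M) : ℝ :=
  formTrace g (covDerivCovec g σ) p

/-- The differential of a function. -/
def differential (f : M → ℝ) : CovectorField I (M := M) := fun p => mfderiv I 𝓘(ℝ, ℝ) f p

/-- The gradient of a function. -/
def gradient (g : FormField I (M := M)) (f : M → ℝ) : VecField I (M := M) :=
  sharp g (differential f)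

/-- The Laplacian of a function. -/
def laplacian (g : FormField I (M := M)) (f : M → ℝ) (p : M) : ℝ :=
  divergence g (differential f) p

end Manifold

/-! ### Near-horizon geometries on `ℝ × ℝ × S`, with coordinates `(u, v, x)` -/

section NearHorizon

variable (E S : Type*) [NormedAddCommGroup E] [NormedSpace ℝ E]
  [TopologicalSpace S] [ChartedSpace E S]

/-- The model with corners of the manifold `ℝ × ℝ × S`. -/
abbrev stModel := 𝓘(ℝ, ℝ).prod (𝓘(ℝ, ℝ).prod 𝓘(ℝ, E))

/-- Data `(γ, s, h)` of a near-horizon geometry on the cut `S`. Only the values on an open set on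
which the data are regular are meaningful. -/
structure HorizonData where
  /-- the metric of the cut -/
  γ : FormField 𝓘(ℝ, E) (M := S)
  /-- the torsion one-form -/
  s : CovectorField 𝓘(ℝ, E) (M := S)
  /-- the scalar coefficient -/
  h : S → ℝ

variable {E S}

/-- On `W`, `γ` is a smooth Riemannian metric and `s`, `h` are smooth. -/
structure HorizonData.IsRegularOn [IsManifold 𝓘(ℝ, E) ∞ S] (D : HorizonData E S) (W : Set S) :
    Prop where
  symm : ∀ x ∈ W, ∀ a b, D.γ x a b = D.γ x b a
  pos : ∀ x ∈ W, ∀ a, a ≠ 0 → 0 < D.γ x a a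
  smooth_γ : SmoothForm D.γ W
  smooth_s : SmoothCovec D.s W
  smooth_h : ContMDiffOn 𝓘(ℝ, E) 𝓘(ℝ, ℝ) ∞ D.h W

/-- Two sets of data agree on `W`. -/
def HorizonData.EqOn (D D' : HorizonData E S) (W : Set S) : Prop :=
  ∀ x ∈ W, D.γ x = D'.γ x ∧ D.s x = D'.s x ∧ D.h x = D'.h x

/-- The bilinear form `2 dv (du + 2 u s + (1/2) u² h dv) + γ` (symmetrized product) on
`ℝ × ℝ × E`. -/
def nhgForm (γ : E →L[ℝ] E →L[ℝ] ℝ) (s : E →L[ℝ] ℝ) (h u : ℝ) :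
    (ℝ × ℝ × E) →L[ℝ] (ℝ × ℝ × E) →L[ℝ] ℝ :=
  let du : (ℝ × ℝ × E) →L[ℝ] ℝ := ContinuousLinearMap.fst ℝ ℝ (ℝ × E)
  let pr : (ℝ × ℝ × E) →L[ℝ] ℝ × E := ContinuousLinearMap.snd ℝ ℝ (ℝ × E)
  let dv : (ℝ × ℝ × E) →L[ℝ] ℝ := (ContinuousLinearMap.fst ℝ ℝ E) ∘L pr
  let dx : (ℝ × ℝ × E) →L[ℝ] E := (ContinuousLinearMap.snd ℝ ℝ E) ∘L pr
  let θ : (ℝ × ℝ × E) →L[ℝ] ℝ := du + (2 * u) • (s ∘L dx) + (1 / 2 * u ^ 2 * h) • dv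
  dv.smulRight θ + θ.smulRight dv + pullbackForm γ dx

theorem nhgForm_apply (γ : E →L[ℝ] E →L[ℝ] ℝ) (s : E →L[ℝ] ℝ) (h u : ℝ) (a b : ℝ × ℝ × E) :
    nhgForm γ s h u a b =
      a.2.1 * b.1 + a.1 * b.2.1 + 2 * u * (a.2.1 * s b.2.2 + b.2.1 * s a.2.2)
        + u ^ 2 * h * (a.2.1 * b.2.1) + γ a.2.2 b.2.2 := by
  simp [nhgForm, pullbackForm]; ring

/-- The near-horizon metric `2 dv (du + 2 u s + (1/2) u² h dv) + γ` on `ℝ × ℝ × S`. -/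
def nhgMetric (D : HorizonData E S) : FormField (stModel E) (M := ℝ × ℝ × S) :=
  fun p => nhgForm (E := E) (D.γ p.2.2) (D.s p.2.2) (D.h p.2.2) p.1

/-- The vector field `∂_v`. -/
def etaField : VecField (stModel E) (M := ℝ × ℝ × S) := fun _ => ((0, 1, 0) : ℝ × ℝ × E)

/-- The vector field `v ∂_v - u ∂_u`. -/
def xiField : VecField (stModel E) (M := ℝ × ℝ × S) :=
  fun p => ((-p.1, p.2.1, 0) : ℝ × ℝ × E)

/-- The vector field `f ∂_v + (u²/2) Δf ∂_u - u grad f`, with `Δ` and `grad` those of `γ`. -/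
def degField (γ : FormField 𝓘(ℝ, E) (M := S)) (f : S → ℝ) :
    VecField (stModel E) (M := ℝ × ℝ × S) :=
  fun p =>
    let w : E := gradient γ f p.2.2
    ((p.1 ^ 2 / 2 * laplacian γ f p.2.2, f p.2.2, -(p.1 • w)) : ℝ × ℝ × E)

/-- The part of `ℝ × ℝ × S` over `W`. -/
def region (W : Set S) : Set (ℝ × ℝ × S) := {p | p.2.2 ∈ W}

/-- The part of the hypersurface `{u = 0}` over `W`. -/
def horizon (W : Set S) : Set (ℝ × ℝ × S) := {p | p.1 = 0 ∧ p.2.2 ∈ W}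

/-- `K`, a relatively open part of `{u = 0}`, is a Killing horizon of `Z` with surface gravity `κ`:
`Z` is nowhere zero on `K`, tangent to `K`, orthogonal to every vector tangent to `K` (so `Z` and
`K` are null), and `∇_Z Z = κ Z` on `K`. -/
structure IsKillingHorizon (g : FormField (stModel E) (M := ℝ × ℝ × S))
    (Z : VecField (stModel E) (M := ℝ × ℝ × S)) (κ : ℝ) (K : Set (ℝ × ℝ × S)) : Prop where
  nonzero : ∀ p ∈ K, Z p ≠ 0
  tangent : ∀ p ∈ K, ((Z p : ℝ × ℝ × E)).1 = 0
  null : ∀ p ∈ K, ∀ X : ℝ × ℝ × E, X.1 = 0 → g p (Z p) X = 0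
  surfaceGravity : ∀ p ∈ K, covDeriv g Z p (Z p) = κ • Z p

/-- `Z` is a Killing vector field of `g` over `W`, and it has a Killing horizon with surface
gravity `κ` that is open and dense in the hypersurface `{u = 0}` over `W`. -/
def IsHorizonGenerator [IsManifold 𝓘(ℝ, E) ∞ S] (g : FormField (stModel E) (M := ℝ × ℝ × S))
    (Z : VecField (stModel E) (M := ℝ × ℝ × S)) (κ : ℝ) (W : Set S) : Prop :=
  IsKillingOn g Z (region W) ∧
    ∃ O : Set (ℝ × ℝ × S), IsOpen O ∧ horizon W ⊆ closure (O ∩ horizon W) ∧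
      IsKillingHorizon g Z κ (O ∩ horizon W)

/-- The cut `{u = 0, v = φ(x)}` of `{u = 0}`, as an embedding of `S`. -/
def cut (φ : S → ℝ) (x : S) : ℝ × ℝ × S := (0, φ x, x)

/-- The differential of the embedding of the cut. -/
def cutTangent (φ : S → ℝ) (x : S) : E →L[ℝ] ℝ × ℝ × E :=
  mfderiv 𝓘(ℝ, E) (stModel E) (cut φ) x

/-- `D` is, over `W`, the data of the near-horizon geometry of the spacetime metric `g` with
respect to the degenerate horizon generator `Z`, read off on the cut `{u = 0, v = φ(x)}`:
* `γ` is the first fundamental form of the cut;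
* `s(X) = g(ℓ, ∇_X Z)`, where `ℓ` is the null normal of the cut with `g(ℓ, Z) = -1`;
* `h = 2 |s|² - div s + R / 2 - tr_γ Ric / 2`, with `R` and `Ric` the curvatures of `g`. -/
structure IsNearHorizonData [FiniteDimensional ℝ E]
    (g : FormField (stModel E) (M := ℝ × ℝ × S)) (Z : VecField (stModel E) (M := ℝ × ℝ × S))
    (φ : S → ℝ) (W : Set S) (D : HorizonData E S) : Prop where
  firstForm : ∀ x ∈ W, ∀ a b : E,
    D.γ x a b = g (cut φ x) (cutTangent φ x a) (cutTangent φ x b)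
  torsion : ∀ x ∈ W, ∃ l : ℝ × ℝ × E,
    (∀ a : E, g (cut φ x) l (cutTangent φ x a) = 0) ∧ g (cut φ x) l l = 0 ∧
      g (cut φ x) l (Z (cut φ x)) = -1 ∧
      ∀ a : E, D.s x a = g (cut φ x) l (covDeriv g Z (cut φ x) (cutTangent φ x a))
  scalar : ∀ x ∈ W, D.h x =
    2 * D.s x (sharp D.γ D.s x) - divergence D.γ D.s x
      + scalarCurvature g (cut φ x) / 2
      - traceWith (V := E) (D.γ x)
          (pullbackForm (V := ℝ × ℝ × E) (ricci g (cut φ x)) (cutTangent φ x)) / 2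

/-- `D` is the data over `W` of **the** near-horizon geometry of `g` with respect to `Z`: from
every smooth cut over `W`, the data `D`, and only these, are obtained. -/
def IsNearHorizonGeometry [FiniteDimensional ℝ E]
    (g : FormField (stModel E) (M := ℝ × ℝ × S)) (Z : VecField (stModel E) (M := ℝ × ℝ × S))
    (W : Set S) (D : HorizonData E S) : Prop :=
  ∀ φ : S → ℝ, ContMDiffOn 𝓘(ℝ, E) 𝓘(ℝ, ℝ) ∞ φ W →
    ∀ D' : HorizonData E S, IsNearHorizonData g Z φ W D' ↔ D'.EqOn D W

end NearHorizon

end NHG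

end

set_option linter.unusedSectionVars false

namespace NHG

open Filter Topology

/-! ### Differentiation of operator-valued maps, tested on fixed vectors -/

section LocalCalculus

variable {V V' W : Type*} [NormedAddCommGroup V] [NormedSpace ℝ V]
  [NormedAddCommGroup V'] [NormedSpace ℝ V'] [NormedAddCommGroup W] [NormedSpace ℝ W]

/-! Everything is reduced to equations on `S`. In a product chart the metric keeps its near-horizon
form, so the computations take place on `ℝ × ℝ × E` with local data `(G, s, h)`.

On `{u = 0}` a degenerate generator is `f ∂_v` with `f` independent of `v`: nullity and tangency fix
the direction, `∇_Z Z = 0` gives `∂_v f = 0`, and continuity extends both from a dense subset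
(`IsHorizonGenerator.isHorizonField`). The components of the Killing equation with one slot `∂_u`
are differential equations in `u`; they give `ζ = f ∂_v + u² s(w) ∂_u - u w` with `w = grad f`
(`IsHorizonField.vecVal_eq`). The other components are the equations `MasterEq` for `f`: `Hess f =
df ⊗ s + s ⊗ df`, a linear and a scalar equation. The trace of the first, `Δf = 2 s(w)`, gives the
form used in `degField`.

The data for a horizon field `f ∂_v` are computed on an arbitrary cut. The torsion is `s' = s - df /
f` (`torsion_cut`). On the horizon `Ric(∂_v, ·)` vanishes on tangent vectors and takes the value `ρ
= h - 2|s|² + div s` on `∂_u`, so `(R - tr_γ Ric) / 2 = ρ` on each cut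
(`LocalData.curvature_horizon`). The new data are therefore determined by `s' = s - df / f` and `ρ'
= ρ`. Applying the same rule with `1 / f` restores `s`, and `ρ` is still unchanged, so `h` is
restored as well: this is the second assertion.

For the first assertion, inversion preserves the master equations: if `f` solves them for `(γ, s,
h)`, then `1 / f` solves them for `(γ, s', h')` (`MasterEq.inv`), so its `degField` is Killing.
Linear independence needs a point where `grad f ≠ 0`. The master equations bound the differential of
`|grad f|²` by a multiple of `|grad f|²`, so one zero would spread over the connected `S`; then `f`
would be constant and `ζ = f η` (`MasterEqOn.eq_const`). -/

theorem contDiffAt_clm_apply_iff [FiniteDimensional ℝ V] {n : WithTop ℕ∞} {F : W → V →L[ℝ] V'}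
    {x : W} : ContDiffAt ℝ n F x ↔ ∀ a, ContDiffAt ℝ n (fun y => F y a) x := by
  refine ⟨fun h a => h.clm_apply contDiffAt_const, fun h => ?_⟩
  let d := Module.finrank ℝ V
  have hd : d = Module.finrank ℝ (Fin d → ℝ) := (Module.finrank_fin_fun ℝ).symm
  let e₁ := ContinuousLinearEquiv.ofFinrankEq hd
  let e₂ := (e₁.arrowCongr (1 : V' ≃L[ℝ] V')).trans (ContinuousLinearEquiv.piRing (Fin d))
  rw [← Function.id_comp F, ← e₂.symm_comp_self]
  exact e₂.symm.contDiff.contDiffAt.comp x (contDiffAt_pi.mpr fun i => h _)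

theorem contDiffAt_clm_apply₂_iff [FiniteDimensional ℝ V] [FiniteDimensional ℝ V'] {U : Type*}
    [NormedAddCommGroup U] [NormedSpace ℝ U] {n : WithTop ℕ∞}
    {F : W → V →L[ℝ] V' →L[ℝ] U} {x : W} :
    ContDiffAt ℝ n F x ↔ ∀ a b, ContDiffAt ℝ n (fun y => F y a b) x := by
  rw [contDiffAt_clm_apply_iff]
  exact forall_congr' fun a => contDiffAt_clm_apply_iff

theorem fderiv_apply_const {F : W → V →L[ℝ] V'} {x : W} (hF : DifferentiableAt ℝ F x)
    (c : W) (a : V) : fderiv ℝ (fun y => F y a) x c = fderiv ℝ F x c a := by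
  rw [fderiv_clm_apply hF (differentiableAt_const a)]
  simp

theorem fderiv_apply₂_const {U : Type*} [NormedAddCommGroup U] [NormedSpace ℝ U]
    {F : W → V →L[ℝ] V' →L[ℝ] U} {x : W} (hF : DifferentiableAt ℝ F x)
    (c : W) (a : V) (b : V') :
    fderiv ℝ (fun y => F y a b) x c = fderiv ℝ F x c a b := by
  rw [fderiv_apply_const (F := fun y => F y a) (hF.clm_apply (differentiableAt_const a)),
    fderiv_apply_const hF]

end LocalCalculus

/-! ### The near-horizon metric in coordinates and its first derivatives -/

section NHGLocal

variable {E : Type*} [NormedAddCommGroup E] [NormedSpace ℝ E]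

/-- The near-horizon metric of data on an open subset of a vector space. -/
noncomputable def nhgLocal (G : E → E →L[ℝ] E →L[ℝ] ℝ) (s : E → E →L[ℝ] ℝ) (h : E → ℝ)
    (y : ℝ × ℝ × E) :
    (ℝ × ℝ × E) →L[ℝ] (ℝ × ℝ × E) →L[ℝ] ℝ :=
  nhgForm (G y.2.2) (s y.2.2) (h y.2.2) y.1

variable {G : E → E →L[ℝ] E →L[ℝ] ℝ} {s : E → E →L[ℝ] ℝ} {h : E → ℝ}

theorem nhgLocal_apply (y a b : ℝ × ℝ × E) :
    nhgLocal G s h y a b =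
      a.2.1 * b.1 + a.1 * b.2.1 + 2 * y.1 * (a.2.1 * s y.2.2 b.2.2 + b.2.1 * s y.2.2 a.2.2)
        + y.1 ^ 2 * h y.2.2 * (a.2.1 * b.2.1) + G y.2.2 a.2.2 b.2.2 :=
  nhgForm_apply _ _ _ _ _ _

theorem contDiffAt_nhgLocal [FiniteDimensional ℝ E] {n : WithTop ℕ∞} {y : ℝ × ℝ × E}
    (hG : ContDiffAt ℝ n G y.2.2)
    (hs : ContDiffAt ℝ n s y.2.2) (hh : ContDiffAt ℝ n h y.2.2) :
    ContDiffAt ℝ n (nhgLocal G s h) y := by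
  rw [contDiffAt_clm_apply₂_iff]
  intro a b
  simp only [nhgLocal_apply]
  have hp : ContDiffAt ℝ n (fun z : ℝ × ℝ × E => z.2.2) y := by fun_prop
  have h1 : ContDiffAt ℝ n (fun z : ℝ × ℝ × E => s z.2.2) y := hs.comp y hp
  have h2 : ContDiffAt ℝ n (fun z : ℝ × ℝ × E => G z.2.2) y := hG.comp y hp
  have h3 : ContDiffAt ℝ n (fun z : ℝ × ℝ × E => h z.2.2) y := hh.comp y hp
  fun_prop

theorem fderiv_nhgLocal_apply [FiniteDimensional ℝ E] {y : ℝ × ℝ × E}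
    (hG : ContDiffAt ℝ 1 G y.2.2)
    (hs : ContDiffAt ℝ 1 s y.2.2) (hh : ContDiffAt ℝ 1 h y.2.2) (c a b : ℝ × ℝ × E) :
    fderiv ℝ (nhgLocal G s h) y c a b =
      2 * c.1 * (a.2.1 * s y.2.2 b.2.2 + b.2.1 * s y.2.2 a.2.2)
      + 2 * y.1 * (a.2.1 * fderiv ℝ s y.2.2 c.2.2 b.2.2 + b.2.1 * fderiv ℝ s y.2.2 c.2.2 a.2.2)
      + (2 * y.1 * c.1 * h y.2.2 + y.1 ^ 2 * fderiv ℝ h y.2.2 c.2.2) * (a.2.1 * b.2.1)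
      + fderiv ℝ G y.2.2 c.2.2 a.2.2 b.2.2 := by
  rw [← fderiv_apply₂_const ((contDiffAt_nhgLocal hG hs hh).differentiableAt one_ne_zero)]
  simp only [nhgLocal_apply]
  have hp : HasFDerivAt (fun z : ℝ × ℝ × E => z.2.2)
      ((ContinuousLinearMap.snd ℝ ℝ E).comp (ContinuousLinearMap.snd ℝ ℝ (ℝ × E))) y :=
    hasFDerivAt_snd.comp y hasFDerivAt_snd
  have h0 : HasFDerivAt (fun z : ℝ × ℝ × E => z.1) (ContinuousLinearMap.fst ℝ ℝ (ℝ × E)) y :=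
    hasFDerivAt_fst
  have hs' := hs.differentiableAt one_ne_zero
  have hG' := hG.differentiableAt one_ne_zero
  have hc {k : E → ℝ} (hk : DifferentiableAt ℝ k y.2.2) :
      HasFDerivAt (fun z : ℝ × ℝ × E => k z.2.2) ((fderiv ℝ k y.2.2).comp
        ((ContinuousLinearMap.snd ℝ ℝ E).comp (ContinuousLinearMap.snd ℝ ℝ (ℝ × E)))) y :=
    hk.hasFDerivAt.comp y hp
  have h1 (v : E) := hc (hs'.clm_apply (differentiableAt_const v))
  have h2 (v w : E) := hc ((hG'.clm_apply (differentiableAt_const v)).clm_apply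
      (differentiableAt_const w))
  have h3 := hc (hh.differentiableAt one_ne_zero)
  have key := (((((h1 b.2.2).const_mul a.2.1).add ((h1 a.2.2).const_mul b.2.1)).fun_mul
    (h0.const_mul 2)).add (((h0.pow 2).fun_mul h3).mul_const (a.2.1 * b.2.1))).add (h2 a.2.2 b.2.2)
  have key2 := (key.const_add (a.2.1 * b.1 + a.1 * b.2.1)).fderiv
  have e : (fun x : ℝ × ℝ × E => a.2.1 * b.1 + a.1 * b.2.1
      + 2 * x.1 * (a.2.1 * (s x.2.2) b.2.2 + b.2.1 * (s x.2.2) a.2.2)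
      + x.1 ^ 2 * h x.2.2 * (a.2.1 * b.2.1) + ((G x.2.2) a.2.2) b.2.2) = fun x =>
      (a.2.1 * b.1 + a.1 * b.2.1) + ((((a.2.1 * (s x.2.2) b.2.2 + b.2.1 * (s x.2.2) a.2.2)
      * (2 * x.1))
      + x.1 ^ 2 * h x.2.2 * (a.2.1 * b.2.1)) + ((G x.2.2) a.2.2) b.2.2) := by
    ext x; ring
  rw [e]
  refine (DFunLike.congr_fun key2 c).trans ?_
  simp [fderiv_apply_const hs', fderiv_apply₂_const hG']
  ring

end NHGLocal

/-! ### Traces in block form and traces of skew maps -/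

section Trace

variable {M N : Type*} [AddCommGroup M] [Module ℝ M] [FiniteDimensional ℝ M]
  [AddCommGroup N] [Module ℝ N] [FiniteDimensional ℝ N]

theorem trace_prod (T : M × N →ₗ[ℝ] M × N) :
    LinearMap.trace ℝ (M × N) T =
      LinearMap.trace ℝ M (LinearMap.fst ℝ M N ∘ₗ T ∘ₗ LinearMap.inl ℝ M N)
        + LinearMap.trace ℝ N (LinearMap.snd ℝ M N ∘ₗ T ∘ₗ LinearMap.inr ℝ M N) := by
  have e : T = LinearMap.inl ℝ M N ∘ₗ (LinearMap.fst ℝ M N ∘ₗ T)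
      + LinearMap.inr ℝ M N ∘ₗ (LinearMap.snd ℝ M N ∘ₗ T) := by
    ext x <;> simp
  conv_lhs => rw [e, map_add, LinearMap.trace_comp_comm', LinearMap.trace_comp_comm' _
    (LinearMap.inr ℝ M N)]
  rfl

theorem trace_real (T : ℝ →ₗ[ℝ] ℝ) : LinearMap.trace ℝ ℝ T = T 1 := by
  have : T = T 1 • LinearMap.id := by ext; simp
  rw [this, map_smul, LinearMap.trace_id]; simp

theorem trace_spacetime {E : Type*} [NormedAddCommGroup E] [NormedSpace ℝ E]
    [FiniteDimensional ℝ E] (T : (ℝ × ℝ × E) →L[ℝ] (ℝ × ℝ × E)) (T' : E →L[ℝ] E)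
    (hT : ∀ a : E, (T (0, 0, a)).2.2 = T' a) :
    LinearMap.trace ℝ (ℝ × ℝ × E) (T : (ℝ × ℝ × E) →ₗ[ℝ] (ℝ × ℝ × E)) =
      (T (1, 0, 0)).1 + (T (0, 1, 0)).2.1 + LinearMap.trace ℝ E (T' : E →ₗ[ℝ] E) := by
  rw [trace_prod, trace_prod, trace_real, trace_real, ← add_assoc]
  congr 1
  congr 1
  ext a
  simp [hT]

/-- Skewness says that `g` conjugates `-T` into the transpose of `T`, and transposition and
conjugation both preserve the trace. Neither symmetry nor definiteness of `g` is needed, so this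
applies to a Lorentzian form. -/
theorem trace_eq_zero_of_skew {V : Type*} [AddCommGroup V] [Module ℝ V] [FiniteDimensional ℝ V]
    (g : V →ₗ[ℝ] V →ₗ[ℝ] ℝ) (hg : Function.Injective g) (T : V →ₗ[ℝ] V)
    (h : ∀ a b, g (T a) b = -g a (T b)) : LinearMap.trace ℝ V T = 0 := by
  let e : V ≃ₗ[ℝ] Module.Dual ℝ V :=
    LinearEquiv.ofInjectiveOfFinrankEq g hg (Subspace.dual_finrank_eq (K := ℝ) (V := V)).symm
  have h1 : Module.Dual.transpose (R := ℝ) T = -(e.conj T) := by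
    ext l b
    obtain ⟨a, rfl⟩ := e.surjective l
    have h2 : e (T a) b = -(e a (T b)) := h a b
    simp [Module.Dual.transpose_apply, LinearEquiv.conj_apply, h2]
  have h3 := LinearMap.trace_transpose' (R := ℝ) T
  rw [h1, map_neg, LinearMap.trace_conj'] at h3
  linarith

end Trace

/-! ### Christoffel symbols, and the Ricci tensor along a translation symmetry -/

section Christoffel

variable {V : Type*} [NormedAddCommGroup V] [NormedSpace ℝ V]

theorem christoffel_spec {G : V → V →L[ℝ] V →L[ℝ] ℝ} {y : V} (hG : (G y).IsInvertible)
    (a b c : V) : G y (christoffel G y a b) c = christoffelLower G y a b c := by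
  rw [christoffel_apply, hG.self_apply_inverse]

theorem eventually_isInvertible [CompleteSpace V] {G : V → V →L[ℝ] V →L[ℝ] ℝ} {y : V}
    (hG : ContinuousAt G y) (h : (G y).IsInvertible) : ∀ᶠ z in 𝓝 y, (G z).IsInvertible := by
  obtain ⟨e, he⟩ := h
  have : range ((↑) : (V ≃L[ℝ] (V →L[ℝ] ℝ)) → V →L[ℝ] V →L[ℝ] ℝ) ∈ 𝓝 (G y) := by
    rw [← he]; exact e.nhds
  filter_upwards [hG this] with z hz
  obtain ⟨e', he'⟩ := hz
  exact ⟨e', he'⟩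

theorem isInvertible_of_injective [FiniteDimensional ℝ V] {B : V →L[ℝ] V →L[ℝ] ℝ}
    (hB : Function.Injective B) : B.IsInvertible := by
  have hd : Module.finrank ℝ V = Module.finrank ℝ (V →L[ℝ] ℝ) := by
    rw [← (LinearMap.toContinuousLinearMap (𝕜 := ℝ) (E := V) (F' := ℝ)).finrank_eq]
    exact (Subspace.dual_finrank_eq (K := ℝ) (V := V)).symm
  exact ⟨(LinearEquiv.ofInjectiveOfFinrankEq (B : V →ₗ[ℝ] V →L[ℝ] ℝ) hB
    hd).toContinuousLinearEquiv, by ext; rfl⟩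

theorem isInvertible_of_pos [FiniteDimensional ℝ V] {B : V →L[ℝ] V →L[ℝ] ℝ}
    (hB : ∀ a, a ≠ 0 → 0 < B a a) : B.IsInvertible := by
  refine isInvertible_of_injective ((injective_iff_map_eq_zero _).2 fun a ha => ?_)
  by_contra h
  simpa [ha] using hB a h

theorem fderiv_symm_of_eventually {G : V → V →L[ℝ] V →L[ℝ] ℝ} {y : V}
    (hG : DifferentiableAt ℝ G y) (hs : ∀ᶠ z in 𝓝 y, ∀ a b, G z a b = G z b a) (c a b : V) :
    fderiv ℝ G y c a b = fderiv ℝ G y c b a := by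
  rw [← fderiv_apply₂_const hG, ← fderiv_apply₂_const hG]
  congr 1
  exact Filter.EventuallyEq.fderiv_eq (hs.mono fun z hz => hz a b)

theorem christoffelLower_symm {G : V → V →L[ℝ] V →L[ℝ] ℝ} {y : V}
    (hs : ∀ c a b, fderiv ℝ G y c a b = fderiv ℝ G y c b a) (a b : V) :
    christoffelLower G y a b = christoffelLower G y b a := by
  ext c
  rw [christoffelLower_apply, christoffelLower_apply, hs c a b]; ring

theorem christoffel_symm {G : V → V →L[ℝ] V →L[ℝ] ℝ} {y : V}
    (hs : ∀ c a b, fderiv ℝ G y c a b = fderiv ℝ G y c b a) (a b : V) :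
    christoffel G y a b = christoffel G y b a := by
  rw [christoffel_apply, christoffel_apply, christoffelLower_symm hs]

theorem contDiffAt_christoffelLower [FiniteDimensional ℝ V] {G : V → V →L[ℝ] V →L[ℝ] ℝ} {y : V}
    (hG : ContDiffAt ℝ 2 G y) : ContDiffAt ℝ 1 (christoffelLower G) y := by
  have h1 : ContDiffAt ℝ 1 (fderiv ℝ G) y := hG.fderiv_right (by norm_num)
  rw [contDiffAt_clm_apply₂_iff]
  intro a b
  rw [contDiffAt_clm_apply_iff]
  intro c
  simp only [christoffelLower_apply]
  have h2 (a b c : V) : ContDiffAt ℝ 1 (fun z => fderiv ℝ G z a b c) y :=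
    ((h1.clm_apply contDiffAt_const).clm_apply contDiffAt_const).clm_apply contDiffAt_const
  exact contDiffAt_const.mul (((h2 a b c).add (h2 b a c)).sub (h2 c a b))

theorem contDiffAt_christoffel [FiniteDimensional ℝ V] {G : V → V →L[ℝ] V →L[ℝ] ℝ} {y : V}
    (hG : ContDiffAt ℝ 2 G y) (hi : (G y).IsInvertible) :
    ContDiffAt ℝ 1 (christoffel G) y := by
  rw [contDiffAt_clm_apply₂_iff]
  intro a b
  simp only [christoffel_apply]
  have h2 : ContDiffAt ℝ 1 (fun z => (G z).inverse) y :=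
    (hi.contDiffAt_map_inverse).comp y (hG.of_le (by norm_num))
  exact h2.clm_apply (((contDiffAt_christoffelLower hG).clm_apply
    contDiffAt_const).clm_apply contDiffAt_const)

/-- The product rule applied to `G (Γ(b, c), d) = christoffelLower G b c d`. It gives derivatives of
`Γ` without differentiating the inverse metric. -/
theorem fderiv_christoffel_spec [FiniteDimensional ℝ V] {G : V → V →L[ℝ] V →L[ℝ] ℝ} {y : V}
    (hG : ContDiffAt ℝ 2 G y) (hi : (G y).IsInvertible) (a b c d : V) :
    fderiv ℝ G y a (christoffel G y b c) d + G y (fderiv ℝ (christoffel G) y a b c) d =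
      fderiv ℝ (fun z => christoffelLower G z b c d) y a := by
  have hev : (fun z => G z (christoffel G z b c) d) =ᶠ[𝓝 y]
      fun z => christoffelLower G z b c d := by
    filter_upwards [eventually_isInvertible hG.continuousAt hi] with z hz
    exact christoffel_spec hz b c d
  have hG1 : DifferentiableAt ℝ G y := hG.differentiableAt (by norm_num)
  have hΓ : DifferentiableAt ℝ (christoffel G) y :=
    (contDiffAt_christoffel hG hi).differentiableAt one_ne_zero
  have hΓ' : DifferentiableAt ℝ (fun z => christoffel G z b c) y := by fun_prop
  have e : fderiv ℝ (fun z => christoffel G z b c) y a = fderiv ℝ (christoffel G) y a b c :=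
    fderiv_apply₂_const hΓ a b c
  rw [← hev.fderiv_eq, fderiv_apply_const (F := fun z => G z (christoffel G z b c))
    (hG1.clm_apply hΓ'), fderiv_clm_apply hG1 hΓ', ← e]
  simp [add_comm]

variable {G : V → V →L[ℝ] V →L[ℝ] ℝ} {e : V}

theorem fderiv_of_translation_invariant {W : Type*} [NormedAddCommGroup W] [NormedSpace ℝ W]
    {F : V → W} (ht : ∀ z (t : ℝ), F (z + t • e) = F z) (y : V) : fderiv ℝ F y e = 0 := by
  by_cases hF : DifferentiableAt ℝ F y
  · have h1 : HasDerivAt (fun t : ℝ => y + t • e) e 0 := by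
      simpa using ((hasDerivAt_id (0 : ℝ)).smul_const e).const_add y
    have h2 : HasFDerivAt F (fderiv ℝ F y) (y + (0 : ℝ) • e) := by simpa using hF.hasFDerivAt
    have h3 := h2.comp_hasDerivAt (0 : ℝ) h1
    have h4 : (F ∘ fun t : ℝ => y + t • e) = fun _ => F y := by ext t; exact ht y t
    rw [h4] at h3
    exact h3.unique (hasDerivAt_const _ _)
  · simp [fderiv_zero_of_not_differentiableAt hF]

theorem christoffel_translation_invariant (ht : ∀ z (t : ℝ), G (z + t • e) = G z) (z : V) (t : ℝ) :
    christoffel G (z + t • e) = christoffel G z := by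
  have h1 : fderiv ℝ G (z + t • e) = fderiv ℝ G z := by
    rw [← fderiv_comp_add_right]
    congr 1
    ext1 x
    exact ht x t
  simp only [christoffel, christoffelLower, h1, ht]

/-- Since `∂_e G = 0`, the lower symbols with first slot `e` are antisymmetric in the other two, so
`Γ(e, ·)` is skew for `G`. -/
theorem trace_christoffel_of_translation_invariant [FiniteDimensional ℝ V]
    (ht : ∀ z (t : ℝ), G (z + t • e) = G z) {y : V} (hi : (G y).IsInvertible)
    (hsy : ∀ a b, G y a b = G y b a) :
    LinearMap.trace ℝ V (christoffel G y e : V →ₗ[ℝ] V) = 0 := by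
  refine trace_eq_zero_of_skew
    (LinearMap.mk₂ ℝ (fun a b => G y a b) (by simp) (by simp) (by simp) (by simp)) ?_ _ ?_
  · intro a b hab
    refine hi.injective ?_
    ext c
    exact LinearMap.congr_fun hab c
  · intro a b
    have h0 : fderiv ℝ G y e = 0 := fderiv_of_translation_invariant ht y
    simp only [LinearMap.mk₂_apply, ContinuousLinearMap.coe_coe]
    rw [hsy a, christoffel_spec hi, christoffel_spec hi, christoffelLower_apply,
      christoffelLower_apply, h0]
    simp
    ring

/-- As `∂_e Γ = 0`, the two Ricci components differ by `-∂_b (tr Γ(e, ·))` and the trace of a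
commutator; both vanish. Only this case of the symmetry of the Ricci tensor is needed, with `e =
∂_v`. -/
theorem ricci_symm_of_translation_invariant [FiniteDimensional ℝ V]
    (ht : ∀ z (t : ℝ), G (z + t • e) = G z) {y : V} (hG : ContDiffAt ℝ 2 G y)
    (hi : (G y).IsInvertible) (hs : ∀ᶠ z in 𝓝 y, ∀ a b, G z a b = G z b a) (b : V) :
    ricciLocal G y b e = ricciLocal G y e b := by
  have hΓ : DifferentiableAt ℝ (christoffel G) y :=
    (contDiffAt_christoffel hG hi).differentiableAt one_ne_zero
  have hG1 : ∀ᶠ z in 𝓝 y, DifferentiableAt ℝ G z :=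
    (hG.eventually (by simp)).mono fun z hz => hz.differentiableAt (by norm_num)
  have hsym : ∀ᶠ z in 𝓝 y, ∀ c a b, fderiv ℝ G z c a b = fderiv ℝ G z c b a := by
    filter_upwards [hs.eventually_nhds, hG1] with z hz hz1 c a b
    exact fderiv_symm_of_eventually hz1 hz c a b
  have hΓs : ∀ᶠ z in 𝓝 y, ∀ a b, christoffel G z a b = christoffel G z b a :=
    hsym.mono fun z hz a b => christoffel_symm hz a b
  have hΓd (c a b : V) : fderiv ℝ (christoffel G) y c a b = fderiv ℝ (christoffel G) y c b a := by
    rw [← fderiv_apply₂_const hΓ, ← fderiv_apply₂_const hΓ]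
    congr 1
    exact Filter.EventuallyEq.fderiv_eq (hΓs.mono fun z hz => hz a b)
  have hinv : fderiv ℝ (christoffel G) y e = 0 :=
    fderiv_of_translation_invariant (christoffel_translation_invariant ht) y
  have htr : (fun z => LinearMap.trace ℝ V (christoffel G z e : V →ₗ[ℝ] V)) =ᶠ[𝓝 y]
      fun _ => 0 := by
    filter_upwards [eventually_isInvertible hG.continuousAt hi, hs] with z h1 h2
    exact trace_christoffel_of_translation_invariant ht h1 h2
  let tr : (V →L[ℝ] V) →L[ℝ] ℝ := LinearMap.toContinuousLinearMap
    ((LinearMap.trace ℝ V) ∘ₗ (ContinuousLinearMap.coeLM (R := ℝ) (M := V) (N₃ := V) ℝ))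
  have htr2 : tr (fderiv ℝ (christoffel G) y b e) = 0 := by
    have h1 : fderiv ℝ (fun z => tr (christoffel G z e)) y b = 0 := by
      have := htr.fderiv_eq (𝕜 := ℝ)
      rw [show (fun z => tr (christoffel G z e)) =
        fun z => LinearMap.trace ℝ V (christoffel G z e : V →ₗ[ℝ] V) from rfl, this]
      simp
    have h2 : HasFDerivAt (fun z => christoffel G z e) (fderiv ℝ (fun z => christoffel G z e) y) y :=
      (hΓ.clm_apply (differentiableAt_const e)).hasFDerivAt
    have h3 : HasFDerivAt (fun z => tr (christoffel G z e))
      (tr ∘L fderiv ℝ (fun z => christoffel G z e) y) y := tr.hasFDerivAt.comp y h2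
    rw [h3.fderiv] at h1
    simpa [fderiv_apply_const hΓ] using h1
  have hmul (A B : V →L[ℝ] V) : tr (A ∘L B) = tr (B ∘L A) :=
    LinearMap.trace_mul_comm ℝ (A : V →ₗ[ℝ] V) (B : V →ₗ[ℝ] V)
  have h1 : riemannOp G y b e - riemannOp G y e b = -(fderiv ℝ (christoffel G) y b e)
      - (christoffel G y b ∘L christoffel G y e) + (christoffel G y e ∘L christoffel G y b) := by
    have hs0 := hΓs.self_of_nhds
    ext a
    simp only [sub_apply, riemannOp_apply, add_apply, neg_apply,
      ContinuousLinearMap.comp_apply, hinv, zero_apply]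
    rw [hΓd a e b, hΓd b a e, hs0 a e, hs0 a b, hs0 b e]
    abel
  have h2 : tr (riemannOp G y b e) - tr (riemannOp G y e b) = 0 := by
    rw [← map_sub, h1, map_add, map_sub, map_neg, htr2, hmul]
    ring
  exact sub_eq_zero.1 h2

end Christoffel

/-! ### Connection and Ricci curvature on the horizon -/

section HorizonCurvature

variable {E : Type*} [NormedAddCommGroup E] [NormedSpace ℝ E]

/-- Near `x`, the data are smooth, and `G` is a Riemannian metric. -/
structure LocalData (G : E → E →L[ℝ] E →L[ℝ] ℝ) (s : E → E →L[ℝ] ℝ) (h : E → ℝ) (x : E) :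
    Prop where
  smooth_G : ContDiffAt ℝ ∞ G x
  smooth_s : ContDiffAt ℝ ∞ s x
  smooth_h : ContDiffAt ℝ ∞ h x
  symm : ∀ᶠ z in 𝓝 x, ∀ a b, G z a b = G z b a
  pos : ∀ a, a ≠ 0 → 0 < G x a a

theorem tendsto_snd_snd (y : ℝ × ℝ × E) :
    Tendsto (fun z : ℝ × ℝ × E => z.2.2) (𝓝 y) (𝓝 y.2.2) :=
  (continuous_snd.comp continuous_snd).continuousAt

variable [FiniteDimensional ℝ E] {G : E → E →L[ℝ] E →L[ℝ] ℝ} {s : E → E →L[ℝ] ℝ} {h : E → ℝ}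

theorem LocalData.isInvertible {x : E} (hd : LocalData G s h x) : (G x).IsInvertible :=
  isInvertible_of_pos hd.pos

theorem LocalData.isInvertible_nhgLocal {y : ℝ × ℝ × E} (hd : LocalData G s h y.2.2) :
    (nhgLocal G s h y).IsInvertible := by
  refine isInvertible_of_injective ((injective_iff_map_eq_zero _).2 fun a ha => ?_)
  have key (b : ℝ × ℝ × E) : nhgLocal G s h y a b = 0 := by rw [ha]; rfl
  simp only [nhgLocal_apply] at key
  have h1 : a.2.1 = 0 := by simpa using key (1, 0, 0)
  have h2 : a.2.2 = 0 := by
    by_contra hne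
    have := key (0, 0, a.2.2)
    simp [h1] at this
    exact (hd.pos _ hne).ne' this
  have h3 : a.1 = 0 := by simpa [h1, h2] using key (0, 1, 0)
  exact Prod.ext h3 (Prod.ext h1 h2)

theorem LocalData.symm_nhgLocal {y : ℝ × ℝ × E} (hd : LocalData G s h y.2.2) :
    ∀ᶠ z in 𝓝 y, ∀ a b, nhgLocal G s h z a b = nhgLocal G s h z b a := by
  filter_upwards [(tendsto_snd_snd y).eventually hd.symm] with z hz a b
  rw [nhgLocal_apply, nhgLocal_apply, hz a.2.2]
  ring

theorem LocalData.contDiffAt_nhgLocal {y : ℝ × ℝ × E} (hd : LocalData G s h y.2.2) :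
    ContDiffAt ℝ ∞ (nhgLocal G s h) y :=
  NHG.contDiffAt_nhgLocal hd.smooth_G hd.smooth_s hd.smooth_h

theorem LocalData.fderiv_nhgLocal {y : ℝ × ℝ × E} (hd : LocalData G s h y.2.2)
    (c a b : ℝ × ℝ × E) :
    fderiv ℝ (nhgLocal G s h) y c a b =
      2 * c.1 * (a.2.1 * s y.2.2 b.2.2 + b.2.1 * s y.2.2 a.2.2)
      + 2 * y.1 * (a.2.1 * fderiv ℝ s y.2.2 c.2.2 b.2.2 + b.2.1 * fderiv ℝ s y.2.2 c.2.2 a.2.2)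
      + (2 * y.1 * c.1 * h y.2.2 + y.1 ^ 2 * fderiv ℝ h y.2.2 c.2.2) * (a.2.1 * b.2.1)
      + fderiv ℝ G y.2.2 c.2.2 a.2.2 b.2.2 :=
  fderiv_nhgLocal_apply (hd.smooth_G.of_le (by simp)) (hd.smooth_s.of_le (by simp))
    (hd.smooth_h.of_le (by simp)) c a b

theorem LocalData.fderiv_symm {x : E} (hd : LocalData G s h x) (c a b : E) :
    fderiv ℝ G x c a b = fderiv ℝ G x c b a :=
  fderiv_symm_of_eventually (hd.smooth_G.differentiableAt (by simp)) hd.symm c a b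

theorem nhgLocal_add_smul_dv (z : ℝ × ℝ × E) (t : ℝ) :
    nhgLocal G s h (z + t • ((0, 1, 0) : ℝ × ℝ × E)) = nhgLocal G s h z := by
  simp [nhgLocal]

theorem LocalData.christoffelLower_dv {y : ℝ × ℝ × E} (hd : LocalData G s h y.2.2)
    (b c : ℝ × ℝ × E) :
    christoffelLower (nhgLocal G s h) y (0, 1, 0) b c =
      b.1 * s y.2.2 c.2.2 - c.1 * s y.2.2 b.2.2
      + y.1 * (fderiv ℝ s y.2.2 b.2.2 c.2.2 - fderiv ℝ s y.2.2 c.2.2 b.2.2)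
      + y.1 * h y.2.2 * (b.1 * c.2.1 - c.1 * b.2.1)
      + y.1 ^ 2 / 2 * (fderiv ℝ h y.2.2 b.2.2 * c.2.1 - fderiv ℝ h y.2.2 c.2.2 * b.2.1) := by
  rw [christoffelLower_apply, hd.fderiv_nhgLocal, hd.fderiv_nhgLocal, hd.fderiv_nhgLocal]
  simp
  ring

/-- The components of a vector, read off with the metric on the horizon. -/
theorem nhgLocal_horizon_apply (v : ℝ) (x : E) (Z : ℝ × ℝ × E) :
    nhgLocal G s h (0, v, x) Z (0, 1, 0) = Z.1 ∧ nhgLocal G s h (0, v, x) Z (1, 0, 0) = Z.2.1 ∧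
      ∀ d : E, nhgLocal G s h (0, v, x) Z (0, 0, d) = G x Z.2.2 d := by
  simp [nhgLocal_apply]

variable {v : ℝ} {x : E}

/-- Both sides are paired with the nondegenerate metric, and the lower symbols are evaluated at `u =
0`. In particular `∇_X ∂_v = -s(X) ∂_v` for `X` tangent to the horizon, which is where the torsion
appears. -/
theorem LocalData.christoffel_dv (hd : LocalData G s h x) (b : ℝ × ℝ × E) :
    christoffel (nhgLocal G s h) (0, v, x) (0, 1, 0) b =
      (0, -s x b.2.2, b.1 • (G x).inverse (s x)) := by
  have hi : (nhgLocal G s h (0, v, x)).IsInvertible :=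
    LocalData.isInvertible_nhgLocal (y := (0, v, x)) hd
  rw [christoffel_apply]
  apply hi.injective
  rw [hi.self_apply_inverse]
  ext c
  · rw [ContinuousLinearMap.comp_apply, ContinuousLinearMap.comp_apply,
      LocalData.christoffelLower_dv (y := (0, v, x)) hd]
    simp [nhgLocal_apply]
  · rw [ContinuousLinearMap.comp_apply, ContinuousLinearMap.comp_apply,
      ContinuousLinearMap.comp_apply, ContinuousLinearMap.comp_apply,
      LocalData.christoffelLower_dv (y := (0, v, x)) hd]
    simp [nhgLocal_apply]
  · rw [ContinuousLinearMap.comp_apply, ContinuousLinearMap.comp_apply,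
      ContinuousLinearMap.comp_apply, ContinuousLinearMap.comp_apply,
      LocalData.christoffelLower_dv (y := (0, v, x)) hd]
    simp [nhgLocal_apply, hd.isInvertible.self_apply_inverse]

theorem LocalData.christoffel_symm (hd : LocalData G s h x) (a b : ℝ × ℝ × E) :
    christoffel (nhgLocal G s h) (0, v, x) a b = christoffel (nhgLocal G s h) (0, v, x) b a :=
  NHG.christoffel_symm (fun c a b => fderiv_symm_of_eventually
    ((LocalData.contDiffAt_nhgLocal (y := (0, v, x)) hd).differentiableAt (by simp))
    (LocalData.symm_nhgLocal (y := (0, v, x)) hd) c a b) a b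

/-- The curvature needs the derivative across the horizon, so the formula for the lower symbols is
first established on a whole neighbourhood; the terms of order `u²` drop out at `u = 0`. This is how
`h` enters the Ricci tensor. -/
theorem LocalData.fderiv_christoffelLower_dv (hd : LocalData G s h x) (a b c : ℝ × ℝ × E) :
    fderiv ℝ (fun z => christoffelLower (nhgLocal G s h) z (0, 1, 0) b c) (0, v, x) a =
      b.1 * fderiv ℝ s x a.2.2 c.2.2 - c.1 * fderiv ℝ s x a.2.2 b.2.2
      + a.1 * (fderiv ℝ s x b.2.2 c.2.2 - fderiv ℝ s x c.2.2 b.2.2)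
      + a.1 * h x * (b.1 * c.2.1 - c.1 * b.2.1) := by
  have hd' : ∀ᶠ z in 𝓝 x, ContDiffAt ℝ 1 G z ∧ ContDiffAt ℝ 1 s z ∧ ContDiffAt ℝ 1 h z := by
    filter_upwards [(hd.smooth_G.of_le (m := 1) (by simp)).eventually (by simp),
      (hd.smooth_s.of_le (m := 1) (by simp)).eventually (by simp),
      (hd.smooth_h.of_le (m := 1) (by simp)).eventually (by simp)] with z h1 h2 h3
    exact ⟨h1, h2, h3⟩
  have hev : (fun z => christoffelLower (nhgLocal G s h) z (0, 1, 0) b c) =ᶠ[𝓝 (0, v, x)]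
      fun z => (b.1 * s z.2.2 c.2.2 - c.1 * s z.2.2 b.2.2)
      + (z.1 * ((fderiv ℝ s z.2.2 b.2.2 c.2.2 - fderiv ℝ s z.2.2 c.2.2 b.2.2)
        + h z.2.2 * (b.1 * c.2.1 - c.1 * b.2.1))
      + z.1 ^ 2 * (1 / 2 * (fderiv ℝ h z.2.2 b.2.2 * c.2.1 - fderiv ℝ h z.2.2 c.2.2 * b.2.1))) := by
    filter_upwards [(tendsto_snd_snd ((0, v, x) : ℝ × ℝ × E)).eventually hd'] with z hz
    rw [christoffelLower_apply, fderiv_nhgLocal_apply hz.1 hz.2.1 hz.2.2,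
      fderiv_nhgLocal_apply hz.1 hz.2.1 hz.2.2, fderiv_nhgLocal_apply hz.1 hz.2.1 hz.2.2]
    simp
    ring
  rw [hev.fderiv_eq]
  have hs' : DifferentiableAt ℝ s x := hd.smooth_s.differentiableAt (by simp)
  have hds : DifferentiableAt ℝ (fderiv ℝ s) x :=
    (hd.smooth_s.fderiv_right (m := ∞) le_rfl).differentiableAt (by simp)
  have hdh : DifferentiableAt ℝ (fderiv ℝ h) x :=
    (hd.smooth_h.fderiv_right (m := ∞) le_rfl).differentiableAt (by simp)
  have hh : DifferentiableAt ℝ h x := hd.smooth_h.differentiableAt (by simp)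
  have hp : HasFDerivAt (fun z : ℝ × ℝ × E => z.2.2)
      ((ContinuousLinearMap.snd ℝ ℝ E).comp (ContinuousLinearMap.snd ℝ ℝ (ℝ × E))) (0, v, x) :=
    hasFDerivAt_snd.comp _ hasFDerivAt_snd
  have h0 : HasFDerivAt (fun z : ℝ × ℝ × E => z.1) (ContinuousLinearMap.fst ℝ ℝ (ℝ × E))
      (0, v, x) := hasFDerivAt_fst
  have hc {k : E → ℝ} (hk : DifferentiableAt ℝ k x) :
      HasFDerivAt (fun z : ℝ × ℝ × E => k z.2.2) ((fderiv ℝ k x).comp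
        ((ContinuousLinearMap.snd ℝ ℝ E).comp (ContinuousLinearMap.snd ℝ ℝ (ℝ × E))))
        (0, v, x) := HasFDerivAt.comp (g := k) (0, v, x) hk.hasFDerivAt hp
  have h1 (w : E) := hc (hs'.clm_apply (differentiableAt_const w))
  have h2 := hc (k := fun z => (fderiv ℝ s z b.2.2 c.2.2 - fderiv ℝ s z c.2.2 b.2.2)
        + h z * (b.1 * c.2.1 - c.1 * b.2.1)) (by fun_prop)
  have h3 := hc (k := fun z => 1 / 2 * (fderiv ℝ h z b.2.2 * c.2.1 - fderiv ℝ h z c.2.2 * b.2.1))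
    (by fun_prop)
  have key := ((((h1 c.2.2).const_mul b.1).sub ((h1 b.2.2).const_mul c.1)).add
    ((h0.fun_mul h2).add ((h0.pow 2).fun_mul h3))).fderiv
  refine (DFunLike.congr_fun key a).trans ?_
  simp [fderiv_apply_const hs']
  ring

theorem LocalData.fderiv_nhgLocal_horizon (hd : LocalData G s h x) (c a b : ℝ × ℝ × E) :
    fderiv ℝ (nhgLocal G s h) (0, v, x) c a b =
      2 * c.1 * (a.2.1 * s x b.2.2 + b.2.1 * s x a.2.2) + fderiv ℝ G x c.2.2 a.2.2 b.2.2 := by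
  rw [LocalData.fderiv_nhgLocal (y := (0, v, x)) hd]
  simp

/-- The `v`-component is omitted: it does not contribute to the traces below. -/
theorem LocalData.christoffel_horizon (hd : LocalData G s h x) (a b : ℝ × ℝ × E) :
    (christoffel (nhgLocal G s h) (0, v, x) a b).1 = a.1 * s x b.2.2 + b.1 * s x a.2.2 ∧
    (christoffel (nhgLocal G s h) (0, v, x) a b).2.2 =
      christoffel G x a.2.2 b.2.2 + (a.1 * b.2.1 + b.1 * a.2.1) • (G x).inverse (s x) := by
  have hi : (nhgLocal G s h (0, v, x)).IsInvertible :=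
    LocalData.isInvertible_nhgLocal (y := (0, v, x)) hd
  obtain ⟨h1, -, h3⟩ := nhgLocal_horizon_apply (G := G) (s := s) (h := h) v x
    (christoffel (nhgLocal G s h) (0, v, x) a b)
  constructor
  · rw [← h1, christoffel_spec hi, christoffelLower_apply]
    simp only [hd.fderiv_nhgLocal_horizon]
    simp
    ring
  · apply hd.isInvertible.injective
    ext d
    rw [← h3, christoffel_spec hi, christoffelLower_apply]
    simp only [hd.fderiv_nhgLocal_horizon]
    simp [hd.isInvertible.self_apply_inverse, christoffel_spec hd.isInvertible,
      christoffelLower_apply]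
    ring

/-- The trace of `a ↦ R(a, ∂_v) c` is split into its `u`, `v` and `E` blocks. With `k = s^♯` they
contribute `c^u (h - s(k))`, `0` and `c^u (div s - s(k))`. -/
theorem LocalData.ricci_dv (hd : LocalData G s h x) (c : ℝ × ℝ × E) :
    ricciLocal (nhgLocal G s h) (0, v, x) (0, 1, 0) c =
      c.1 * (h x - 2 * s x ((G x).inverse (s x)) + traceWith (G x) (fderiv ℝ s x
        - (ContinuousLinearMap.compL ℝ E E ℝ (s x)) ∘L (christoffel G x))) := by
  set 𝒢 := nhgLocal G s h with h𝒢
  set y : ℝ × ℝ × E := (0, v, x) with hy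
  set k := (G x).inverse (s x) with hk
  have hiG := hd.isInvertible
  have hi : (𝒢 y).IsInvertible := LocalData.isInvertible_nhgLocal (y := (0, v, x)) hd
  have hC : ContDiffAt ℝ 2 𝒢 y :=
    (LocalData.contDiffAt_nhgLocal (y := (0, v, x)) hd).of_le ENat.LEInfty.out
  have hGk (d : E) : G x k d = s x d := by rw [hk, hiG.self_apply_inverse]
  have hGsymm (a b : E) : G x a b = G x b a := hd.symm.self_of_nhds a b
  have hinv : fderiv ℝ (christoffel 𝒢) y (0, 1, 0) = 0 :=
    fderiv_of_translation_invariant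
      (christoffel_translation_invariant nhgLocal_add_smul_dv) y
  have hX : christoffel 𝒢 y (0, 1, 0) c = (0, -s x c.2.2, c.1 • k) := hd.christoffel_dv c
  -- The only derivative of the Christoffel symbols that survives, since they do not depend on `v`.
  let T : (ℝ × ℝ × E) → (ℝ × ℝ × E) := fun a => fderiv ℝ (christoffel 𝒢) y a (0, 1, 0) c
  have hT (a d : ℝ × ℝ × E) : 𝒢 y (T a) d =
      c.1 * fderiv ℝ s x a.2.2 d.2.2 - d.1 * fderiv ℝ s x a.2.2 c.2.2
      + a.1 * (fderiv ℝ s x c.2.2 d.2.2 - fderiv ℝ s x d.2.2 c.2.2)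
      + a.1 * h x * (c.1 * d.2.1 - d.1 * c.2.1)
      - (2 * a.1 * (-s x c.2.2 * s x d.2.2 + d.2.1 * (c.1 * s x k))
        + c.1 * fderiv ℝ G x a.2.2 k d.2.2) := by
    have h1 := fderiv_christoffel_spec hC hi a (0, 1, 0) c d
    rw [hd.fderiv_christoffelLower_dv, hX, hd.fderiv_nhgLocal_horizon] at h1
    simp only [map_smul, smul_apply, smul_eq_mul] at h1
    linear_combination h1
  have hop (a : ℝ × ℝ × E) : riemannOp 𝒢 y (0, 1, 0) c a =
      T a + christoffel 𝒢 y a (0, -s x c.2.2, c.1 • k)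
        - (0, -s x (christoffel 𝒢 y a c).2.2, (christoffel 𝒢 y a c).1 • k) := by
    rw [riemannOp_apply, hinv, hX, hd.christoffel_dv]
    simp [T, hk]
  rw [ricciLocal_apply]
  let D : E →L[ℝ] E →L[ℝ] ℝ := fderiv ℝ s x
        - (ContinuousLinearMap.compL ℝ E E ℝ (s x)) ∘L (christoffel G x)
  have hcomp (Z : ℝ × ℝ × E) : 𝒢 y Z (0, 1, 0) = Z.1 ∧ 𝒢 y Z (1, 0, 0) = Z.2.1 ∧
      ∀ d : E, 𝒢 y Z (0, 0, d) = G x Z.2.2 d := nhgLocal_horizon_apply v x Z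
  rw [trace_spacetime _ (c.1 • ((G x).inverse ∘L D) - (c.1 • s x).smulRight k)]
  · have e1 : (T (1, 0, 0)).1 = h x * c.1 - 2 * (c.1 * s x k) := by
      rw [← (hcomp _).1, hT]; simp
    have e2 : (T (0, 1, 0)).2.1 = 0 := by
      rw [← (hcomp _).2.1, hT]; simp
    have e3 : LinearMap.trace ℝ E ((c.1 • ((G x).inverse ∘L D) - (c.1 • s x).smulRight k :
        E →L[ℝ] E) : E →ₗ[ℝ] E) = c.1 * traceWith (G x) D - c.1 * s x k := by
      have := LinearMap.trace_smulRight ((c.1 • s x : E →L[ℝ] ℝ) : E →ₗ[ℝ] ℝ) k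
      rw [ContinuousLinearMap.toLinearMap_sub, ContinuousLinearMap.toLinearMap_smul, map_sub, map_smul]
      refine congrArg₂ _ rfl (Eq.trans ?_ this)
      rfl
    rw [e3, hop, hop, hX]
    have e4 : (christoffel 𝒢 y (1, 0, 0) (0, -s x c.2.2, c.1 • k)).1 = c.1 * s x k := by
      rw [(hd.christoffel_horizon _ _).1]; simp
    have e5 : christoffel 𝒢 y (0, 1, 0) (0, -s x c.2.2, c.1 • k) = _ := hd.christoffel_dv _
    simp [e1, e2, e4, e5]
    ring
  · intro a
    rw [hop]
    obtain ⟨e1, -⟩ := hd.christoffel_horizon (v := v) (0, 0, a) c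
    obtain ⟨-, e3⟩ := hd.christoffel_horizon (v := v) (0, 0, a) (0, -s x c.2.2, c.1 • k)
    rw [← h𝒢, ← hy] at e1 e3
    -- In the `E` block the derivative of `s^♯` and the connection of the cut combine into the
    -- covariant derivative of `s`.
    have e4 : (T (0, 0, a)).2.2 + c.1 • christoffel G x a k
        = c.1 • (G x).inverse (D a) := by
      apply hiG.injective
      ext d
      rw [map_add, add_apply, ← (hcomp _).2.2, hT]
      have e5 : s x (christoffel G x a d) = christoffelLower G x a d k := by
        rw [← hGk, hGsymm, christoffel_spec hiG]
      simp [christoffel_spec hiG, hiG.self_apply_inverse, D, e5, christoffelLower_apply]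
      rw [hd.fderiv_symm a d k]
      ring
    simp only [Prod.snd_add, Prod.snd_sub, e1, e3]
    simp [← e4, mul_smul]

end HorizonCurvature

section HorizonCurvature

variable {E : Type*} [NormedAddCommGroup E] [NormedSpace ℝ E] [FiniteDimensional ℝ E]
  {G : E → E →L[ℝ] E →L[ℝ] ℝ} {s : E → E →L[ℝ] ℝ} {h : E → ℝ} {v : ℝ} {x : E}

theorem LocalData.ricci_dv_right (hd : LocalData G s h x) (c : ℝ × ℝ × E) :
    ricciLocal (nhgLocal G s h) (0, v, x) c (0, 1, 0) =
      ricciLocal (nhgLocal G s h) (0, v, x) (0, 1, 0) c :=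
  ricci_symm_of_translation_invariant nhgLocal_add_smul_dv
    ((LocalData.contDiffAt_nhgLocal (y := (0, v, x)) hd).of_le ENat.LEInfty.out)
    (LocalData.isInvertible_nhgLocal (y := (0, v, x)) hd)
    (LocalData.symm_nhgLocal (y := (0, v, x)) hd) c

/-- The trace of Ricci over spacetime is its trace over a cut plus the two mixed terms in `∂_u`,
`∂_v`, each equal to `ρ`. The slope `α` of the cut does not appear in the result. -/
theorem LocalData.curvature_horizon (hd : LocalData G s h x) (A : E →L[ℝ] ℝ × ℝ × E)
    (α : E → ℝ) (hA : ∀ a, A a = (0, α a, a)) :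
    traceWith (nhgLocal G s h (0, v, x)) (ricciLocal (nhgLocal G s h) (0, v, x)) / 2
      - traceWith (G x) (pullbackForm (ricciLocal (nhgLocal G s h) (0, v, x)) A) / 2 =
      h x - 2 * s x ((G x).inverse (s x)) + traceWith (G x) (fderiv ℝ s x
        - (ContinuousLinearMap.compL ℝ E E ℝ (s x)) ∘L (christoffel G x)) := by
  set ρ := h x - 2 * s x ((G x).inverse (s x)) + traceWith (G x) (fderiv ℝ s x
        - (ContinuousLinearMap.compL ℝ E E ℝ (s x)) ∘L (christoffel G x)) with hρ
  set B := ricciLocal (nhgLocal G s h) (0, v, x) with hB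
  have hi : (nhgLocal G s h (0, v, x)).IsInvertible :=
    LocalData.isInvertible_nhgLocal (y := (0, v, x)) hd
  have h1 (c : ℝ × ℝ × E) : B (0, 1, 0) c = c.1 * ρ := hd.ricci_dv c
  have h2 (c : ℝ × ℝ × E) : B c (0, 1, 0) = c.1 * ρ := (hd.ricci_dv_right c).trans (h1 c)
  -- A tilted cut changes tangent vectors by multiples of `∂_v`, which `Ric` annihilates against
  -- tangent vectors of the horizon.
  have hAB : pullbackForm B A = pullbackForm B
      ((ContinuousLinearMap.inr ℝ ℝ (ℝ × E)) ∘L (ContinuousLinearMap.inr ℝ ℝ E)) := by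
    ext a b
    have e (a : E) : A a = α a • ((0, 1, 0) : ℝ × ℝ × E) + (0, 0, a) := by simp [hA]
    simp only [pullbackForm, ContinuousLinearMap.bilinearComp_apply]
    rw [e, e]
    simp only [map_add, map_smul, add_apply, smul_apply, h1, h2]
    simp
  set C := (nhgLocal G s h (0, v, x)).inverse ∘L B with hC
  have hcomp (b : ℝ × ℝ × E) := nhgLocal_horizon_apply (G := G) (s := s) (h := h) v x (C b)
  have hCB (b c : ℝ × ℝ × E) : nhgLocal G s h (0, v, x) (C b) c = B b c := by
    rw [hC, ContinuousLinearMap.comp_apply, hi.self_apply_inverse]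
  have h3 : traceWith (nhgLocal G s h (0, v, x)) B =
      ρ + ρ + traceWith (G x) (pullbackForm B A) := by
    rw [hAB, traceWith, trace_spacetime C ((G x).inverse ∘L pullbackForm B
      ((ContinuousLinearMap.inr ℝ ℝ (ℝ × E)) ∘L (ContinuousLinearMap.inr ℝ ℝ E)))]
    · rw [← (hcomp _).1, ← (hcomp _).2.1, hCB, hCB, h1, h2, traceWith]
      simp
    · intro a
      apply hd.isInvertible.injective
      ext d
      rw [← (hcomp _).2.2, hCB]
      simp [hd.isInvertible.self_apply_inverse, pullbackForm]
  rw [h3]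
  ring

end HorizonCurvature

/-! ### The Killing equation as equations on the cut, and their inversion -/

section Killing

variable {E : Type*} [NormedAddCommGroup E] [NormedSpace ℝ E]

/-- The equations for the vector field `φ ∂_v + u² s(w) ∂_u - u w`, with `w = grad φ`, to be a
Killing vector of a near-horizon metric. -/
structure MasterEq (G : E → E →L[ℝ] E →L[ℝ] ℝ) (s : E → E →L[ℝ] ℝ) (h φ : E → ℝ) (w : E → E)
    (x : E) : Prop where
  smooth_φ : ContDiffAt ℝ ∞ φ x
  smooth_w : ContDiffAt ℝ ∞ w x
  grad : ∀ᶠ z in 𝓝 x, ∀ a, G z (w z) a = fderiv ℝ φ z a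
  hess : ∀ a b, fderiv ℝ G x (w x) a b + G x (fderiv ℝ w x a) b + G x a (fderiv ℝ w x b) =
    2 * (fderiv ℝ φ x a * s x b + fderiv ℝ φ x b * s x a)
  lin : ∀ a, fderiv ℝ s x a (w x) - 2 * fderiv ℝ s x (w x) a - s x (fderiv ℝ w x a)
    + 2 * s x (w x) * s x a + h x * fderiv ℝ φ x a = 0
  scal : 2 * s x (w x) * h x = fderiv ℝ h x (w x)

/-- Local form of the vector fields `degField`. -/
noncomputable def degLocal (q φ : E → ℝ) (w : E → E) (y : ℝ × ℝ × E) : ℝ × ℝ × E :=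
  (y.1 ^ 2 * q y.2.2, φ y.2.2, -(y.1 • w y.2.2))

variable {G : E → E →L[ℝ] E →L[ℝ] ℝ} {s : E → E →L[ℝ] ℝ} {h φ q : E → ℝ} {w : E → E} {x : E}

theorem contDiffAt_degLocal {n : WithTop ℕ∞} {y : ℝ × ℝ × E} (hq : ContDiffAt ℝ n q y.2.2)
    (hφ : ContDiffAt ℝ n φ y.2.2) (hw : ContDiffAt ℝ n w y.2.2) :
    ContDiffAt ℝ n (degLocal q φ w) y := by
  have hp : ContDiffAt ℝ n (fun z : ℝ × ℝ × E => z.2.2) y := by fun_prop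
  have h1 : ContDiffAt ℝ n (fun z : ℝ × ℝ × E => q z.2.2) y := hq.comp y hp
  have h2 : ContDiffAt ℝ n (fun z : ℝ × ℝ × E => φ z.2.2) y := hφ.comp y hp
  have h3 : ContDiffAt ℝ n (fun z : ℝ × ℝ × E => w z.2.2) y := hw.comp y hp
  unfold degLocal
  fun_prop

theorem fderiv_degLocal {y : ℝ × ℝ × E} (hq : DifferentiableAt ℝ q y.2.2)
    (hφ : DifferentiableAt ℝ φ y.2.2) (hw : DifferentiableAt ℝ w y.2.2) (a : ℝ × ℝ × E) :
    fderiv ℝ (degLocal q φ w) y a =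
      (2 * y.1 * a.1 * q y.2.2 + y.1 ^ 2 * fderiv ℝ q y.2.2 a.2.2, fderiv ℝ φ y.2.2 a.2.2,
        -(a.1 • w y.2.2 + y.1 • fderiv ℝ w y.2.2 a.2.2)) := by
  have hp : HasFDerivAt (fun z : ℝ × ℝ × E => z.2.2)
      ((ContinuousLinearMap.snd ℝ ℝ E).comp (ContinuousLinearMap.snd ℝ ℝ (ℝ × E))) y :=
    hasFDerivAt_snd.comp y hasFDerivAt_snd
  have h0 : HasFDerivAt (fun z : ℝ × ℝ × E => z.1) (ContinuousLinearMap.fst ℝ ℝ (ℝ × E)) y :=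
    hasFDerivAt_fst
  have h1 : HasFDerivAt (fun z : ℝ × ℝ × E => q z.2.2) _ y := HasFDerivAt.comp y hq.hasFDerivAt hp
  have h2 : HasFDerivAt (fun z : ℝ × ℝ × E => φ z.2.2) _ y := HasFDerivAt.comp y hφ.hasFDerivAt hp
  have h3 : HasFDerivAt (fun z : ℝ × ℝ × E => w z.2.2) _ y := HasFDerivAt.comp y hw.hasFDerivAt hp
  have key := (((h0.pow 2).fun_mul h1).prodMk (h2.prodMk (h0.fun_smul h3).fun_neg)).fderiv
  refine (DFunLike.congr_fun key a).trans ?_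
  refine Prod.ext ?_ (Prod.ext ?_ ?_)
  · simp; ring
  · simp
  · simp [add_comm]

variable [FiniteDimensional ℝ E]

/-- The Lie derivative is a polynomial in `u` whose coefficients are conditions on the cut. The
coefficient of `u` in the `(∂_u, ∂_v)` component explains the choice `q = s(w)` made below. -/
theorem LocalData.lie_degLocal (hd : LocalData G s h x) (hq : DifferentiableAt ℝ q x)
    (hφ : DifferentiableAt ℝ φ x) (hw : DifferentiableAt ℝ w x) (u v : ℝ) (a b : ℝ × ℝ × E) :
    fderiv ℝ (nhgLocal G s h) (u, v, x) (degLocal q φ w (u, v, x)) a b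
      + nhgLocal G s h (u, v, x) (fderiv ℝ (degLocal q φ w) (u, v, x) a) b
      + nhgLocal G s h (u, v, x) a (fderiv ℝ (degLocal q φ w) (u, v, x) b) =
    u * (2 * (fderiv ℝ φ x a.2.2 * s x b.2.2 + fderiv ℝ φ x b.2.2 * s x a.2.2)
      - (fderiv ℝ G x (w x) a.2.2 b.2.2 + G x (fderiv ℝ w x a.2.2) b.2.2
        + G x a.2.2 (fderiv ℝ w x b.2.2)))
    + a.1 * (fderiv ℝ φ x b.2.2 - G x (w x) b.2.2) + b.1 * (fderiv ℝ φ x a.2.2 - G x (w x) a.2.2)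
    + (a.1 * b.2.1 + b.1 * a.2.1) * (2 * u * (q x - s x (w x)))
    + u ^ 2 * (a.2.1 * (fderiv ℝ q x b.2.2 + 2 * q x * s x b.2.2 - 2 * fderiv ℝ s x (w x) b.2.2
        - 2 * s x (fderiv ℝ w x b.2.2) + h x * fderiv ℝ φ x b.2.2)
      + b.2.1 * (fderiv ℝ q x a.2.2 + 2 * q x * s x a.2.2 - 2 * fderiv ℝ s x (w x) a.2.2
        - 2 * s x (fderiv ℝ w x a.2.2) + h x * fderiv ℝ φ x a.2.2))
    + u ^ 3 * (2 * q x * h x - fderiv ℝ h x (w x)) * (a.2.1 * b.2.1) := by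
  rw [LocalData.fderiv_nhgLocal (y := (u, v, x)) hd, fderiv_degLocal (y := (u, v, x)) hq hφ hw,
    fderiv_degLocal (y := (u, v, x)) hq hφ hw]
  have hs : ∀ a b, G x a b = G x b a := hd.symm.self_of_nhds
  simp only [nhgLocal_apply, degLocal]
  simp only [map_neg, map_add, map_smul, neg_apply, add_apply, smul_apply, smul_eq_mul]
  rw [hs a.2.2 (w x)]
  ring

theorem LocalData.fderiv_pairing (hd : LocalData G s h x) (hw : ContDiffAt ℝ ∞ w x) (a : E) :
    fderiv ℝ (fun z => s z (w z)) x a = fderiv ℝ s x a (w x) + s x (fderiv ℝ w x a) := by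
  rw [fderiv_clm_apply (hd.smooth_s.differentiableAt (by simp)) (hw.differentiableAt (by simp))]
  simp [add_comm]

theorem MasterEq.lie_eq_zero (hm : MasterEq G s h φ w x) (hd : LocalData G s h x)
    (u v : ℝ) (a b : ℝ × ℝ × E) :
    fderiv ℝ (nhgLocal G s h) (u, v, x) (degLocal (fun z => s z (w z)) φ w (u, v, x)) a b
      + nhgLocal G s h (u, v, x) (fderiv ℝ (degLocal (fun z => s z (w z)) φ w) (u, v, x) a) b
      + nhgLocal G s h (u, v, x) a (fderiv ℝ (degLocal (fun z => s z (w z)) φ w) (u, v, x) b)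
      = 0 := by
  have hs := hd.smooth_s.differentiableAt (by simp)
  have hw := hm.smooth_w.differentiableAt (by simp)
  rw [hd.lie_degLocal (hs.clm_apply hw) (hm.smooth_φ.differentiableAt (by simp)) hw]
  simp only [hd.fderiv_pairing hm.smooth_w, ← hm.grad.self_of_nhds, hm.hess, hm.scal]
  have h1 := hm.lin a.2.2
  have h2 := hm.lin b.2.2
  simp only [← hm.grad.self_of_nhds] at h1 h2
  linear_combination u ^ 2 * a.2.1 * h2 + u ^ 2 * b.2.1 * h1

/-- Once `q = s(w)` and `w = grad φ`, each component of the Lie derivative carries a single power of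
`u`, so the slice `u = 1` already yields all the equations. -/
theorem LocalData.masterEq (hd : LocalData G s h x) (hφ : ContDiffAt ℝ ∞ φ x)
    (hw : ContDiffAt ℝ ∞ w x) (hg : ∀ᶠ z in 𝓝 x, ∀ a, G z (w z) a = fderiv ℝ φ z a) (v : ℝ)
    (hl : ∀ a b : ℝ × ℝ × E,
      fderiv ℝ (nhgLocal G s h) (1, v, x) (degLocal (fun z => s z (w z)) φ w (1, v, x)) a b
      + nhgLocal G s h (1, v, x) (fderiv ℝ (degLocal (fun z => s z (w z)) φ w) (1, v, x) a) b
      + nhgLocal G s h (1, v, x) a (fderiv ℝ (degLocal (fun z => s z (w z)) φ w) (1, v, x) b)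
      = 0) : MasterEq G s h φ w x := by
  have hs := hd.smooth_s.differentiableAt (by simp)
  have hw' := hw.differentiableAt (by simp)
  have hl' (a b : ℝ × ℝ × E) := (hd.lie_degLocal (q := fun z => s z (w z)) (hs.clm_apply hw')
    (hφ.differentiableAt (by simp)) hw' 1 v a b).symm.trans (hl a b)
  refine ⟨hφ, hw, hg, fun a b => ?_, fun a => ?_, ?_⟩
  · have := hl' (0, 0, a) (0, 0, b)
    simp only [zero_mul, mul_zero, add_zero] at this
    linear_combination -this
  · have := hl' (0, 1, 0) (0, 0, a)
    simp [hd.fderiv_pairing hw] at this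
    linear_combination this
  · have := hl' (0, 1, 0) (0, 1, 0)
    simp at this
    linear_combination this

theorem LocalData.fderiv_fderiv_apply (hd : LocalData G s h x) (hw : ContDiffAt ℝ ∞ w x)
    (hφ : ContDiffAt ℝ ∞ φ x)
    (hg : ∀ᶠ z in 𝓝 x, ∀ a, G z (w z) a = fderiv ℝ φ z a) (a b : E) :
    fderiv ℝ (fderiv ℝ φ) x a b = fderiv ℝ G x a (w x) b + G x (fderiv ℝ w x a) b := by
  have hφ' : DifferentiableAt ℝ (fderiv ℝ φ) x :=
    (hφ.fderiv_right (m := ∞) le_rfl).differentiableAt (by simp)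
  have hG := hd.smooth_G.differentiableAt (by simp)
  have hw' := hw.differentiableAt (by simp)
  have hev : (fun z => G z (w z)) =ᶠ[𝓝 x] fderiv ℝ φ :=
    hg.mono fun z hz => ContinuousLinearMap.ext hz
  rw [← hev.fderiv_eq, fderiv_clm_apply hG hw']
  simp [add_comm]

theorem fderiv_fderiv_symm (hφ : ContDiffAt ℝ ∞ φ x) (a b : E) :
    fderiv ℝ (fderiv ℝ φ) x a b = fderiv ℝ (fderiv ℝ φ) x b a :=
  (hφ.isSymmSndFDerivAt (by
    rw [minSmoothness_of_isRCLikeNormedField]; exact ENat.LEInfty.out)).eq a b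

theorem LocalData.fderiv_normSq (hd : LocalData G s h x) (hw : ContDiffAt ℝ ∞ w x) (a : E) :
    fderiv ℝ (fun z => G z (w z) (w z)) x a =
      fderiv ℝ G x a (w x) (w x) + 2 * G x (fderiv ℝ w x a) (w x) := by
  have hG := hd.smooth_G.differentiableAt (by simp)
  have hw' := hw.differentiableAt (by simp)
  rw [fderiv_clm_apply (hG.clm_apply hw') hw', fderiv_clm_apply hG hw']
  simp [hd.symm.self_of_nhds (w x)]
  ring

/-- The Hessian equation contracted with `w`, rewritten by the symmetry of second derivatives of
`φ`. In short `d|w|² = 2 (|w|² s + s(w) dφ)`; this drives both the inversion of the equations and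
unique continuation. -/
theorem MasterEq.fderiv_normSq (hm : MasterEq G s h φ w x) (hd : LocalData G s h x) (a : E) :
    fderiv ℝ G x a (w x) (w x) + 2 * G x (fderiv ℝ w x a) (w x) =
      2 * (G x (w x) (w x) * s x a + s x (w x) * fderiv ℝ φ x a) := by
  have h1 := hm.hess a (w x)
  have h2 := fderiv_fderiv_symm hm.smooth_φ a (w x)
  rw [hd.fderiv_fderiv_apply hm.smooth_w hm.smooth_φ hm.grad,
    hd.fderiv_fderiv_apply hm.smooth_w hm.smooth_φ hm.grad] at h2
  have hs := hd.symm.self_of_nhds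
  rw [← hm.grad.self_of_nhds (w x), hs a, hd.fderiv_symm (w x) a] at h1
  linear_combination h1 + h2

/-- The equations for the inverse function, on the near-horizon geometry with respect to the
Killing vector of the function. -/
theorem MasterEq.inv (hm : MasterEq G s h φ w x) (hd : LocalData G s h x) (h0 : φ x ≠ 0)
    {s' : E → E →L[ℝ] ℝ} {h' : E → ℝ}
    (hs' : ∀ᶠ z in 𝓝 x, s' z = s z - (φ z)⁻¹ • fderiv ℝ φ z)
    (hh' : ∀ᶠ z in 𝓝 x, h' z =
      h z + (φ z)⁻¹ ^ 2 * G z (w z) (w z) - 2 * (φ z)⁻¹ * s z (w z)) :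
    MasterEq G s' h' (fun z => (φ z)⁻¹) (fun z => -((φ z)⁻¹ ^ 2) • w z) x := by
  have hφ := hm.smooth_φ
  have hφd := hφ.differentiableAt (by simp)
  have hw := hm.smooth_w
  have hwd := hw.differentiableAt (by simp)
  have hGd := hd.smooth_G.differentiableAt (by simp)
  have hsd := hd.smooth_s.differentiableAt (by simp)
  have hhd := hd.smooth_h.differentiableAt (by simp)
  have hsymm := hd.symm.self_of_nhds
  have hgrad := hm.grad.self_of_nhds
  have hDφ : DifferentiableAt ℝ (fderiv ℝ φ) x :=
    (hφ.fderiv_right (m := ∞) le_rfl).differentiableAt (by simp)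
  have hinv : HasFDerivAt (fun z => (φ z)⁻¹) (-((φ x)⁻¹ ^ 2) • fderiv ℝ φ x) x := by
    have := (hasDerivAt_inv h0).comp_hasFDerivAt x hφd.hasFDerivAt
    simpa [Function.comp_def] using this
  have hinv2 : HasFDerivAt (fun z => (φ z)⁻¹ ^ 2) _ x := hinv.pow 2
  have hsx : s' x = s x - (φ x)⁻¹ • fderiv ℝ φ x := hs'.self_of_nhds
  have hhx := hh'.self_of_nhds
  have hDs (a b : E) : fderiv ℝ s' x a b = fderiv ℝ s x a b
      + (φ x)⁻¹ ^ 2 * fderiv ℝ φ x a * fderiv ℝ φ x b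
      - (φ x)⁻¹ * fderiv ℝ (fderiv ℝ φ) x a b := by
    have h1 : HasFDerivAt (fun z => s z - (φ z)⁻¹ • fderiv ℝ φ z) _ x :=
      hsd.hasFDerivAt.fun_sub (hinv.fun_smul hDφ.hasFDerivAt)
    rw [Filter.EventuallyEq.fderiv_eq hs', h1.fderiv]
    simp
    ring
  have hDh (a : E) : fderiv ℝ h' x a = fderiv ℝ h x a
      + (φ x)⁻¹ ^ 2 * (fderiv ℝ G x a (w x) (w x) + 2 * G x (fderiv ℝ w x a) (w x))
      - 2 * (φ x)⁻¹ ^ 3 * fderiv ℝ φ x a * G x (w x) (w x)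
      - 2 * (φ x)⁻¹ * (fderiv ℝ s x a (w x) + s x (fderiv ℝ w x a))
      + 2 * (φ x)⁻¹ ^ 2 * fderiv ℝ φ x a * s x (w x) := by
    have hN : HasFDerivAt (fun z => G z (w z) (w z)) _ x :=
      ((hGd.clm_apply hwd).clm_apply hwd).hasFDerivAt
    have hσ : HasFDerivAt (fun z => s z (w z)) _ x := (hsd.clm_apply hwd).hasFDerivAt
    have h1 := (hhd.hasFDerivAt.fun_add (hinv2.fun_mul hN)).fun_sub
      ((hinv.const_mul 2).fun_mul hσ)
    rw [Filter.EventuallyEq.fderiv_eq hh', h1.fderiv]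
    simp [hd.fderiv_normSq hw, hd.fderiv_pairing hw]
    ring
  have hDw (a : E) : fderiv ℝ (fun z => -((φ z)⁻¹ ^ 2) • w z) x a =
      -((φ x)⁻¹ ^ 2) • fderiv ℝ w x a + (2 * (φ x)⁻¹ ^ 3 * fderiv ℝ φ x a) • w x := by
    have h1 := (hinv2.fun_neg.fun_smul hwd.hasFDerivAt).fderiv
    rw [h1]
    simp
    congr 1
    ring
  have hDinv : fderiv ℝ (fun z => (φ z)⁻¹) x = -((φ x)⁻¹ ^ 2) • fderiv ℝ φ x := hinv.fderiv
  have hww : fderiv ℝ φ x (w x) = G x (w x) (w x) := (hgrad (w x)).symm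
  have hD2 (a : E) : fderiv ℝ (fderiv ℝ φ) x (w x) a = fderiv ℝ (fderiv ℝ φ) x a (w x) :=
    fderiv_fderiv_symm hφ (w x) a
  -- The second derivatives of `φ` enter the new equations only contracted with `w`, and these
  -- contractions are eliminated by `d|w|²`.
  have hN (a : E) : fderiv ℝ (fderiv ℝ φ) x a (w x) =
      2 * (G x (w x) (w x) * s x a + s x (w x) * fderiv ℝ φ x a)
        - fderiv ℝ φ x (fderiv ℝ w x a) := by
    rw [hd.fderiv_fderiv_apply hw hφ hm.grad, ← hm.fderiv_normSq hd, ← hgrad, hsymm (w x)]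
    ring
  refine ⟨hφ.inv h0, ?_, ?_, fun a b => ?_, fun a => ?_, ?_⟩
  · exact ((hφ.inv h0).pow 2).neg.smul hw
  · filter_upwards [hm.grad, (hφ.of_le (m := 1) (by simp)).eventually (by simp), hφd.continuousAt.eventually_ne h0]
      with z hz hz1 hz2 a
    have h1 : HasFDerivAt (fun z => (φ z)⁻¹) _ z := (hasDerivAt_inv hz2).comp_hasFDerivAt z
      (hz1.differentiableAt (by simp)).hasFDerivAt
    rw [h1.fderiv]
    simp [hz]
  · simp only [hDw, hDinv, hsx, map_add, map_smul, add_apply, smul_apply, sub_apply, smul_eq_mul,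
      hgrad, hsymm a (w x)]
    linear_combination -(φ x)⁻¹ ^ 2 * hm.hess a b
  -- After this elimination the new linear equation is `-1 / φ²` times the old one.
  · simp only [hDw, hDinv, hsx, hDs, hhx, map_add, map_smul, smul_apply, sub_apply,
      smul_eq_mul, hww, hD2, hN]
    linear_combination -(φ x)⁻¹ ^ 2 * hm.lin a
  -- The new scalar equation combines the old one, the linear equation at `w`, and the derivative of
  -- `|w|²` along `w`.
  · have hσ := hm.lin (w x)
    rw [hww] at hσ
    have hsc := hm.scal
    simp only [hsx, hDh, hhx, map_smul, sub_apply, smul_apply, smul_eq_mul, hww]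
    have hNw := hm.fderiv_normSq hd (w x)
    rw [hww] at hNw
    linear_combination (-(φ x)⁻¹ ^ 2) * hsc + (φ x)⁻¹ ^ 4 * hNw + 2 * (φ x)⁻¹ ^ 3 * hσ

end Killing

theorem contDiffAt_congr_iff {E F : Type*} [NormedAddCommGroup E] [NormedSpace ℝ E]
    [NormedAddCommGroup F] [NormedSpace ℝ F] {n : WithTop ℕ∞} {f g : E → F} {x : E}
    (h : f =ᶠ[𝓝 x] g) : ContDiffAt ℝ n f x ↔ ContDiffAt ℝ n g x :=
  ⟨fun hf => hf.congr_of_eventuallyEq h.symm, fun hg => hg.congr_of_eventuallyEq h⟩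

/-! ### Chart expressions of tensor fields and their smoothness -/

section Charts

variable {V H M : Type*} [NormedAddCommGroup V] [NormedSpace ℝ V] [TopologicalSpace H]
  {I : ModelWithCorners ℝ V H} [I.Boundaryless] [TopologicalSpace M] [ChartedSpace H M]

theorem eventually_mem_target (p : M) :
    ∀ᶠ y in 𝓝 (extChartAt I p p), y ∈ (extChartAt I p).target :=
  extChartAt_target_mem_nhds p

theorem contMDiffAt_iff_contDiffAt_symm [IsManifold I ∞ M] {F : Type*} [NormedAddCommGroup F]
    [NormedSpace ℝ F]
    {n : WithTop ℕ∞} {f : M → F} {p : M} :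
    ContMDiffAt I 𝓘(ℝ, F) n f p ↔
      ContDiffAt ℝ n (f ∘ (extChartAt I p).symm) (extChartAt I p p) := by
  rw [contMDiffAt_iff_source, contMDiffWithinAt_iff_contDiffWithinAt, I.range_eq_univ,
    contDiffWithinAt_univ]

theorem chartFrame_self [IsManifold I ∞ M] (p : M) :
    chartFrame (I := I) p (extChartAt I p p) = ContinuousLinearMap.id ℝ V :=
  haveI : IsManifold I 1 M := IsManifold.of_le (n := ∞) ENat.LEInfty.out
  mfderivWithin_range_extChartAt_symm

theorem chartFrame_isInvertible [IsManifold I ∞ M] {p : M} {y : V}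
    (hy : y ∈ (extChartAt I p).target) : (chartFrame (I := I) p y).IsInvertible :=
  haveI : IsManifold I 1 M := IsManifold.of_le (n := ∞) ENat.LEInfty.out
  isInvertible_mfderivWithin_extChartAt_symm hy

/-- The value of a vector field, as a vector of the model space. -/
def vecVal (Z : VecField I (M := M)) (q : M) : V := Z q

/-- The value of a one-form, as a linear form on the model space. -/
def covecVal (σ : CovectorField I (M := M)) (q : M) : V →L[ℝ] ℝ := σ q

/-- The value of a field of forms, as a bilinear form on the model space. -/
def formVal (g : FormField I (M := M)) (q : M) : V →L[ℝ] V →L[ℝ] ℝ := g q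

theorem chartVec_apply (Z : VecField I (M := M)) (p : M) (y : V) :
    chartVec Z p y = (chartFrame (I := I) p y).inverse (vecVal Z ((extChartAt I p).symm y)) := rfl

theorem chartVec_self [IsManifold I ∞ M] (Z : VecField I (M := M)) (p : M) :
    chartVec Z p (extChartAt I p p) = vecVal Z p := by
  rw [chartVec_apply, chartFrame_self, extChartAt_to_inv]
  exact congrFun (congrArg DFunLike.coe ContinuousLinearMap.inverse_id) _

theorem chartForm_apply (g : FormField I (M := M)) (p : M) (y a b : V) :
    chartForm g p y a b = formVal g ((extChartAt I p).symm y) (chartFrame (I := I) p y a)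
      (chartFrame (I := I) p y b) := rfl

theorem chartCovec_apply (σ : CovectorField I (M := M)) (p : M) (y a : V) :
    chartCovec σ p y a = covecVal σ ((extChartAt I p).symm y) (chartFrame (I := I) p y a) := rfl

theorem chartForm_self [IsManifold I ∞ M] (g : FormField I (M := M)) (p : M) :
    chartForm g p (extChartAt I p p) = formVal g p := by
  refine ContinuousLinearMap.ext fun a => ContinuousLinearMap.ext fun b => ?_
  rw [chartForm_apply, chartFrame_self, extChartAt_to_inv]
  rfl

theorem chartCovec_self [IsManifold I ∞ M] (σ : CovectorField I (M := M)) (p : M) :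
    chartCovec σ p (extChartAt I p p) = covecVal σ p := by
  refine ContinuousLinearMap.ext fun a => ?_
  rw [chartCovec_apply, chartFrame_self, extChartAt_to_inv]
  rfl

/-- The trivialization of the tangent bundle at `p` is the differential of the chart at `p`, which
inverts `chartFrame`; so the two expressions agree near `p`. -/
theorem contMDiffAt_vec_iff [IsManifold I ∞ M] {Z : VecField I (M := M)} {p : M} :
    ContMDiffAt I I.tangent ∞ (fun q => (⟨q, Z q⟩ : TangentBundle I M)) p ↔
      ContDiffAt ℝ ∞ (chartVec Z p) (extChartAt I p p) := by
  have : IsManifold I 1 M := IsManifold.of_le (n := ∞) ENat.LEInfty.out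
  rw [Bundle.contMDiffAt_section, contMDiffAt_iff_contDiffAt_symm]
  refine contDiffAt_congr_iff ?_
  filter_upwards [eventually_mem_target (I := I) p] with y hy
  have hq : (extChartAt I p).symm y ∈ (chartAt H p).source := by
    rw [← extChartAt_source I]; exact (extChartAt I p).map_target hy
  have h1 := TangentBundle.continuousLinearMapAt_trivializationAt (I := I) hq
  have h2 := mfderiv_extChartAt_comp_mfderivWithin_extChartAt_symm (I := I) hy
  have h3 := mfderivWithin_extChartAt_symm_comp_mfderiv_extChartAt (I := I) hy
  have h4 := ContinuousLinearMap.inverse_eq h3 h2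
  rw [chartVec_apply]
  unfold chartFrame
  refine Eq.trans ?_ (congrFun (congrArg DFunLike.coe h4) _).symm
  refine Eq.trans ?_ (congrFun (congrArg DFunLike.coe h1) _)
  exact (Bundle.Trivialization.continuousLinearMapAt_apply_of_mem ℝ
    (trivializationAt V (TangentSpace I) p) (by simpa using hq) _).symm

theorem contMDiffAt_covec_iff [IsManifold I ∞ M] {σ : CovectorField I (M := M)} {p : M} :
    ContMDiffAt I (I.prod 𝓘(ℝ, V →L[ℝ] ℝ)) ∞
      (fun p => Bundle.TotalSpace.mk' (V →L[ℝ] ℝ)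
      (E := fun p : M => TangentSpace I p →L[ℝ] ℝ) p (σ p)) p ↔
      ContDiffAt ℝ ∞ (chartCovec σ p) (extChartAt I p p) := by
  have : IsManifold I 1 M := IsManifold.of_le (n := ∞) ENat.LEInfty.out
  rw [Bundle.contMDiffAt_section, contMDiffAt_iff_contDiffAt_symm]
  refine contDiffAt_congr_iff ?_
  filter_upwards [eventually_mem_target (I := I) p] with y hy
  have hq : (extChartAt I p).symm y ∈ (chartAt H p).source := by
    rw [← extChartAt_source I]; exact (extChartAt I p).map_target hy
  have h1 := TangentBundle.symmL_trivializationAt (I := I) hq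
  rw [(extChartAt I p).right_inv hy] at h1
  ext a
  rw [chartCovec_apply, chartFrame, ← h1]
  simp [hom_trivializationAt_apply, ContinuousLinearMap.inCoordinates]
  rfl

theorem contMDiffAt_form_iff [IsManifold I ∞ M] {g : FormField I (M := M)} {p : M} :
    ContMDiffAt I (I.prod 𝓘(ℝ, V →L[ℝ] V →L[ℝ] ℝ)) ∞
      (fun p => Bundle.TotalSpace.mk' (V →L[ℝ] V →L[ℝ] ℝ)
      (E := fun p : M => TangentSpace I p →L[ℝ] TangentSpace I p →L[ℝ] ℝ) p (g p)) p ↔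
      ContDiffAt ℝ ∞ (chartForm g p) (extChartAt I p p) := by
  have : IsManifold I 1 M := IsManifold.of_le (n := ∞) ENat.LEInfty.out
  rw [Bundle.contMDiffAt_section, contMDiffAt_iff_contDiffAt_symm]
  refine contDiffAt_congr_iff ?_
  filter_upwards [eventually_mem_target (I := I) p] with y hy
  have hq : (extChartAt I p).symm y ∈ (chartAt H p).source := by
    rw [← extChartAt_source I]; exact (extChartAt I p).map_target hy
  have h1 := TangentBundle.symmL_trivializationAt (I := I) hq
  rw [(extChartAt I p).right_inv hy] at h1
  have h2 (a : V) : chartFrame (I := I) p y a =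
      (trivializationAt V (TangentSpace I) p).symm ((extChartAt I p).symm y) a :=
    (congrFun (congrArg DFunLike.coe h1) a).symm.trans
      (Bundle.Trivialization.symmL_apply (trivializationAt V (TangentSpace I) p)
        (by simpa using hq) a)
  ext a b
  rw [chartForm_apply, h2, h2]
  simp only [Function.comp_apply, hom_trivializationAt_apply]
  rw [inCoordinates_apply_eq₂ (by simpa using hq) (by simpa using hq) (by simp)]
  simp
  rfl

end Charts

/-! ### Charts of `ℝ × ℝ × S` and the metric in them -/

section ProductCharts

variable {E S : Type*} [NormedAddCommGroup E] [NormedSpace ℝ E]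
  [TopologicalSpace S] [ChartedSpace E S]

theorem extChartAt_st_symm (p : ℝ × ℝ × S) (y : ℝ × ℝ × E) :
    (extChartAt (stModel E) p).symm y =
      (y.1, y.2.1, (extChartAt 𝓘(ℝ, E) p.2.2).symm y.2.2) := by
  simp only [extChartAt_prod, PartialEquiv.prod_symm, PartialEquiv.prod_coe]
  rfl

theorem extChartAt_st (p q : ℝ × ℝ × S) :
    extChartAt (stModel E) p q = (q.1, q.2.1, extChartAt 𝓘(ℝ, E) p.2.2 q.2.2) := by
  simp only [extChartAt_prod, PartialEquiv.prod_coe]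
  rfl

theorem mem_extChartAt_st_target {p : ℝ × ℝ × S} {y : ℝ × ℝ × E} :
    y ∈ (extChartAt (stModel E) p).target ↔ y.2.2 ∈ (extChartAt 𝓘(ℝ, E) p.2.2).target := by
  simp only [extChartAt_prod, PartialEquiv.prod_target, mem_prod]
  exact ⟨fun h => h.2.2, fun h => ⟨by simp [extChartAt, chartAt_self_eq],
    by simp [extChartAt, chartAt_self_eq], h⟩⟩

variable [IsManifold 𝓘(ℝ, E) ∞ S]

theorem hasMFDerivAt_chart_symm {x : S} {y : E} (hy : y ∈ (extChartAt 𝓘(ℝ, E) x).target) :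
    HasMFDerivAt 𝓘(ℝ, E) 𝓘(ℝ, E) (extChartAt 𝓘(ℝ, E) x).symm y
      (chartFrame (V := E) (I := 𝓘(ℝ, E)) x y) := by
  have : IsManifold 𝓘(ℝ, E) 1 S := IsManifold.of_le (n := ∞) ENat.LEInfty.out
  have h : HasMFDerivWithinAt 𝓘(ℝ, E) 𝓘(ℝ, E) (extChartAt 𝓘(ℝ, E) x).symm (range 𝓘(ℝ, E)) y
      (chartFrame (V := E) (I := 𝓘(ℝ, E)) x y) :=
    (mdifferentiableWithinAt_extChartAt_symm (I := 𝓘(ℝ, E)) hy).hasMFDerivWithinAt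
  rw [ModelWithCorners.range_eq_univ 𝓘(ℝ, E)] at h
  exact hasMFDerivWithinAt_univ.1 h

theorem chartFrame_st {p : ℝ × ℝ × S} {y : ℝ × ℝ × E}
    (hy : y.2.2 ∈ (extChartAt 𝓘(ℝ, E) p.2.2).target) (a : ℝ × ℝ × E) :
    chartFrame (I := stModel E) p y a =
      (a.1, a.2.1, chartFrame (I := 𝓘(ℝ, E)) p.2.2 y.2.2 a.2.2) := by
  have h3 := hasMFDerivAt_chart_symm hy
  have h1 : HasMFDerivAt 𝓘(ℝ, ℝ × ℝ × E) 𝓘(ℝ, ℝ) (fun z : ℝ × ℝ × E => z.1) y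
    (ContinuousLinearMap.fst ℝ ℝ (ℝ × E)) := hasFDerivAt_fst.hasMFDerivAt
  have h2 : HasMFDerivAt 𝓘(ℝ, ℝ × ℝ × E) 𝓘(ℝ, ℝ) (fun z : ℝ × ℝ × E => z.2.1) y
      ((ContinuousLinearMap.fst ℝ ℝ E).comp (ContinuousLinearMap.snd ℝ ℝ (ℝ × E))) :=
    (hasFDerivAt_fst.comp y hasFDerivAt_snd).hasMFDerivAt
  have h4 : HasMFDerivAt 𝓘(ℝ, ℝ × ℝ × E) 𝓘(ℝ, E) (fun z : ℝ × ℝ × E => z.2.2) y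
      ((ContinuousLinearMap.snd ℝ ℝ E).comp (ContinuousLinearMap.snd ℝ ℝ (ℝ × E))) :=
    (hasFDerivAt_snd.comp y hasFDerivAt_snd).hasMFDerivAt
  have h5 := h1.prodMk (h2.prodMk (HasMFDerivAt.comp y h3 h4))
  have h6 : (extChartAt (stModel E) p).symm = fun z : ℝ × ℝ × E =>
      (z.1, z.2.1, ((extChartAt 𝓘(ℝ, E) p.2.2).symm ∘ fun z : ℝ × ℝ × E => z.2.2) z) := by
    ext1 z
    exact extChartAt_st_symm p z
  have h7 : HasMFDerivAt 𝓘(ℝ, ℝ × ℝ × E) (stModel E) (extChartAt (stModel E) p).symm y _ :=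
    h6 ▸ h5
  have h8 := h7.mfderiv
  have h9 : chartFrame (I := stModel E) p y =
      mfderiv 𝓘(ℝ, ℝ × ℝ × E) (stModel E) (extChartAt (stModel E) p).symm y := by
    rw [← mfderivWithin_univ, ← ModelWithCorners.range_eq_univ (stModel E)]
    rfl
  exact congrFun (congrArg DFunLike.coe (h9.trans h8)) a

theorem chartVec_st (Z : VecField (stModel E) (M := ℝ × ℝ × S)) {p : ℝ × ℝ × S} {y : ℝ × ℝ × E}
    (hy : y.2.2 ∈ (extChartAt 𝓘(ℝ, E) p.2.2).target) {a : ℝ × ℝ × E}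
    (ha : vecVal Z (y.1, y.2.1, (extChartAt 𝓘(ℝ, E) p.2.2).symm y.2.2) = a) :
    chartVec Z p y = (a.1, a.2.1, (chartFrame (I := 𝓘(ℝ, E)) p.2.2 y.2.2).inverse a.2.2) := by
  have hi := chartFrame_isInvertible (I := stModel E) (mem_extChartAt_st_target.2 hy)
  have hi' := chartFrame_isInvertible (I := 𝓘(ℝ, E)) hy
  apply hi.injective
  rw [chartVec_apply, hi.self_apply_inverse, chartFrame_st hy]
  dsimp only
  rw [hi'.self_apply_inverse, extChartAt_st_symm, ha]

/-- The function `f` in the preferred chart at `x`. -/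
noncomputable def chartFun (f : S → ℝ) (x : S) (y : E) : ℝ := f ((extChartAt 𝓘(ℝ, E) x).symm y)

theorem eventually_symm_mem {x : S} {W : Set S} (hW : IsOpen W) (hx : x ∈ W) :
    ∀ᶠ y in 𝓝 (extChartAt 𝓘(ℝ, E) x x), y ∈ (extChartAt 𝓘(ℝ, E) x).target ∧
      (extChartAt 𝓘(ℝ, E) x).symm y ∈ W := by
  refine (eventually_mem_target x).and ?_
  refine (continuousAt_extChartAt_symm x).eventually ?_
  rw [extChartAt_to_inv]
  exact hW.mem_nhds hx

variable [FiniteDimensional ℝ E]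

/-- A product chart is the identity in `u` and `v`, so only the data on `S` are transformed. This
transfers all the local computations to the manifold. -/
theorem chartForm_nhgMetric (D : HorizonData E S) {p : ℝ × ℝ × S} {y : ℝ × ℝ × E}
    (hy : y.2.2 ∈ (extChartAt 𝓘(ℝ, E) p.2.2).target) :
    chartForm (nhgMetric D) p y =
      nhgLocal (chartForm D.γ p.2.2) (chartCovec D.s p.2.2) (chartFun D.h p.2.2) y := by
  refine ContinuousLinearMap.ext fun a => ContinuousLinearMap.ext fun b => ?_
  rw [chartForm_apply, chartFrame_st hy, chartFrame_st hy, extChartAt_st_symm, nhgLocal_apply]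
  exact nhgForm_apply _ _ _ _ _ _

theorem chartForm_nhgMetric_eventuallyEq (D : HorizonData E S) (p : ℝ × ℝ × S) :
    chartForm (nhgMetric D) p =ᶠ[𝓝 (extChartAt (stModel E) p p)]
      nhgLocal (chartForm D.γ p.2.2) (chartCovec D.s p.2.2) (chartFun D.h p.2.2) := by
  filter_upwards [eventually_mem_target (I := stModel E) p] with y hy
  exact chartForm_nhgMetric D (mem_extChartAt_st_target.1 hy)

theorem HorizonData.IsRegularOn.localData {D : HorizonData E S} {W : Set S} (hD : D.IsRegularOn W)
    (hW : IsOpen W) {x : S} (hx : x ∈ W) :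
    LocalData (chartForm D.γ x) (chartCovec D.s x) (chartFun D.h x) (extChartAt 𝓘(ℝ, E) x x) where
  smooth_G := contMDiffAt_form_iff.1 ((hD.smooth_γ x hx).contMDiffAt (hW.mem_nhds hx))
  smooth_s := contMDiffAt_covec_iff.1 ((hD.smooth_s x hx).contMDiffAt (hW.mem_nhds hx))
  smooth_h := contMDiffAt_iff_contDiffAt_symm.1 ((hD.smooth_h x hx).contMDiffAt (hW.mem_nhds hx))
  symm := by
    filter_upwards [eventually_symm_mem hW hx] with y hy a b
    rw [chartForm_apply, chartForm_apply]
    exact hD.symm _ hy.2 _ _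
  pos a ha := by
    rw [chartForm_self]
    exact hD.pos x hx a ha

end ProductCharts

/-! ### Dependence of the curvature on the germ of the metric -/

section Congruence

variable {V : Type*} [NormedAddCommGroup V] [NormedSpace ℝ V]
  {G G' : V → V →L[ℝ] V →L[ℝ] ℝ} {y : V}

theorem christoffel_congr (h : G =ᶠ[𝓝 y] G') : christoffel G y = christoffel G' y := by
  simp only [christoffel, christoffelLower, h.fderiv_eq, h.eq_of_nhds]

theorem ricciLocal_congr [FiniteDimensional ℝ V] (h : G =ᶠ[𝓝 y] G') :
    ricciLocal G y = ricciLocal G' y := by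
  have h1 : christoffel G =ᶠ[𝓝 y] christoffel G' :=
    h.eventuallyEq_nhds.mono fun z hz => christoffel_congr hz
  ext b c
  rw [ricciLocal_apply, ricciLocal_apply]
  simp only [riemannOp, h1.fderiv_eq, h1.eq_of_nhds]

end Congruence

/-! ### Lie derivative, connection and curvature of the near-horizon metric on the manifold -/

section Fields

variable {E S : Type*} [NormedAddCommGroup E] [NormedSpace ℝ E]
  [TopologicalSpace S] [ChartedSpace E S] [IsManifold 𝓘(ℝ, E) ∞ S]

theorem chartFun_self (f : S → ℝ) (x : S) : chartFun f x (extChartAt 𝓘(ℝ, E) x x) = f x := by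
  rw [chartFun, extChartAt_to_inv]

theorem chartCovec_differential {f : S → ℝ} {x : S} {y : E}
    (hy : y ∈ (extChartAt 𝓘(ℝ, E) x).target)
    (hf : MDifferentiableAt 𝓘(ℝ, E) 𝓘(ℝ, ℝ) f ((extChartAt 𝓘(ℝ, E) x).symm y)) :
    chartCovec (V := E) (I := 𝓘(ℝ, E)) (differential f) x y = fderiv ℝ (chartFun f x) y := by
  have h := HasMFDerivAt.comp y hf.hasMFDerivAt (hasMFDerivAt_chart_symm hy)
  have h' : HasFDerivAt (chartFun f x)
    (chartCovec (V := E) (I := 𝓘(ℝ, E)) (differential f) x y) y := hasMFDerivAt_iff_hasFDerivAt.1 h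
  exact h'.fderiv.symm

theorem covecVal_differential {f : S → ℝ} {x : S}
    (hf : MDifferentiableAt 𝓘(ℝ, E) 𝓘(ℝ, ℝ) f x) :
    covecVal (V := E) (I := 𝓘(ℝ, E)) (differential f) x =
      fderiv ℝ (chartFun f x) (extChartAt 𝓘(ℝ, E) x x) := by
  rw [← chartCovec_self, chartCovec_differential (mem_extChartAt_target x)]
  rwa [extChartAt_to_inv]

theorem chartCovec_differential_eventuallyEq {f : S → ℝ} {W : Set S} (hW : IsOpen W)
    (hf : ContMDiffOn 𝓘(ℝ, E) 𝓘(ℝ, ℝ) ∞ f W) {x : S} (hx : x ∈ W) :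
    chartCovec (V := E) (I := 𝓘(ℝ, E)) (differential f) x
      =ᶠ[𝓝 (extChartAt 𝓘(ℝ, E) x x)] fderiv ℝ (chartFun f x) := by
  filter_upwards [eventually_symm_mem hW hx] with y hy
  exact chartCovec_differential hy.1
    (((hf _ hy.2).contMDiffAt (hW.mem_nhds hy.2)).mdifferentiableAt (by simp))

variable [FiniteDimensional ℝ E]

/-- In a chart, `σ^♯` is metrically related to `σ`. -/
theorem chartForm_sharp {γ : FormField 𝓘(ℝ, E) (M := S)} {σ : CovectorField 𝓘(ℝ, E) (M := S)}
    {x : S} {y : E} (hy : y ∈ (extChartAt 𝓘(ℝ, E) x).target)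
    (hγ : ∀ a : E, a ≠ 0 → 0 < formVal γ ((extChartAt 𝓘(ℝ, E) x).symm y) a a) :
    chartForm γ x y (chartVec (sharp γ σ) x y) = chartCovec σ x y := by
  have h1 : (formVal γ ((extChartAt 𝓘(ℝ, E) x).symm y)).IsInvertible := isInvertible_of_pos hγ
  refine ContinuousLinearMap.ext fun a => ?_
  rw [chartForm_apply, chartCovec_apply, chartVec_apply,
    (chartFrame_isInvertible hy).self_apply_inverse]
  exact DFunLike.congr_fun (h1.self_apply_inverse _) _

/-- Only the germ of the chart expression matters, so an explicit local formula `Y` may replace it.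
-/
theorem lieDeriv_nhgMetric (D : HorizonData E S) {Z : VecField (stModel E) (M := ℝ × ℝ × S)}
    {p : ℝ × ℝ × S} {Y : ℝ × ℝ × E → ℝ × ℝ × E} {y : ℝ × ℝ × E}
    (hy : y = (p.1, p.2.1, extChartAt 𝓘(ℝ, E) p.2.2 p.2.2))
    (hY : chartVec Z p =ᶠ[𝓝 y] Y) (a b : ℝ × ℝ × E) :
    lieDeriv (nhgMetric D) Z p a b =
      fderiv ℝ (nhgLocal (chartForm D.γ p.2.2) (chartCovec D.s p.2.2) (chartFun D.h p.2.2)) y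
        (Y y) a b
      + nhgLocal (chartForm D.γ p.2.2) (chartCovec D.s p.2.2) (chartFun D.h p.2.2) y
        (fderiv ℝ Y y a) b
      + nhgLocal (chartForm D.γ p.2.2) (chartCovec D.s p.2.2) (chartFun D.h p.2.2) y
        a (fderiv ℝ Y y b) := by
  have h1 := chartForm_nhgMetric_eventuallyEq D p
  have hy' : y = extChartAt (stModel E) p p := hy.trans (extChartAt_st p p).symm
  rw [← hy'] at h1
  unfold lieDeriv
  simp only [← hy']
  rw [h1.fderiv_eq, h1.eq_of_nhds, hY.fderiv_eq, hY.eq_of_nhds]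

theorem covDeriv_nhgMetric (D : HorizonData E S) {Z : VecField (stModel E) (M := ℝ × ℝ × S)}
    {p : ℝ × ℝ × S} {Y : ℝ × ℝ × E → ℝ × ℝ × E} {y : ℝ × ℝ × E}
    (hy : y = (p.1, p.2.1, extChartAt 𝓘(ℝ, E) p.2.2 p.2.2))
    (hY : chartVec Z p =ᶠ[𝓝 y] Y) (X : ℝ × ℝ × E) :
    covDeriv (nhgMetric D) Z p X = fderiv ℝ Y y X + christoffel
      (nhgLocal (chartForm D.γ p.2.2) (chartCovec D.s p.2.2) (chartFun D.h p.2.2)) y X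
      (vecVal Z p) := by
  have h1 := chartForm_nhgMetric_eventuallyEq D p
  have hy' : y = extChartAt (stModel E) p p := hy.trans (extChartAt_st p p).symm
  rw [← hy'] at h1
  unfold covDeriv
  simp only [← hy']
  rw [christoffel_congr h1, hY.fderiv_eq]
  rfl

theorem ricci_nhgMetric (D : HorizonData E S) (p : ℝ × ℝ × S) :
    formVal (ricci (nhgMetric D)) p = ricciLocal
      (nhgLocal (chartForm D.γ p.2.2) (chartCovec D.s p.2.2) (chartFun D.h p.2.2))
      (p.1, p.2.1, extChartAt 𝓘(ℝ, E) p.2.2 p.2.2) := by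
  have h1 := chartForm_nhgMetric_eventuallyEq D p
  have h2 := ricciLocal_congr h1
  rw [extChartAt_st] at h2
  rw [← h2, ← extChartAt_st]
  rfl

theorem formVal_nhgMetric (D : HorizonData E S) (p : ℝ × ℝ × S) :
    formVal (nhgMetric D) p =
      nhgLocal (chartForm D.γ p.2.2) (chartCovec D.s p.2.2) (chartFun D.h p.2.2)
      (p.1, p.2.1, extChartAt 𝓘(ℝ, E) p.2.2 p.2.2) := by
  rw [← extChartAt_st, ← (chartForm_nhgMetric_eventuallyEq D p).eq_of_nhds, chartForm_self]

end Fields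

/-! ### Vector fields equal to `f ∂_v` on the horizon -/

section HorizonFields

variable {E S : Type*} [NormedAddCommGroup E] [NormedSpace ℝ E]
  [TopologicalSpace S] [ChartedSpace E S] [IsManifold 𝓘(ℝ, E) ∞ S]

/-- On the horizon over `W`, the vector field `Z` is smooth and equal to `f ∂_v`. -/
structure IsHorizonField (Z : VecField (stModel E) (M := ℝ × ℝ × S)) (f : S → ℝ) (W : Set S) :
    Prop where
  smooth : ∀ p ∈ horizon W, ContDiffAt ℝ ∞ (chartVec Z p) (extChartAt (stModel E) p p)
  eq : ∀ v, ∀ x ∈ W, vecVal Z (0, v, x) = ((0, f x, 0) : ℝ × ℝ × E)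

variable {Z : VecField (stModel E) (M := ℝ × ℝ × S)} {f : S → ℝ} {W : Set S}

theorem IsHorizonField.chartVec_eventuallyEq (hZ : IsHorizonField Z f W) (hW : IsOpen W) {x : S}
    (hx : x ∈ W) (v : ℝ) :
    (fun z : ℝ × E => chartVec Z (0, v, x) (0, z)) =ᶠ[𝓝 (v, extChartAt 𝓘(ℝ, E) x x)]
      fun z => (0, chartFun f x z.2, 0) := by
  have h := (continuous_snd.tendsto (v, extChartAt 𝓘(ℝ, E) x x)).eventually
    (eventually_symm_mem hW hx)
  filter_upwards [h] with z hz
  rw [chartVec_st Z (p := (0, v, x)) (y := (0, z)) hz.1 (hZ.eq _ _ hz.2)]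
  simp [chartFun]

theorem IsHorizonField.contMDiffAt (hZ : IsHorizonField Z f W) (hW : IsOpen W) {x : S}
    (hx : x ∈ W) : ContMDiffAt 𝓘(ℝ, E) 𝓘(ℝ, ℝ) ∞ f x := by
  rw [contMDiffAt_iff_contDiffAt_symm]
  have h1 := hZ.smooth (0, 0, x) ⟨rfl, hx⟩
  rw [extChartAt_st] at h1
  have h2 : ContDiffAt ℝ ∞ (fun z : E => chartVec Z (0, 0, x) (0, 0, z))
      (extChartAt 𝓘(ℝ, E) x x) :=
    ContDiffAt.comp (g := chartVec Z (0, 0, x)) _ h1 (by fun_prop)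
  have h3 : ContDiffAt ℝ ∞ (fun z : E => (chartVec Z (0, 0, x) (0, 0, z)).2.1)
      (extChartAt 𝓘(ℝ, E) x x) := by fun_prop
  refine h3.congr_of_eventuallyEq ?_
  have h4 : Tendsto (fun z : E => ((0 : ℝ), z)) (𝓝 (extChartAt 𝓘(ℝ, E) x x))
      (𝓝 (0, extChartAt 𝓘(ℝ, E) x x)) := (Continuous.prodMk_right 0).tendsto _
  filter_upwards [h4.eventually (hZ.chartVec_eventuallyEq hW hx 0)] with z hz
  rw [hz]
  rfl

theorem IsHorizonField.contMDiffOn (hZ : IsHorizonField Z f W) (hW : IsOpen W) :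
    ContMDiffOn 𝓘(ℝ, E) 𝓘(ℝ, ℝ) ∞ f W :=
  fun _ hx => (hZ.contMDiffAt hW hx).contMDiffWithinAt

variable [FiniteDimensional ℝ E] {D : HorizonData E S}

/-- The Leibniz rule for `f ∂_v` together with `∇_X ∂_v = -s(X) ∂_v`. -/
theorem IsHorizonField.covDeriv_eq (hZ : IsHorizonField Z f W) (hW : IsOpen W)
    (hD : D.IsRegularOn W) {x : S} (hx : x ∈ W) (v : ℝ) (X : ℝ × E) :
    covDeriv (nhgMetric D) Z (0, v, x) ((0, X) : ℝ × ℝ × E) =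
      ((0, covecVal (V := E) (I := 𝓘(ℝ, E)) (differential f) x X.2
        - f x * covecVal (V := E) (I := 𝓘(ℝ, E)) D.s x X.2, 0) : ℝ × ℝ × E) := by
  have hf := hZ.contMDiffAt hW hx
  have hd := hD.localData hW hx
  have hfd : DifferentiableAt ℝ (chartFun f x) (extChartAt 𝓘(ℝ, E) x x) :=
    (contMDiffAt_iff_contDiffAt_symm.1 hf).differentiableAt (by simp)
  refine (covDeriv_nhgMetric D (y := (0, v, extChartAt 𝓘(ℝ, E) x x)) rfl
    (EventuallyEq.refl _ _) _).trans ?_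
  have h1 := (hZ.smooth (0, v, x) ⟨rfl, hx⟩).differentiableAt (by simp)
  rw [extChartAt_st] at h1
  -- The direction is tangent to the horizon, so the derivative only sees the restriction of `Z` to
  -- `u = 0`, which is known.
  have h2 : HasFDerivAt (fun z : ℝ × E => chartVec Z (0, v, x) (0, z))
      ((fderiv ℝ (chartVec Z (0, v, x)) (0, v, extChartAt 𝓘(ℝ, E) x x)).comp
        (ContinuousLinearMap.inr ℝ ℝ (ℝ × E))) (v, extChartAt 𝓘(ℝ, E) x x) :=
    HasFDerivAt.comp (g := chartVec Z (0, v, x)) _ h1.hasFDerivAt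
      (hasFDerivAt_prodMk_right 0 _)
  have h3 : HasFDerivAt (fun z : ℝ × E => ((0, chartFun f x z.2, 0) : ℝ × ℝ × E))
      ((0 : ℝ × E →L[ℝ] ℝ).prod (((fderiv ℝ (chartFun f x) (extChartAt 𝓘(ℝ, E) x x)).comp
        (ContinuousLinearMap.snd ℝ ℝ E)).prod 0)) (v, extChartAt 𝓘(ℝ, E) x x) :=
    (hasFDerivAt_const _ _).prodMk ((HasFDerivAt.comp (g := chartFun f x)
      (v, extChartAt 𝓘(ℝ, E) x x) hfd.hasFDerivAt hasFDerivAt_snd).prodMk (hasFDerivAt_const _ _))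
  have h4 := h2.unique (h3.congr_of_eventuallyEq (hZ.chartVec_eventuallyEq hW hx v))
  have h5 := DFunLike.congr_fun h4 X
  simp only [ContinuousLinearMap.comp_apply, ContinuousLinearMap.inr_apply] at h5
  rw [h5, hZ.eq v x hx]
  have e : ((0, f x, 0) : ℝ × ℝ × E) = f x • ((0, 1, 0) : ℝ × ℝ × E) := by simp
  dsimp only
  rw [e, map_smul, hd.christoffel_symm, hd.christoffel_dv,
    covecVal_differential (hf.mdifferentiableAt (by simp)), chartCovec_self]
  simp [sub_eq_add_neg]
  rfl

theorem cutTangent_apply {φ : S → ℝ} {x : S} (hφ : MDifferentiableAt 𝓘(ℝ, E) 𝓘(ℝ, ℝ) φ x)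
    (a : E) :
    cutTangent (E := E) φ x a = (0, covecVal (V := E) (I := 𝓘(ℝ, E)) (differential φ) x a, a) := by
  have h := (hasMFDerivAt_const (I := 𝓘(ℝ, E)) (I' := 𝓘(ℝ, ℝ)) (0 : ℝ) x).prodMk
    (hφ.hasMFDerivAt.prodMk (hasMFDerivAt_id (I := 𝓘(ℝ, E)) x))
  have h' : HasMFDerivAt 𝓘(ℝ, E) (stModel E) (cut φ) x _ := h
  exact congrFun (congrArg DFunLike.coe h'.mfderiv) a

theorem divergence_eq (γ : FormField 𝓘(ℝ, E) (M := S)) (σ : CovectorField 𝓘(ℝ, E) (M := S))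
    (x : S) : divergence γ σ x = traceWith (chartForm γ x (extChartAt 𝓘(ℝ, E) x x))
      (fderiv ℝ (chartCovec σ x) (extChartAt 𝓘(ℝ, E) x x)
        - (ContinuousLinearMap.compL ℝ E E ℝ (chartCovec σ x (extChartAt 𝓘(ℝ, E) x x))) ∘L
          christoffel (chartForm γ x) (extChartAt 𝓘(ℝ, E) x x)) := by
  rw [chartForm_self]
  rfl

theorem divergence_congr {γ γ' : FormField 𝓘(ℝ, E) (M := S)}
    {σ σ' : CovectorField 𝓘(ℝ, E) (M := S)} (hW : IsOpen W)
    (hγ : ∀ x ∈ W, γ x = γ' x) (hσ : ∀ x ∈ W, σ x = σ' x) {x : S} (hx : x ∈ W) :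
    divergence γ σ x = divergence γ' σ' x := by
  have h1 : chartForm γ x =ᶠ[𝓝 (extChartAt 𝓘(ℝ, E) x x)] chartForm γ' x := by
    filter_upwards [eventually_symm_mem hW hx] with y hy
    simp only [chartForm, hγ _ hy.2]
  have h2 : chartCovec σ x =ᶠ[𝓝 (extChartAt 𝓘(ℝ, E) x x)] chartCovec σ' x := by
    filter_upwards [eventually_symm_mem hW hx] with y hy
    simp only [chartCovec, hσ _ hy.2]
  rw [divergence_eq, divergence_eq, christoffel_congr h1, h1.eq_of_nhds, h2.eq_of_nhds,
    h2.fderiv_eq]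

end HorizonFields

/-! ### The near-horizon data with respect to a horizon field, on an arbitrary cut -/

section NearHorizonData

variable {E S : Type*} [NormedAddCommGroup E] [NormedSpace ℝ E]
  [TopologicalSpace S] [ChartedSpace E S] [IsManifold 𝓘(ℝ, E) ∞ S] [FiniteDimensional ℝ E]
  {Z : VecField (stModel E) (M := ℝ × ℝ × S)} {f φ : S → ℝ} {W : Set S} {D D' : HorizonData E S}

theorem nhgMetric_horizon_apply (D : HorizonData E S) (v : ℝ) (x : S) (a b : ℝ × ℝ × E) :
    nhgMetric D (0, v, x) a b =
      a.2.1 * b.1 + a.1 * b.2.1 + formVal (V := E) (I := 𝓘(ℝ, E)) D.γ x a.2.2 b.2.2 := by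
  refine (nhgForm_apply (E := E) _ _ _ _ _ _).trans ?_
  simp [formVal]

theorem scalarCurvature_cut (hW : IsOpen W) (hD : D.IsRegularOn W) {x : S} (hx : x ∈ W)
    (hφ : MDifferentiableAt 𝓘(ℝ, E) 𝓘(ℝ, ℝ) φ x) :
    scalarCurvature (nhgMetric D) (cut φ x) / 2
      - traceWith (V := E) (D.γ x)
          (pullbackForm (V := ℝ × ℝ × E) (ricci (nhgMetric D) (cut φ x)) (cutTangent φ x)) / 2 =
      D.h x - 2 * covecVal (V := E) (I := 𝓘(ℝ, E)) D.s x (vecVal (sharp D.γ D.s) x)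
        + divergence D.γ D.s x := by
  have h1 := (hD.localData hW hx).curvature_horizon (v := φ x) (cutTangent (E := E) φ x) _
    (cutTangent_apply hφ)
  have h2 : formVal (nhgMetric D) (cut φ x) = _ := formVal_nhgMetric D (0, φ x, x)
  have h3 : formVal (ricci (nhgMetric D)) (cut φ x) = _ := ricci_nhgMetric D (0, φ x, x)
  have h4 : chartForm D.γ x (extChartAt 𝓘(ℝ, E) x x) = formVal D.γ x := chartForm_self D.γ x
  have h5 : chartCovec D.s x (extChartAt 𝓘(ℝ, E) x x) = covecVal D.s x := chartCovec_self D.s x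
  dsimp only at h2 h3
  rw [← h2, ← h3, ← divergence_eq, h4, h5, chartFun_self] at h1
  exact h1

/-- `∇_X Z` is a multiple of `∂_v`, and `g(ℓ, ∂_v) = -1 / f` by the normalization of `ℓ`. The rest
of `ℓ`, and with it the cut, is irrelevant to the value. -/
theorem torsion_cut (hW : IsOpen W) (hD : D.IsRegularOn W) (hZ : IsHorizonField Z f W) {x : S}
    (hx : x ∈ W) (hf : f x ≠ 0) (hφ : MDifferentiableAt 𝓘(ℝ, E) 𝓘(ℝ, ℝ) φ x) (τ : E →L[ℝ] ℝ) :
    (∃ l : ℝ × ℝ × E,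
      (∀ a : E, nhgMetric D (cut φ x) l (cutTangent φ x a) = 0) ∧ nhgMetric D (cut φ x) l l = 0 ∧
      nhgMetric D (cut φ x) l (Z (cut φ x)) = -1 ∧
      ∀ a : E, τ a = nhgMetric D (cut φ x) l
        (covDeriv (nhgMetric D) Z (cut φ x) (cutTangent φ x a))) ↔
    τ = covecVal (V := E) (I := 𝓘(ℝ, E)) D.s x
      - (f x)⁻¹ • covecVal (V := E) (I := 𝓘(ℝ, E)) (differential f) x := by
  set α := covecVal (V := E) (I := 𝓘(ℝ, E)) (differential φ) x with hα
  set G := formVal (V := E) (I := 𝓘(ℝ, E)) D.γ x with hG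
  have hpos : ∀ a : E, a ≠ 0 → 0 < G a a := hD.pos x hx
  have hsymm : ∀ a b : E, G a b = G b a := hD.symm x hx
  have hinv : G.IsInvertible := isInvertible_of_pos hpos
  have e1 (l : ℝ × ℝ × E) (a : E) : nhgMetric D (cut φ x) l (cutTangent φ x a) =
      l.1 * α a + G l.2.2 a := by
    rw [cutTangent_apply hφ]
    refine (nhgMetric_horizon_apply D _ _ _ _).trans ?_
    simp [hα, hG]
  have e2 (l : ℝ × ℝ × E) : nhgMetric D (cut φ x) l l = 2 * l.1 * l.2.1 + G l.2.2 l.2.2 :=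
    (nhgMetric_horizon_apply D _ _ _ _).trans (by rw [← hG]; ring)
  have e3 (l : ℝ × ℝ × E) : nhgMetric D (cut φ x) l (Z (cut φ x)) = l.1 * f x := by
    have h : Z (cut φ x) = ((0, f x, 0) : ℝ × ℝ × E) := hZ.eq (φ x) x hx
    rw [h]
    refine (nhgMetric_horizon_apply D _ _ _ _).trans ?_
    simp
  have e4 (l : ℝ × ℝ × E) (a : E) : nhgMetric D (cut φ x) l
      (covDeriv (nhgMetric D) Z (cut φ x) (cutTangent φ x a)) =
      l.1 * (covecVal (V := E) (I := 𝓘(ℝ, E)) (differential f) x a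
        - f x * covecVal (V := E) (I := 𝓘(ℝ, E)) D.s x a) := by
    have h : covDeriv (nhgMetric D) Z (cut φ x) (cutTangent φ x a) =
        ((0, covecVal (V := E) (I := 𝓘(ℝ, E)) (differential f) x a
          - f x * covecVal (V := E) (I := 𝓘(ℝ, E)) D.s x a, 0) : ℝ × ℝ × E) := by
      rw [cutTangent_apply hφ]
      exact hZ.covDeriv_eq hW hD hx (φ x) (_, a)
    rw [h]
    refine (nhgMetric_horizon_apply D _ _ _ _).trans ?_
    simp
  simp only [e1, e2, e3, e4]
  constructor
  · rintro ⟨l, -, -, h3, h4⟩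
    ext a
    have h5 : l.1 = -(f x)⁻¹ := by field_simp; linarith
    rw [h4, h5, sub_apply, smul_apply, smul_eq_mul]
    field_simp
    ring
  · intro h
    -- The first entry comes from `g(ℓ, Z) = -1`, the third from orthogonality to the cut, the
    -- second from `g(ℓ, ℓ) = 0`.
    refine ⟨(-(f x)⁻¹, f x * G ((f x)⁻¹ • G.inverse α) ((f x)⁻¹ • G.inverse α) / 2,
      (f x)⁻¹ • G.inverse α), fun a => ?_, ?_, ?_, fun a => ?_⟩
    · dsimp only
      rw [map_smul, hinv.self_apply_inverse]
      simp
    · dsimp only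
      field_simp
      ring
    · simp [hf]
    · rw [h, sub_apply, smul_apply, smul_eq_mul]
      field_simp
      ring

/-- The right-hand side does not contain `φ`: this is the independence of the cut. Its last clause
says that `h - 2|s|² + div s` is the same for both sets of data. -/
theorem isNearHorizonData_iff (hW : IsOpen W) (hD : D.IsRegularOn W) (hZ : IsHorizonField Z f W)
    (hf : ∀ x ∈ W, f x ≠ 0) (hφ : ContMDiffOn 𝓘(ℝ, E) 𝓘(ℝ, ℝ) ∞ φ W) :
    IsNearHorizonData (nhgMetric D) Z φ W D' ↔ ∀ x ∈ W,
      formVal (V := E) (I := 𝓘(ℝ, E)) D'.γ x = formVal D.γ x ∧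
      covecVal (V := E) (I := 𝓘(ℝ, E)) D'.s x = covecVal D.s x
        - (f x)⁻¹ • covecVal (V := E) (I := 𝓘(ℝ, E)) (differential f) x ∧
      D'.h x = 2 * covecVal (V := E) (I := 𝓘(ℝ, E)) D'.s x (vecVal (sharp D'.γ D'.s) x)
        - divergence D'.γ D'.s x
        + (D.h x - 2 * covecVal (V := E) (I := 𝓘(ℝ, E)) D.s x (vecVal (sharp D.γ D.s) x)
          + divergence D.γ D.s x) := by
  have hφ' : ∀ x ∈ W, MDifferentiableAt 𝓘(ℝ, E) 𝓘(ℝ, ℝ) φ x := fun x hx =>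
    ((hφ x hx).contMDiffAt (hW.mem_nhds hx)).mdifferentiableAt (by simp)
  have e1 (x : S) (hx : x ∈ W) (a b : E) :
      nhgMetric D (cut φ x) (cutTangent φ x a) (cutTangent φ x b) =
        formVal (V := E) (I := 𝓘(ℝ, E)) D.γ x a b := by
    rw [cutTangent_apply (hφ' x hx), cutTangent_apply (hφ' x hx)]
    refine (nhgMetric_horizon_apply D _ _ _ _).trans ?_
    simp
  constructor
  · intro h x hx
    have h1 : formVal (V := E) (I := 𝓘(ℝ, E)) D'.γ x = formVal D.γ x :=
      ContinuousLinearMap.ext fun a => ContinuousLinearMap.ext fun b =>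
        (h.firstForm x hx a b).trans (e1 x hx a b)
    refine ⟨h1, (torsion_cut hW hD hZ hx (hf x hx) (hφ' x hx) _).1 (h.torsion x hx), ?_⟩
    have h2 := scalarCurvature_cut hW hD hx (hφ' x hx)
    have h3 := h.scalar x hx
    have h4 : D'.γ x = D.γ x := h1
    rw [← h2, ← h4, h3, ← add_sub_assoc]
    rfl
  · intro h
    refine ⟨fun x hx a b => ?_, fun x hx => ?_, fun x hx => ?_⟩
    · exact (congrFun (congrArg DFunLike.coe (congrFun (congrArg DFunLike.coe (h x hx).1) a))
        b).trans (e1 x hx a b).symm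
    · exact (torsion_cut hW hD hZ hx (hf x hx) (hφ' x hx) _).2 (h x hx).2.1
    · have h2 := scalarCurvature_cut hW hD hx (hφ' x hx)
      have h4 : D'.γ x = D.γ x := (h x hx).1
      rw [(h x hx).2.2, ← h2, ← h4, ← add_sub_assoc]
      rfl

/-- The near-horizon geometry of a near-horizon metric with respect to a horizon field without
zeros. -/
theorem isNearHorizonGeometry_of_eq (hW : IsOpen W) (hD : D.IsRegularOn W)
    (hZ : IsHorizonField Z f W) (hf : ∀ x ∈ W, f x ≠ 0)
    (hγ : ∀ x ∈ W, formVal (V := E) (I := 𝓘(ℝ, E)) D'.γ x = formVal D.γ x)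
    (hs : ∀ x ∈ W, covecVal (V := E) (I := 𝓘(ℝ, E)) D'.s x = covecVal D.s x
        - (f x)⁻¹ • covecVal (V := E) (I := 𝓘(ℝ, E)) (differential f) x)
    (hh : ∀ x ∈ W, D'.h x =
      2 * covecVal (V := E) (I := 𝓘(ℝ, E)) D'.s x (vecVal (sharp D'.γ D'.s) x)
        - divergence D'.γ D'.s x
        + (D.h x - 2 * covecVal (V := E) (I := 𝓘(ℝ, E)) D.s x (vecVal (sharp D.γ D.s) x)
          + divergence D.γ D.s x)) :
    IsNearHorizonGeometry (nhgMetric D) Z W D' := by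
  intro φ hφ D''
  rw [isNearHorizonData_iff hW hD hZ hf hφ]
  -- Agreement of `γ` and `s` on the open set `W` fixes the terms in `|s|²` and `div s`, hence `h`.
  have key (hγ' : ∀ x ∈ W, D''.γ x = D'.γ x) (hs' : ∀ x ∈ W, D''.s x = D'.s x) (x : S)
      (hx : x ∈ W) :
      2 * covecVal (V := E) (I := 𝓘(ℝ, E)) D''.s x (vecVal (sharp D''.γ D''.s) x)
        - divergence D''.γ D''.s x =
      2 * covecVal (V := E) (I := 𝓘(ℝ, E)) D'.s x (vecVal (sharp D'.γ D'.s) x)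
        - divergence D'.γ D'.s x := by
    rw [divergence_congr hW hγ' hs' hx]
    simp only [covecVal, vecVal, sharp, hγ' x hx, hs' x hx]
  constructor
  · intro h
    have h1 : ∀ x ∈ W, D''.γ x = D'.γ x := fun x hx => (h x hx).1.trans (hγ x hx).symm
    have h2 : ∀ x ∈ W, D''.s x = D'.s x := fun x hx => (h x hx).2.1.trans (hs x hx).symm
    refine fun x hx => ⟨h1 x hx, h2 x hx, ?_⟩
    rw [(h x hx).2.2, hh x hx, key h1 h2 x hx]
  · intro h x hx
    have h1 : ∀ x ∈ W, D''.γ x = D'.γ x := fun x hx => (h x hx).1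
    have h2 : ∀ x ∈ W, D''.s x = D'.s x := fun x hx => (h x hx).2.1
    refine ⟨(h1 x hx).trans (hγ x hx), (h2 x hx).trans (hs x hx), ?_⟩
    rw [key h1 h2 x hx, (h x hx).2.2, hh x hx]

end NearHorizonData

/-! ### A degenerate generator on the horizon -/

section Generators

variable {E S : Type*} [NormedAddCommGroup E] [NormedSpace ℝ E]
  [TopologicalSpace S] [ChartedSpace E S] [IsManifold 𝓘(ℝ, E) ∞ S]
  {Z : VecField (stModel E) (M := ℝ × ℝ × S)} {f : S → ℝ}

theorem SmoothVec.contDiffAt (hZ : SmoothVec Z univ) (p : ℝ × ℝ × S) :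
    ContDiffAt ℝ ∞ (chartVec Z p) (p.1, p.2.1, extChartAt 𝓘(ℝ, E) p.2.2 p.2.2) := by
  have h := contMDiffAt_vec_iff.1 ((hZ p (mem_univ p)).contMDiffAt univ_mem)
  rwa [extChartAt_st] at h

theorem chartVec_st_self (Z : VecField (stModel E) (M := ℝ × ℝ × S)) (p : ℝ × ℝ × S) (u v : ℝ) :
    chartVec Z p (u, v, extChartAt 𝓘(ℝ, E) p.2.2 p.2.2) = vecVal Z (u, v, p.2.2) := by
  rw [chartVec_st Z (p := p) (y := (u, v, extChartAt 𝓘(ℝ, E) p.2.2 p.2.2))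
    (mem_extChartAt_target p.2.2) rfl, chartFrame_self]
  dsimp only
  rw [ContinuousLinearMap.inverse_id, extChartAt_to_inv]
  rfl

theorem chartVec_st_v (Z : VecField (stModel E) (M := ℝ × ℝ × S)) {p : ℝ × ℝ × S}
    {y : ℝ × ℝ × E} (hy : y.2.2 ∈ (extChartAt 𝓘(ℝ, E) p.2.2).target) :
    (chartVec Z p y).2.1 =
      (vecVal Z (y.1, y.2.1, (extChartAt 𝓘(ℝ, E) p.2.2).symm y.2.2) : ℝ × ℝ × E).2.1 := by
  rw [chartVec_st Z hy rfl]

theorem SmoothVec.hasDerivAt_u (hZ : SmoothVec Z univ) (u v : ℝ) (x : S) :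
    HasDerivAt (fun t => (vecVal Z (t, v, x) : ℝ × ℝ × E))
      (fderiv ℝ (chartVec Z (u, v, x)) (u, v, extChartAt 𝓘(ℝ, E) x x) (1, 0, 0)) u := by
  have h1 := ((hZ.contDiffAt (u, v, x)).differentiableAt (by simp)).hasFDerivAt
  have h2 : HasDerivAt (fun t : ℝ => ((t, v, extChartAt 𝓘(ℝ, E) x x) : ℝ × ℝ × E)) (1, 0, 0) u :=
    (hasDerivAt_id u).prodMk ((hasDerivAt_const u v).prodMk (hasDerivAt_const u _))
  have h3 := HasFDerivAt.comp_hasDerivAt u (f := fun t : ℝ =>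
    ((t, v, extChartAt 𝓘(ℝ, E) x x) : ℝ × ℝ × E)) h1 h2
  refine h3.congr_of_eventuallyEq (Eventually.of_forall fun t => ?_)
  exact (chartVec_st_self Z (u, v, x) t v).symm

/-- One chart serves all points near `p`, because the `v`-component does not depend on the chart of
`S`. This makes the derivative continuous in the base point. -/
theorem SmoothVec.hasDerivAt_v (hZ : SmoothVec Z univ) (p : ℝ × ℝ × S) :
    ∀ᶠ q in 𝓝 p, HasDerivAt
      (fun t => (vecVal Z (q.1, t, q.2.2) : ℝ × ℝ × E).2.1)
      (fderiv ℝ (chartVec Z p) (extChartAt (stModel E) p q) (0, 1, 0)).2.1 q.2.1 := by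
  have h1 : ∀ᶠ y in 𝓝 (extChartAt (stModel E) p p), ContDiffAt ℝ 1 (chartVec Z p) y := by
    rw [extChartAt_st]
    exact ((hZ.contDiffAt p).of_le (m := 1) (by simp)).eventually (by simp)
  have h2 := (continuousAt_extChartAt (I := stModel E) p).eventually h1
  filter_upwards [h2, extChartAt_source_mem_nhds (I := stModel E) p] with q hq hs
  have hm := (extChartAt (stModel E) p).map_source hs
  have hi := (extChartAt (stModel E) p).left_inv hs
  rw [extChartAt_st] at hm hi hq ⊢
  rw [extChartAt_st_symm] at hi
  have hx : (extChartAt 𝓘(ℝ, E) p.2.2).symm (extChartAt 𝓘(ℝ, E) p.2.2 q.2.2) = q.2.2 :=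
    congrArg (fun z : ℝ × ℝ × S => z.2.2) hi
  rw [mem_extChartAt_st_target] at hm
  have h3 : HasDerivAt (fun t : ℝ => ((q.1, t, extChartAt 𝓘(ℝ, E) p.2.2 q.2.2) : ℝ × ℝ × E))
      (0, 1, 0) q.2.1 :=
    (hasDerivAt_const _ _).prodMk ((hasDerivAt_id q.2.1).prodMk (hasDerivAt_const _ _))
  have h4 := HasFDerivAt.comp_hasDerivAt q.2.1 (f := fun t : ℝ =>
    ((q.1, t, extChartAt 𝓘(ℝ, E) p.2.2 q.2.2) : ℝ × ℝ × E))
    (hq.differentiableAt (by simp)).hasFDerivAt h3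
  have h5 := (hasFDerivAt_fst (𝕜 := ℝ) (E := ℝ) (F := E)).comp_hasDerivAt q.2.1
    ((hasFDerivAt_snd (𝕜 := ℝ) (E := ℝ) (F := ℝ × E)).comp_hasDerivAt q.2.1 h4)
  refine h5.congr_of_eventuallyEq (Eventually.of_forall fun t => ?_)
  refine Eq.trans ?_ (chartVec_st_v Z (p := p)
    (y := (q.1, t, extChartAt 𝓘(ℝ, E) p.2.2 q.2.2)) hm).symm
  dsimp only
  rw [hx]

theorem SmoothVec.continuousAt_deriv_v (hZ : SmoothVec Z univ) (p : ℝ × ℝ × S) :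
    ContinuousAt (fun q : ℝ × ℝ × S =>
      deriv (fun t => (vecVal Z (q.1, t, q.2.2) : ℝ × ℝ × E).2.1) q.2.1) p := by
  have h1 := (hZ.contDiffAt p).fderiv_right (m := ∞) le_rfl
  have h2 : ContinuousAt (fderiv ℝ (chartVec Z p)) (extChartAt (stModel E) p p) := by
    rw [extChartAt_st]
    exact h1.continuousAt
  have h3 := h2.comp (continuousAt_extChartAt (I := stModel E) p)
  have h4 : ContinuousAt (fun q => (fderiv ℝ (chartVec Z p) (extChartAt (stModel E) p q)
      (0, 1, 0)).2.1) p :=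
    (h3.clm_apply continuousAt_const).snd.fst
  refine h4.congr ?_
  filter_upwards [hZ.hasDerivAt_v p] with q hq
  exact hq.deriv.symm

theorem SmoothVec.continuousAt_chartVec (hZ : SmoothVec Z univ) (p : ℝ × ℝ × S) :
    ContinuousAt (fun q => chartVec Z p (extChartAt (stModel E) p q)) p := by
  refine ContinuousAt.comp (g := chartVec Z p) ?_ (continuousAt_extChartAt (I := stModel E) p)
  rw [extChartAt_st]
  exact (hZ.contDiffAt p).continuousAt

variable [FiniteDimensional ℝ E] {D : HorizonData E S}

/-- Orthogonality of `Z` to its own `S`-component makes the `γ`-norm of that component vanish. -/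
theorem IsKillingHorizon.eq_zero {κ : ℝ} {K : Set (ℝ × ℝ × S)}
    (hK : IsKillingHorizon (nhgMetric D) Z κ K) (hD : D.IsRegularOn univ) {p : ℝ × ℝ × S}
    (hp : p ∈ K) (h0 : p.1 = 0) :
    (vecVal Z p : ℝ × ℝ × E).1 = 0 ∧ (vecVal Z p : ℝ × ℝ × E).2.2 = 0 := by
  refine ⟨hK.tangent p hp, ?_⟩
  by_contra hne
  have h1 := hK.null p hp (0, 0, (vecVal Z p : ℝ × ℝ × E).2.2) rfl
  obtain ⟨u, v, x⟩ := p
  obtain rfl : u = 0 := h0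
  have h2 := (nhgMetric_horizon_apply D v x (vecVal Z (0, v, x))
    (0, 0, (vecVal Z (0, v, x) : ℝ × ℝ × E).2.2)).symm.trans h1
  have h3 : 0 < formVal (V := E) (I := 𝓘(ℝ, E)) D.γ x (vecVal Z (0, v, x) : ℝ × ℝ × E).2.2
    (vecVal Z (0, v, x) : ℝ × ℝ × E).2.2 := hD.pos x (mem_univ x) _ hne
  simp only [mul_zero, zero_add] at h2
  exact h3.ne' h2

/-- Write `Z = c ∂_v` at the point, with `c ≠ 0`. Since `∇_{∂_v} ∂_v = 0` on the horizon, `∇_Z Z =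
0` reduces to `c ∂_v Z = 0`. -/
theorem IsKillingHorizon.deriv_v {K : Set (ℝ × ℝ × S)}
    (hK : IsKillingHorizon (nhgMetric D) Z 0 K) (hZ : SmoothVec Z univ) (hD : D.IsRegularOn univ)
    {p : ℝ × ℝ × S} (hp : p ∈ K) (h0 : p.1 = 0) :
    deriv (fun t => (vecVal Z (p.1, t, p.2.2) : ℝ × ℝ × E).2.1) p.2.1 = 0 := by
  rw [(hZ.hasDerivAt_v p).self_of_nhds.deriv]
  obtain ⟨h1, h2⟩ := hK.eq_zero hD hp h0
  obtain ⟨u, v, x⟩ := p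
  obtain rfl : u = 0 := h0
  have h3 : (vecVal Z (0, v, x) : ℝ × ℝ × E) =
      (vecVal Z (0, v, x) : ℝ × ℝ × E).2.1 • ((0, 1, 0) : ℝ × ℝ × E) := by
    ext1
    · simpa using h1
    · ext1
      · simp
      · simpa using h2
  set c := (vecVal Z (0, v, x) : ℝ × ℝ × E).2.1
  have hc : c ≠ 0 := by
    intro hc
    rw [hc, zero_smul] at h3
    exact hK.nonzero _ hp h3
  have h4 := (covDeriv_nhgMetric D (Z := Z) (p := (0, v, x))
    (y := (0, v, extChartAt 𝓘(ℝ, E) x x)) rfl (EventuallyEq.refl _ _)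
    (vecVal Z (0, v, x))).symm.trans (hK.surfaceGravity _ hp)
  have h5 : ((0 : ℝ) • Z (0, v, x) : TangentSpace (stModel E) ((0, v, x) : ℝ × ℝ × S)) =
    (0 : ℝ × ℝ × E) := zero_smul _ _
  have hd := hD.localData isOpen_univ (mem_univ x)
  have h6 : fderiv ℝ (chartVec Z (0, v, x)) (0, v, extChartAt 𝓘(ℝ, E) x x) (vecVal Z (0, v, x))
      + christoffel (nhgLocal (chartForm D.γ x) (chartCovec D.s x) (chartFun D.h x))
        (0, v, extChartAt 𝓘(ℝ, E) x x) (vecVal Z (0, v, x)) (vecVal Z (0, v, x)) =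
      (0 : ℝ × ℝ × E) := h4.trans h5
  rw [h3, map_smul, map_smul, map_smul, smul_apply, hd.christoffel_dv] at h6
  have h7 : c • (fderiv ℝ (chartVec Z (0, v, x)) (0, v, extChartAt 𝓘(ℝ, E) x x) (0, 1, 0)) = 0 := by
    have e : ((0, 0, 0) : ℝ × ℝ × E) = 0 := rfl
    simpa only [map_zero, neg_zero, zero_smul, smul_zero, e, add_zero] using h6
  have h8 := (smul_eq_zero.1 h7).resolve_left hc
  rw [extChartAt_st]
  dsimp only
  rw [h8]
  rfl

/-- A degenerate generator of the horizon is `f ∂_v` there. -/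
theorem IsHorizonGenerator.isHorizonField (hZ : IsHorizonGenerator (nhgMetric D) Z 0 univ)
    (hD : D.IsRegularOn univ)
    (hf : ∀ x, vecVal Z (0, 0, x) = ((0, f x, 0) : ℝ × ℝ × E)) :
    IsHorizonField Z f univ := by
  obtain ⟨⟨hs, -⟩, O, -, hO, hK⟩ := hZ
  have hs : SmoothVec Z univ := fun p _ => (hs p (mem_univ p.2.2)).mono (fun q _ => mem_univ q.2.2)
  have hcl (v : ℝ) (x : S) : ((0, v, x) : ℝ × ℝ × S) ∈ closure (O ∩ horizon univ) :=
    hO ⟨rfl, mem_univ x⟩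
  have h1 (v : ℝ) (x : S) : (vecVal Z (0, v, x) : ℝ × ℝ × E).1 = 0 ∧
      (vecVal Z (0, v, x) : ℝ × ℝ × E).2.2 = 0 := by
    set p : ℝ × ℝ × S := (0, v, x)
    have hA : IsClosed {a : ℝ × ℝ × E | a.1 = 0 ∧ a.2.2 = 0} :=
      (isClosed_eq continuous_fst continuous_const).inter
        (isClosed_eq (by fun_prop) continuous_const)
    -- The closed condition holds on a dense part of the horizon, and the chart expression of `Z` is
    -- continuous.
    have h := ((hs.continuousAt_chartVec p).continuousWithinAt).mem_closure
      (s := (extChartAt (stModel E) p).source ∩ (O ∩ horizon univ))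
      (t := {a : ℝ × ℝ × E | a.1 = 0 ∧ a.2.2 = 0})
      ((isOpen_extChartAt_source p).inter_closure ⟨mem_extChartAt_source p, hcl v x⟩) ?_
    · rw [hA.closure_eq, chartVec_self] at h
      exact h
    · rintro q ⟨hq, hqK⟩
      have hq' := hK.eq_zero hD hqK hqK.2.1
      have hm := (extChartAt (stModel E) p).map_source hq
      have hi := (extChartAt (stModel E) p).left_inv hq
      rw [extChartAt_st_symm] at hi
      rw [mem_extChartAt_st_target] at hm
      dsimp only
      rw [chartVec_st Z hm (congrArg (vecVal Z) hi)]
      exact ⟨hq'.1, by simp [hq'.2]⟩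
  have h2 (v : ℝ) (x : S) :
      deriv (fun t => (vecVal Z (0, t, x) : ℝ × ℝ × E).2.1) v = 0 := by
    have h := ((hs.continuousAt_deriv_v (0, v, x)).continuousWithinAt).mem_closure (hcl v x)
      (t := {0}) (fun q hq => hK.deriv_v hs hD hq hq.2.1)
    rwa [isClosed_singleton.closure_eq] at h
  -- The component is constant along each line in `v`, so it equals its value on the cut `v = 0`.
  have h3 (v : ℝ) (x : S) : (vecVal Z (0, v, x) : ℝ × ℝ × E).2.1 = f x := by
    have h := is_const_of_deriv_eq_zero
      (f := fun t => (vecVal Z (0, t, x) : ℝ × ℝ × E).2.1)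
      (fun t => (hs.hasDerivAt_v (0, t, x)).self_of_nhds.differentiableAt) (fun t => h2 t x) v 0
    rw [hf] at h
    exact h
  refine ⟨fun p _ => ?_, fun v x _ => ?_⟩
  · rw [extChartAt_st]
    exact hs.contDiffAt p
  · ext1
    · exact (h1 v x).1
    · ext1
      · exact h3 v x
      · exact (h1 v x).2

end Generators

/-! ### Integration of the Killing equation away from the horizon -/

section DegenerateKilling

variable {E S : Type*} [NormedAddCommGroup E] [NormedSpace ℝ E]
  [TopologicalSpace S] [ChartedSpace E S] [IsManifold 𝓘(ℝ, E) ∞ S] [FiniteDimensional ℝ E]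
  {Z : VecField (stModel E) (M := ℝ × ℝ × S)} {f : S → ℝ} {D : HorizonData E S}

theorem eq_of_hasDerivAt {F : Type*} [NormedAddCommGroup F] [NormedSpace ℝ F] {c c' : ℝ → F}
    {d : ℝ → F} (hc : ∀ t, HasDerivAt c (d t) t) (hc' : ∀ t, HasDerivAt c' (d t) t)
    (h0 : c 0 = c' 0) (t : ℝ) : c t = c' t := by
  have h := is_const_of_deriv_eq_zero (f := fun t => c t - c' t)
    (fun t => ((hc t).sub (hc' t)).differentiableAt)
    (fun t => by rw [((hc t).fun_sub (hc' t)).deriv, sub_self]) t 0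
  rw [h0, sub_self] at h
  exact sub_eq_zero.1 h

theorem metric_gradient (hD : D.IsRegularOn univ) (f : S → ℝ) (x : S) (a : E) :
    formVal (V := E) (I := 𝓘(ℝ, E)) D.γ x (vecVal (gradient D.γ f) x) a =
      covecVal (V := E) (I := 𝓘(ℝ, E)) (differential f) x a := by
  have hinv : (formVal (V := E) (I := 𝓘(ℝ, E)) D.γ x).IsInvertible :=
    isInvertible_of_pos (hD.pos x (mem_univ x))
  exact congrFun (congrArg DFunLike.coe (hinv.self_apply_inverse _)) a

/-- This is the Killing equation in the slots `(∂_u, b)`. Since `g(∂_u, b) = b^v` has constant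
coefficients, no derivative of the metric remains. -/
theorem killing_chart
    (hK : ∀ p a b, lieDeriv (nhgMetric D) Z p a b = 0) (hD : D.IsRegularOn univ)
    (u v : ℝ) (x : S) (b : ℝ × ℝ × E)
    {Y' : (ℝ × ℝ × E) →L[ℝ] (ℝ × ℝ × E)}
    (hY : fderiv ℝ (chartVec Z (u, v, x)) (u, v, extChartAt 𝓘(ℝ, E) x x) = Y') :
    (Y' (1, 0, 0)).2.1 * b.1 + (Y' (1, 0, 0)).1 * b.2.1
      + 2 * u * ((Y' (1, 0, 0)).2.1 * covecVal (V := E) (I := 𝓘(ℝ, E)) D.s x b.2.2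
        + b.2.1 * covecVal (V := E) (I := 𝓘(ℝ, E)) D.s x (Y' (1, 0, 0)).2.2)
      + u ^ 2 * D.h x * ((Y' (1, 0, 0)).2.1 * b.2.1)
      + formVal (V := E) (I := 𝓘(ℝ, E)) D.γ x (Y' (1, 0, 0)).2.2 b.2.2 + (Y' b).2.1 = 0 := by
  subst hY
  have h1 := (lieDeriv_nhgMetric D (p := (u, v, x)) (y := (u, v, extChartAt 𝓘(ℝ, E) x x)) rfl
    (EventuallyEq.refl _ (chartVec Z (u, v, x))) (1, 0, 0) b).symm.trans (hK _ _ _)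
  have hd := hD.localData isOpen_univ (mem_univ x)
  dsimp only at h1
  rw [LocalData.fderiv_nhgLocal (y := (u, v, extChartAt 𝓘(ℝ, E) x x)) hd, nhgLocal_apply,
    nhgLocal_apply] at h1
  have h4 : chartForm D.γ x (extChartAt 𝓘(ℝ, E) x x) = formVal D.γ x := chartForm_self D.γ x
  have h5 : chartCovec D.s x (extChartAt 𝓘(ℝ, E) x x) = covecVal D.s x := chartCovec_self D.s x
  dsimp only at h1
  rw [h4, h5, chartFun_self] at h1
  simp only [map_zero, zero_apply, mul_zero, zero_mul, add_zero, zero_add, one_mul] at h1 ⊢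
  linear_combination h1

/-- The degenerate generators of the horizon of a near-horizon metric. -/
theorem IsHorizonField.vecVal_eq (hH : IsHorizonField Z f univ) (hZ : SmoothVec Z univ)
    (hK : ∀ p a b, lieDeriv (nhgMetric D) Z p a b = 0) (hD : D.IsRegularOn univ)
    (u v : ℝ) (x : S) :
    vecVal Z (u, v, x) = ((u ^ 2 * covecVal (V := E) (I := 𝓘(ℝ, E)) D.s x
      (vecVal (gradient D.γ f) x), f x, -(u • vecVal (gradient D.γ f) x)) : ℝ × ℝ × E) := by
  have key := killing_chart hK hD
  -- The slots `(∂_u, ∂_u)` give `∂_u Z^v = 0`. Then `b` along `S` gives the derivative of the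
  -- `S`-component, and `b = ∂_v` that of `Z^u`.
  have h1 (u v : ℝ) (x : S) : (fderiv ℝ (chartVec Z (u, v, x)) (u, v, extChartAt 𝓘(ℝ, E) x x)
      (1, 0, 0)).2.1 = 0 := by
    have h := key u v x (1, 0, 0) rfl
    simp only [map_zero, mul_zero, zero_mul, add_zero, mul_one] at h
    linarith
  have du (u v : ℝ) (x : S) := hZ.hasDerivAt_u u v x
  have h2 (u v : ℝ) (x : S) : (vecVal Z (u, v, x) : ℝ × ℝ × E).2.1 = f x := by
    refine eq_of_hasDerivAt (c := fun t => (vecVal Z (t, v, x) : ℝ × ℝ × E).2.1)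
      (c' := fun _ => f x) (d := fun _ => 0) (fun t => ?_) (fun t => hasDerivAt_const _ _) ?_ u
    · have h5 := (hasFDerivAt_fst (𝕜 := ℝ) (E := ℝ) (F := E)).comp_hasDerivAt t
        ((hasFDerivAt_snd (𝕜 := ℝ) (E := ℝ) (F := ℝ × E)).comp_hasDerivAt t (du t v x))
      have h6 := h1 t v x
      rw [← h6]
      exact h5
    · exact congrArg (fun z : ℝ × ℝ × E => z.2.1) (hH.eq v x (mem_univ x))
  have h3 (u v : ℝ) (x : S) (b : ℝ × ℝ × E) :
      (fderiv ℝ (chartVec Z (u, v, x)) (u, v, extChartAt 𝓘(ℝ, E) x x) b).2.1 =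
        covecVal (V := E) (I := 𝓘(ℝ, E)) (differential f) x b.2.2 := by
    have hf := hH.contMDiffAt isOpen_univ (mem_univ x)
    have hfd : DifferentiableAt ℝ (chartFun f x) (extChartAt 𝓘(ℝ, E) x x) :=
      (contMDiffAt_iff_contDiffAt_symm.1 hf).differentiableAt (by simp)
    rw [covecVal_differential (hf.mdifferentiableAt (by simp))]
    have e1 := ((hZ.contDiffAt (u, v, x)).differentiableAt (by simp)).hasFDerivAt.snd.fst
    have e2 : HasFDerivAt (fun z : ℝ × ℝ × E => chartFun f x z.2.2) _
      ((u, v, extChartAt 𝓘(ℝ, E) x x) : ℝ × ℝ × E) :=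
      HasFDerivAt.comp (g := chartFun f x) ((u, v, extChartAt 𝓘(ℝ, E) x x) : ℝ × ℝ × E)
        hfd.hasFDerivAt (hasFDerivAt_snd.comp _ hasFDerivAt_snd)
    have e3 : (fun z : ℝ × ℝ × E => (chartVec Z (u, v, x) z).2.1)
        =ᶠ[𝓝 ((u, v, extChartAt 𝓘(ℝ, E) x x) : ℝ × ℝ × E)] fun z => chartFun f x z.2.2 := by
      filter_upwards [(tendsto_snd_snd ((u, v, extChartAt 𝓘(ℝ, E) x x) : ℝ × ℝ × E)).eventually
        (eventually_mem_target (I := 𝓘(ℝ, E)) x)] with z hz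
      exact (chartVec_st_v Z (p := (u, v, x)) hz).trans (h2 _ _ _)
    have e4 := e1.unique (e2.congr_of_eventuallyEq e3)
    exact DFunLike.congr_fun e4 b
  have h4 (u v : ℝ) (x : S) : (fderiv ℝ (chartVec Z (u, v, x)) (u, v, extChartAt 𝓘(ℝ, E) x x)
      (1, 0, 0)).2.2 = -vecVal (gradient D.γ f) x := by
    have hinv : (formVal (V := E) (I := 𝓘(ℝ, E)) D.γ x).IsInvertible :=
      isInvertible_of_pos (hD.pos x (mem_univ x))
    refine hinv.injective (ContinuousLinearMap.ext fun b => ?_)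
    have h := key u v x (0, 0, b) rfl
    rw [h1, h3] at h
    rw [map_neg, neg_apply, metric_gradient hD f x b]
    simp only [mul_zero, zero_mul, add_zero, zero_add] at h
    linarith
  have h5 (u v : ℝ) (x : S) : (fderiv ℝ (chartVec Z (u, v, x)) (u, v, extChartAt 𝓘(ℝ, E) x x)
      (1, 0, 0)).1 = 2 * u * covecVal (V := E) (I := 𝓘(ℝ, E)) D.s x
        (vecVal (gradient D.γ f) x) := by
    have h := key u v x (0, 1, 0) rfl
    rw [h1, h3, h4] at h
    simp only [map_zero, map_neg, mul_zero, add_zero, zero_add, one_mul, mul_one] at h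
    linarith
  ext1
  · refine eq_of_hasDerivAt (c := fun t => (vecVal Z (t, v, x) : ℝ × ℝ × E).1)
      (c' := fun t => t ^ 2 * covecVal (V := E) (I := 𝓘(ℝ, E)) D.s x (vecVal (gradient D.γ f) x))
      (fun t => (hasFDerivAt_fst (𝕜 := ℝ) (E := ℝ) (F := ℝ × E)).comp_hasDerivAt t (du t v x))
      (fun t => ?_) ?_ u
    · have e := ((hasDerivAt_pow 2 t).mul_const (covecVal (V := E) (I := 𝓘(ℝ, E)) D.s x
        (vecVal (gradient D.γ f) x)))
      refine e.congr_deriv ?_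
      refine Eq.trans ?_ (h5 t v x).symm
      simp
    · exact (congrArg (fun z : ℝ × ℝ × E => z.1) (hH.eq v x (mem_univ x))).trans (by simp)
  · ext1
    · exact h2 u v x
    · refine eq_of_hasDerivAt (c := fun t => (vecVal Z (t, v, x) : ℝ × ℝ × E).2.2)
        (c' := fun t => -(t • vecVal (gradient D.γ f) x))
        (fun t => (hasFDerivAt_snd (𝕜 := ℝ) (E := ℝ) (F := E)).comp_hasDerivAt t
          ((hasFDerivAt_snd (𝕜 := ℝ) (E := ℝ) (F := ℝ × E)).comp_hasDerivAt t (du t v x)))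
        (fun t => ?_) ?_ u
      · have e := ((hasDerivAt_id t).smul_const (vecVal (gradient D.γ f) x)).neg
        refine e.congr_deriv ?_
        refine Eq.trans ?_ (h4 t v x).symm
        simp
      · exact (congrArg (fun z : ℝ × ℝ × E => z.2.2) (hH.eq v x (mem_univ x))).trans (by simp)

end DegenerateKilling

/-! ### Linear algebra of metric traces -/

section Traces

variable {V : Type*} [NormedAddCommGroup V] [NormedSpace ℝ V]

theorem traceWith_add (g B C : V →L[ℝ] V →L[ℝ] ℝ) :
    traceWith g (B + C) = traceWith g B + traceWith g C := by
  simp [traceWith, ContinuousLinearMap.comp_add]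

theorem traceWith_sub (g B C : V →L[ℝ] V →L[ℝ] ℝ) :
    traceWith g (B - C) = traceWith g B - traceWith g C := by
  simp [traceWith, ContinuousLinearMap.comp_sub]

theorem traceWith_smul (g B : V →L[ℝ] V →L[ℝ] ℝ) (c : ℝ) :
    traceWith g (c • B) = c * traceWith g B := by
  simp [traceWith]

theorem traceWith_smulRight [FiniteDimensional ℝ V] (g : V →L[ℝ] V →L[ℝ] ℝ) (α β : V →L[ℝ] ℝ) :
    traceWith g (α.smulRight β) = α (g.inverse β) := by
  have h : ((g.inverse ∘L (α.smulRight β) : V →L[ℝ] V) : V →ₗ[ℝ] V) =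
      (α : V →ₗ[ℝ] ℝ).smulRight (g.inverse β) := by
    ext a
    simp
  rw [traceWith, h]
  exact LinearMap.trace_smulRight _ _

end Traces

/-! ### The Hessian equation and the new coefficient `h'` -/

section Coefficients

variable {E : Type*} [NormedAddCommGroup E] [NormedSpace ℝ E] [FiniteDimensional ℝ E]
  {G : E → E →L[ℝ] E →L[ℝ] ℝ} {s s' : E → E →L[ℝ] ℝ} {h φ : E → ℝ} {w : E → E} {x : E}

theorem MasterEq.inverse_fderiv (hm : MasterEq G s h φ w x) (hd : LocalData G s h x) :
    (G x).inverse (fderiv ℝ φ x) = w x := by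
  have e : G x (w x) = fderiv ℝ φ x := ContinuousLinearMap.ext hm.grad.self_of_nhds
  rw [← e, hd.isInvertible.inverse_apply_self]

theorem MasterEq.fderiv_inverse (hm : MasterEq G s h φ w x) (hd : LocalData G s h x)
    (σ : E →L[ℝ] ℝ) : fderiv ℝ φ x ((G x).inverse σ) = σ (w x) := by
  rw [← hm.grad.self_of_nhds, hd.symm.self_of_nhds, hd.isInvertible.self_apply_inverse]

/-- The first master equation prescribes `L_w γ`, and `L_w γ = 2 Hess φ` for `w = grad φ`. -/
theorem MasterEq.hessian (hm : MasterEq G s h φ w x) (hd : LocalData G s h x) :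
    fderiv ℝ (fderiv ℝ φ) x
      - (ContinuousLinearMap.compL ℝ E E ℝ (fderiv ℝ φ x)) ∘L (christoffel G x) =
    (fderiv ℝ φ x).smulRight (s x) + (s x).smulRight (fderiv ℝ φ x) := by
  refine ContinuousLinearMap.ext fun a => ContinuousLinearMap.ext fun b => ?_
  have h1 := hd.fderiv_fderiv_apply hm.smooth_w hm.smooth_φ hm.grad a b
  have h2 := hd.fderiv_fderiv_apply hm.smooth_w hm.smooth_φ hm.grad b a
  have h3 := fderiv_fderiv_symm hm.smooth_φ a b
  have h4 := hm.hess a b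
  have h5 : fderiv ℝ φ x (christoffel G x a b) = christoffelLower G x a b (w x) := by
    rw [← christoffel_spec hd.isInvertible, hd.symm.self_of_nhds, hm.grad.self_of_nhds]
  rw [christoffelLower_apply, hd.fderiv_symm a b, hd.fderiv_symm b a] at h5
  have h6 := hd.symm.self_of_nhds a (fderiv ℝ w x b)
  simp only [sub_apply, add_apply, ContinuousLinearMap.comp_apply,
    ContinuousLinearMap.compL_apply, ContinuousLinearMap.smulRight_apply, smul_apply, smul_eq_mul]
  linear_combination (1 / 2) * h1 + (1 / 2) * h2 + (1 / 2) * h3 - h5 + (1 / 2) * h4 - (1 / 2) * h6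

theorem MasterEq.trace_hessian (hm : MasterEq G s h φ w x) (hd : LocalData G s h x) :
    traceWith (G x) (fderiv ℝ (fderiv ℝ φ) x
      - (ContinuousLinearMap.compL ℝ E E ℝ (fderiv ℝ φ x)) ∘L (christoffel G x)) =
    2 * s x (w x) := by
  rw [hm.hessian hd, traceWith_add, traceWith_smulRight, traceWith_smulRight,
    hm.inverse_fderiv hd, hm.fderiv_inverse hd]
  ring

/-- The scalar coefficient of the near-horizon geometry with respect to another generator. -/
theorem MasterEq.scalar_coefficient (hm : MasterEq G s h φ w x) (hd : LocalData G s h x)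
    (h0 : φ x ≠ 0) (hs' : s' =ᶠ[𝓝 x] fun z => s z - (φ z)⁻¹ • fderiv ℝ φ z) :
    2 * s' x ((G x).inverse (s' x))
      - traceWith (G x) (fderiv ℝ s' x
        - (ContinuousLinearMap.compL ℝ E E ℝ (s' x)) ∘L (christoffel G x))
      + (h x - 2 * s x ((G x).inverse (s x)) + traceWith (G x) (fderiv ℝ s x
        - (ContinuousLinearMap.compL ℝ E E ℝ (s x)) ∘L (christoffel G x))) =
    h x + (φ x)⁻¹ ^ 2 * G x (w x) (w x) - 2 * (φ x)⁻¹ * s x (w x) := by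
  have e : s' x = s x - (φ x)⁻¹ • fderiv ℝ φ x := hs'.eq_of_nhds
  have hφ : HasFDerivAt φ (fderiv ℝ φ x) x := (hm.smooth_φ.differentiableAt (by simp)).hasFDerivAt
  have hφ' : HasFDerivAt (fderiv ℝ φ) (fderiv ℝ (fderiv ℝ φ) x) x :=
    ((hm.smooth_φ.fderiv_right (m := ∞) le_rfl).differentiableAt (by simp)).hasFDerivAt
  have hi : HasFDerivAt (fun z => (φ z)⁻¹) (-((φ x) ^ 2)⁻¹ • fderiv ℝ φ x) x :=
    (hasDerivAt_inv h0).comp_hasFDerivAt x hφ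
  have hs : HasFDerivAt s (fderiv ℝ s x) x :=
    (hd.smooth_s.differentiableAt (by simp)).hasFDerivAt
  have e' := (hs.fun_sub (hi.fun_smul hφ')).congr_of_eventuallyEq hs'
  -- In invariant form `∇s' = ∇s - Hess φ / φ + dφ ⊗ dφ / φ²`; the trace of the Hessian is `2 s(w)`.
  have e2 : fderiv ℝ s' x - (ContinuousLinearMap.compL ℝ E E ℝ (s' x)) ∘L (christoffel G x) =
      (fderiv ℝ s x - (ContinuousLinearMap.compL ℝ E E ℝ (s x)) ∘L (christoffel G x))
      - (φ x)⁻¹ • (fderiv ℝ (fderiv ℝ φ) x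
        - (ContinuousLinearMap.compL ℝ E E ℝ (fderiv ℝ φ x)) ∘L (christoffel G x))
      + (φ x)⁻¹ ^ 2 • (fderiv ℝ φ x).smulRight (fderiv ℝ φ x) := by
    refine ContinuousLinearMap.ext fun a => ContinuousLinearMap.ext fun b => ?_
    rw [e'.fderiv, e]
    simp only [sub_apply, add_apply, ContinuousLinearMap.comp_apply, neg_smul, neg_apply,
      ContinuousLinearMap.compL_apply, ContinuousLinearMap.smulRight_apply, smul_apply,
      smul_eq_mul]
    ring
  rw [e2, traceWith_add, traceWith_sub, traceWith_smul, traceWith_smul, traceWith_smulRight,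
    hm.trace_hessian hd, hm.inverse_fderiv hd, e]
  simp only [map_sub, map_smul, sub_apply, smul_apply, smul_eq_mul, hm.fderiv_inverse hd,
    hm.inverse_fderiv hd, ← hm.grad.self_of_nhds (w x)]
  ring

end Coefficients

/-! ### Chart expressions of gradients, pairings and degenerate fields -/

section Charts

variable {E S : Type*} [NormedAddCommGroup E] [NormedSpace ℝ E]
  [TopologicalSpace S] [ChartedSpace E S] [IsManifold 𝓘(ℝ, E) ∞ S] [FiniteDimensional ℝ E]
  {Z : VecField (stModel E) (M := ℝ × ℝ × S)} {f σ : S → ℝ} {W : Set S}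
  {w : VecField 𝓘(ℝ, E) (M := S)}

theorem chartFrame_chartVec (w : VecField 𝓘(ℝ, E) (M := S)) {x : S} {y : E}
    (hy : y ∈ (extChartAt 𝓘(ℝ, E) x).target) :
    chartFrame (V := E) (I := 𝓘(ℝ, E)) x y (chartVec w x y) =
      vecVal w ((extChartAt 𝓘(ℝ, E) x).symm y) := by
  rw [chartVec_apply]
  exact (chartFrame_isInvertible hy).self_apply_inverse _

theorem chartCovec_chartVec (τ : CovectorField 𝓘(ℝ, E) (M := S))
    (w : VecField 𝓘(ℝ, E) (M := S)) {x : S} {y : E}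
    (hy : y ∈ (extChartAt 𝓘(ℝ, E) x).target) :
    chartCovec τ x y (chartVec w x y) =
      chartFun (fun q => covecVal (V := E) (I := 𝓘(ℝ, E)) τ q (vecVal w q)) x y := by
  rw [chartCovec_apply, chartFrame_chartVec w hy]
  rfl

theorem chartForm_chartVec (γ : FormField 𝓘(ℝ, E) (M := S))
    (w : VecField 𝓘(ℝ, E) (M := S)) {x : S} {y : E}
    (hy : y ∈ (extChartAt 𝓘(ℝ, E) x).target) :
    chartForm γ x y (chartVec w x y) (chartVec w x y) =
      chartFun (fun q => formVal (V := E) (I := 𝓘(ℝ, E)) γ q (vecVal w q) (vecVal w q)) x y := by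
  rw [chartForm_apply, chartFrame_chartVec w hy]
  rfl

theorem chartVec_eq_degLocal {p : ℝ × ℝ × S} {y : ℝ × ℝ × E}
    (hy : y.2.2 ∈ (extChartAt 𝓘(ℝ, E) p.2.2).target)
    (hZ : vecVal Z (y.1, y.2.1, (extChartAt 𝓘(ℝ, E) p.2.2).symm y.2.2) =
      ((y.1 ^ 2 * chartFun σ p.2.2 y.2.2, chartFun f p.2.2 y.2.2,
        -(y.1 • vecVal w ((extChartAt 𝓘(ℝ, E) p.2.2).symm y.2.2))) : ℝ × ℝ × E)) :
    chartVec Z p y =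
      degLocal (chartFun σ p.2.2) (chartFun f p.2.2) (chartVec w p.2.2) y := by
  rw [chartVec_st Z hy hZ, degLocal]
  dsimp only
  rw [map_neg, map_smul, chartVec_apply]

theorem chartVec_eventuallyEq_degLocal (hW : IsOpen W)
    (hZ : ∀ u v, ∀ x ∈ W, vecVal Z (u, v, x) =
      ((u ^ 2 * σ x, f x, -(u • vecVal w x)) : ℝ × ℝ × E)) {x : S} (hx : x ∈ W) (u v : ℝ)
    {q : E → ℝ} (hq : chartFun σ x =ᶠ[𝓝 (extChartAt 𝓘(ℝ, E) x x)] q) (p : ℝ × ℝ × S)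
    (hp : p.2.2 = x) :
    chartVec Z p =ᶠ[𝓝 ((u, v, extChartAt 𝓘(ℝ, E) x x) : ℝ × ℝ × E)]
      degLocal q (chartFun f x) (chartVec w x) := by
  subst hp
  filter_upwards [(tendsto_snd_snd ((u, v, extChartAt 𝓘(ℝ, E) p.2.2 p.2.2) :
    ℝ × ℝ × E)).eventually (eventually_symm_mem hW hx),
    (tendsto_snd_snd ((u, v, extChartAt 𝓘(ℝ, E) p.2.2 p.2.2) : ℝ × ℝ × E)).eventually hq]
    with y hy hqy
  rw [chartVec_eq_degLocal hy.1 (hZ _ _ _ hy.2), degLocal, degLocal, hqy]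

end Charts

/-! ### Degenerate Killing vectors and solutions of the master equations -/

section MasterEqCharts

variable {E : Type*} [NormedAddCommGroup E] [NormedSpace ℝ E]

theorem MasterEq.congr_vec {G : E → E →L[ℝ] E →L[ℝ] ℝ} {s : E → E →L[ℝ] ℝ} {h φ : E → ℝ}
    {w w' : E → E} {x : E} (hm : MasterEq G s h φ w x) (hw : w' =ᶠ[𝓝 x] w) :
    MasterEq G s h φ w' x where
  smooth_φ := hm.smooth_φ
  smooth_w := hm.smooth_w.congr_of_eventuallyEq hw
  grad := by
    filter_upwards [hm.grad, hw] with z hz hzw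
    rwa [hzw]
  hess := by
    rw [hw.fderiv_eq, hw.eq_of_nhds]
    exact hm.hess
  lin := by
    rw [hw.fderiv_eq, hw.eq_of_nhds]
    exact hm.lin
  scal := by
    rw [hw.eq_of_nhds]
    exact hm.scal

variable {S : Type*} [TopologicalSpace S] [ChartedSpace E S]

/-- The master equations for `f`, in the preferred chart at every point of `W`. -/
def MasterEqOn (D : HorizonData E S) (f : S → ℝ) (w : VecField 𝓘(ℝ, E) (M := S)) (W : Set S) :
    Prop :=
  ∀ x ∈ W, MasterEq (chartForm D.γ x) (chartCovec D.s x) (chartFun D.h x) (chartFun f x)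
    (chartVec w x) (extChartAt 𝓘(ℝ, E) x x)

variable [IsManifold 𝓘(ℝ, E) ∞ S] [FiniteDimensional ℝ E]
  {Z : VecField (stModel E) (M := ℝ × ℝ × S)} {f : S → ℝ} {D : HorizonData E S} {W : Set S}
  {w : VecField 𝓘(ℝ, E) (M := S)}

/-- The function of a degenerate Killing vector satisfies the master equations. -/
theorem IsHorizonField.masterEqOn (hH : IsHorizonField Z f univ) (hZ : SmoothVec Z univ)
    (hK : ∀ p a b, lieDeriv (nhgMetric D) Z p a b = 0) (hD : D.IsRegularOn univ) :
    MasterEqOn D f (gradient D.γ f) univ := by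
  intro x _
  set w : VecField 𝓘(ℝ, E) (M := S) := gradient D.γ f with hw
  have hd := hD.localData isOpen_univ (mem_univ x)
  have hf := hH.contMDiffAt isOpen_univ (mem_univ x)
  have hq : chartFun (fun q => covecVal (V := E) (I := 𝓘(ℝ, E)) D.s q (vecVal w q)) x
      =ᶠ[𝓝 (extChartAt 𝓘(ℝ, E) x x)] fun z => chartCovec D.s x z (chartVec w x z) := by
    filter_upwards [eventually_mem_target (I := 𝓘(ℝ, E)) x] with z hz
    exact (chartCovec_chartVec _ _ hz).symm
  have hY := chartVec_eventuallyEq_degLocal (Z := Z) (W := univ) isOpen_univ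
    (fun u v x _ => hH.vecVal_eq hZ hK hD u v x) (mem_univ x) 1 0 hq (1, 0, x) rfl
  -- On the slice `u = 1` the `S`-component of `Z` is `-w`, so the gradient inherits smoothness from
  -- `Z`.
  have hws : ContDiffAt ℝ ∞ (chartVec w x) (extChartAt 𝓘(ℝ, E) x x) := by
    have h1 := (hZ.contDiffAt (1, 0, x)).congr_of_eventuallyEq hY.symm
    have h2 : ContDiffAt ℝ ∞ (fun z : E => degLocal (fun z => chartCovec D.s x z (chartVec w x z))
        (chartFun f x) (chartVec w x) (1, 0, z)) (extChartAt 𝓘(ℝ, E) x x) :=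
      ContDiffAt.comp (g := degLocal (fun z => chartCovec D.s x z (chartVec w x z))
        (chartFun f x) (chartVec w x)) _ h1 (by fun_prop)
    have h3 := (contDiff_snd.contDiffAt.comp _ (contDiff_snd.contDiffAt.comp _ h2)).neg
    refine h3.congr_of_eventuallyEq (Eventually.of_forall fun z => ?_)
    simp [degLocal]
  refine hd.masterEq (contMDiffAt_iff_contDiffAt_symm.1 hf) hws ?_ 0 fun a b => ?_
  · filter_upwards [eventually_mem_target (I := 𝓘(ℝ, E)) x,
      chartCovec_differential_eventuallyEq isOpen_univ (hH.contMDiffOn isOpen_univ) (mem_univ x)]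
      with z hz hz' a
    rw [← hz']
    exact congrFun (congrArg DFunLike.coe (chartForm_sharp hz fun a => hD.pos _ (mem_univ _) a)) a
  · exact (lieDeriv_nhgMetric D (p := (1, 0, x)) rfl hY a b).symm.trans (hK (1, 0, x) a b)

theorem MasterEqOn.contMDiffOn (hm : MasterEqOn D f w W) :
    ContMDiffOn 𝓘(ℝ, E) 𝓘(ℝ, ℝ) ∞ f W :=
  fun x hx => (contMDiffAt_iff_contDiffAt_symm.2 (hm x hx).smooth_φ).contMDiffWithinAt

/-- This reconciles the coefficient `u² s(w)` from the Killing equation with `(u² / 2) Δf` in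
`degField`. -/
theorem MasterEqOn.laplacian_eq (hm : MasterEqOn D f w W) (hW : IsOpen W)
    (hD : D.IsRegularOn W) {x : S} (hx : x ∈ W) :
    laplacian D.γ f x = 2 * covecVal (V := E) (I := 𝓘(ℝ, E)) D.s x (vecVal w x) := by
  have h := (hm x hx).trace_hessian (hD.localData hW hx)
  have h1 := chartCovec_differential_eventuallyEq hW hm.contMDiffOn hx
  rw [← h1.fderiv_eq, ← h1.eq_of_nhds, ← divergence_eq, chartCovec_self, chartVec_self] at h
  exact h

/-- The Killing vector of a function satisfying the master equations is a degenerate generator of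
the horizon. -/
theorem MasterEqOn.isHorizonGenerator (hm : MasterEqOn D f w W) (hW : IsOpen W)
    (hD : D.IsRegularOn W) (hf : ∀ x ∈ W, f x ≠ 0)
    (hZ : ∀ u v, ∀ x ∈ W, vecVal Z (u, v, x) =
      ((u ^ 2 * covecVal (V := E) (I := 𝓘(ℝ, E)) D.s x (vecVal w x), f x,
        -(u • vecVal w x)) : ℝ × ℝ × E)) :
    IsHorizonField Z f W ∧ IsHorizonGenerator (nhgMetric D) Z 0 W := by
  have hq (x : S) : chartFun (fun q => covecVal (V := E) (I := 𝓘(ℝ, E)) D.s q (vecVal w q)) x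
      =ᶠ[𝓝 (extChartAt 𝓘(ℝ, E) x x)] fun z => chartCovec D.s x z (chartVec w x z) := by
    filter_upwards [eventually_mem_target (I := 𝓘(ℝ, E)) x] with z hz
    exact (chartCovec_chartVec _ _ hz).symm
  have hY (p : ℝ × ℝ × S) (hp : p.2.2 ∈ W) :=
    chartVec_eventuallyEq_degLocal (Z := Z) hW hZ hp p.1 p.2.1 (hq p.2.2) p rfl
  have hsm (p : ℝ × ℝ × S) (hp : p.2.2 ∈ W) :
      ContDiffAt ℝ ∞ (chartVec Z p) (extChartAt (stModel E) p p) := by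
    rw [extChartAt_st]
    exact (contDiffAt_degLocal (((hD.localData hW hp).smooth_s).clm_apply (hm _ hp).smooth_w)
      (hm _ hp).smooth_φ (hm _ hp).smooth_w).congr_of_eventuallyEq (hY p hp)
  have hH : IsHorizonField Z f W :=
    ⟨fun p hp => hsm p hp.2, fun v x hx => by rw [hZ 0 v x hx]; simp⟩
  refine ⟨hH, ⟨fun p hp => (contMDiffAt_vec_iff.2 (hsm p hp)).contMDiffWithinAt,
    fun p hp a b => ?_⟩, univ, isOpen_univ, ?_, ?_⟩
  · refine (lieDeriv_nhgMetric D rfl (hY p hp) a b).trans ?_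
    exact (hm _ hp).lie_eq_zero (hD.localData hW hp) p.1 p.2.1 a b
  · rw [univ_inter]
    exact subset_closure
  · rw [univ_inter]
    have hval (p : ℝ × ℝ × S) (hp : p ∈ horizon W) :
        vecVal Z p = ((0, f p.2.2, 0) : ℝ × ℝ × E) := by
      obtain ⟨u, v, x⟩ := p
      obtain ⟨h0, hx⟩ := hp
      obtain rfl : u = 0 := h0
      exact hH.eq v x hx
    refine ⟨fun p hp h => ?_, fun p hp => ?_, fun p hp X hX => ?_, fun p hp => ?_⟩
    · have h1 : ((0, f p.2.2, 0) : ℝ × ℝ × E) = 0 := (hval p hp).symm.trans h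
      exact hf _ hp.2 (congrArg (fun z : ℝ × ℝ × E => z.2.1) h1)
    · exact congrArg (fun z : ℝ × ℝ × E => z.1) (hval p hp)
    · obtain ⟨u, v, x⟩ := p
      obtain rfl : u = 0 := hp.1
      have h1 : Z (0, v, x) = ((0, f x, 0) : ℝ × ℝ × E) := hval _ hp
      rw [h1]
      refine (nhgMetric_horizon_apply D v x _ _).trans ?_
      simp [hX]
    · obtain ⟨u, v, x⟩ := p
      obtain rfl : u = 0 := hp.1
      have h1 : Z (0, v, x) = ((0, f x, 0) : ℝ × ℝ × E) := hval _ hp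
      have h2 : covDeriv (nhgMetric D) Z (0, v, x) (Z (0, v, x)) = (0 : ℝ × ℝ × E) := by
        rw [h1]
        refine (hH.covDeriv_eq hW hD hp.2 v (f x, 0)).trans ?_
        simp
        rfl
      exact h2.trans (zero_smul ℝ (Z (0, v, x))).symm

end MasterEqCharts

/-! ### The data with respect to `f ∂_v`, and the return to the original data -/

section TransformedData

variable {E : Type*} [NormedAddCommGroup E] [NormedSpace ℝ E]
  {S : Type*} [TopologicalSpace S] [ChartedSpace E S]
  {Z : VecField (stModel E) (M := ℝ × ℝ × S)} {f : S → ℝ} {D : HorizonData E S} {W : Set S}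

/-- The torsion of the near-horizon geometry with respect to the generator `f ∂_v`. -/
noncomputable def torsionWith (D : HorizonData E S) (f : S → ℝ) : CovectorField 𝓘(ℝ, E) (M := S) :=
  fun x => (covecVal (V := E) (I := 𝓘(ℝ, E)) D.s x
    - (f x)⁻¹ • covecVal (V := E) (I := 𝓘(ℝ, E)) (differential f) x : E →L[ℝ] ℝ)

theorem covecVal_torsionWith (D : HorizonData E S) (f : S → ℝ) (x : S) :
    covecVal (V := E) (I := 𝓘(ℝ, E)) (torsionWith D f) x =
      covecVal (V := E) (I := 𝓘(ℝ, E)) D.s x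
        - (f x)⁻¹ • covecVal (V := E) (I := 𝓘(ℝ, E)) (differential f) x := rfl

/-- The data of the near-horizon geometry with respect to the generator `f ∂_v`. -/
noncomputable def dataWith (D : HorizonData E S) (f : S → ℝ) : HorizonData E S where
  γ := D.γ
  s := torsionWith D f
  h x := 2 * covecVal (V := E) (I := 𝓘(ℝ, E)) (torsionWith D f) x
      (vecVal (sharp D.γ (torsionWith D f)) x) - divergence D.γ (torsionWith D f) x
    + (D.h x - 2 * covecVal (V := E) (I := 𝓘(ℝ, E)) D.s x (vecVal (sharp D.γ D.s) x)
      + divergence D.γ D.s x)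

variable [IsManifold 𝓘(ℝ, E) ∞ S]

theorem chartCovec_torsionWith {x : S} {y : E} (hy : y ∈ (extChartAt 𝓘(ℝ, E) x).target)
    (hf : MDifferentiableAt 𝓘(ℝ, E) 𝓘(ℝ, ℝ) f ((extChartAt 𝓘(ℝ, E) x).symm y)) :
    chartCovec (torsionWith D f) x y =
      chartCovec D.s x y - (chartFun f x y)⁻¹ • fderiv ℝ (chartFun f x) y := by
  rw [← chartCovec_differential hy hf]
  rfl

theorem covecVal_differential_inv {x : S} (hf : MDifferentiableAt 𝓘(ℝ, E) 𝓘(ℝ, ℝ) f x)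
    (h0 : f x ≠ 0) :
    covecVal (V := E) (I := 𝓘(ℝ, E)) (differential fun x => 1 / f x) x =
      -((f x)⁻¹ ^ 2) • covecVal (V := E) (I := 𝓘(ℝ, E)) (differential f) x := by
  have h1 : HasDerivAt (fun t : ℝ => 1 / t) (-((f x)⁻¹ ^ 2)) (f x) := by
    simpa using hasDerivAt_inv h0
  have h2 := HasMFDerivAt.comp x h1.hasFDerivAt.hasMFDerivAt hf.hasMFDerivAt
  have h3 : HasMFDerivAt 𝓘(ℝ, E) 𝓘(ℝ, ℝ) (fun x => 1 / f x) x _ := h2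
  refine ContinuousLinearMap.ext fun a => ?_
  refine (congrFun (congrArg DFunLike.coe h3.mfderiv) a).trans ?_
  exact mul_comm _ _

theorem vecVal_gradient_inv {γ : FormField 𝓘(ℝ, E) (M := S)} {x : S}
    (hf : MDifferentiableAt 𝓘(ℝ, E) 𝓘(ℝ, ℝ) f x) (h0 : f x ≠ 0) :
    vecVal (gradient γ fun x => 1 / f x) x =
      -((f x)⁻¹ ^ 2) • vecVal (gradient γ f) x := by
  have h := congrArg (formVal (V := E) (I := 𝓘(ℝ, E)) γ x).inverse (covecVal_differential_inv hf h0)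
  rw [map_smul] at h
  exact h

variable [FiniteDimensional ℝ E]

theorem MasterEqOn.mdifferentiableAt {w : VecField 𝓘(ℝ, E) (M := S)} (hm : MasterEqOn D f w W)
    {x : S} (hx : x ∈ W) : MDifferentiableAt 𝓘(ℝ, E) 𝓘(ℝ, ℝ) f x :=
  (contMDiffAt_iff_contDiffAt_symm.2 (hm x hx).smooth_φ).mdifferentiableAt (by simp)

theorem MasterEqOn.chartCovec_torsionWith (hm : MasterEqOn D f w W) (hW : IsOpen W) {x : S}
    (hx : x ∈ W) :
    chartCovec (torsionWith D f) x =ᶠ[𝓝 (extChartAt 𝓘(ℝ, E) x x)]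
      fun z => chartCovec D.s x z - (chartFun f x z)⁻¹ • fderiv ℝ (chartFun f x) z := by
  filter_upwards [eventually_symm_mem hW hx] with z hz
  exact NHG.chartCovec_torsionWith hz.1 (hm.mdifferentiableAt hz.2)

/-- By the Hessian equation the divergences leave only terms algebraic in `w`, the form required by
`MasterEq.inv`. -/
theorem MasterEqOn.dataWith_h (hm : MasterEqOn D f w W) (hW : IsOpen W)
    (hD : D.IsRegularOn W) (hf : ∀ x ∈ W, f x ≠ 0) {x : S} (hx : x ∈ W) :
    (dataWith D f).h x =
      D.h x + (f x)⁻¹ ^ 2 * formVal (V := E) (I := 𝓘(ℝ, E)) D.γ x (vecVal w x) (vecVal w x)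
      - 2 * (f x)⁻¹ * covecVal (V := E) (I := 𝓘(ℝ, E)) D.s x (vecVal w x) := by
  have h := (hm x hx).scalar_coefficient (hD.localData hW hx)
    (by rw [chartFun_self]; exact hf x hx) (hm.chartCovec_torsionWith hW hx)
  rw [← divergence_eq, ← divergence_eq, chartCovec_self, chartCovec_self, chartForm_self,
    chartFun_self, chartFun_self, chartVec_self] at h
  exact h

theorem MasterEqOn.chartFun_dataWith_h (hm : MasterEqOn D f w W) (hW : IsOpen W)
    (hD : D.IsRegularOn W) (hf : ∀ x ∈ W, f x ≠ 0) {x : S} (hx : x ∈ W) :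
    chartFun (dataWith D f).h x =ᶠ[𝓝 (extChartAt 𝓘(ℝ, E) x x)] fun z =>
      chartFun D.h x z
        + (chartFun f x z)⁻¹ ^ 2 * chartForm D.γ x z (chartVec w x z) (chartVec w x z)
        - 2 * (chartFun f x z)⁻¹ * chartCovec D.s x z (chartVec w x z) := by
  filter_upwards [eventually_symm_mem hW hx] with z hz
  rw [chartForm_chartVec _ _ hz.1, chartCovec_chartVec _ _ hz.1]
  exact hm.dataWith_h hW hD hf hz.2

theorem MasterEqOn.isRegularOn_dataWith (hm : MasterEqOn D f w W) (hW : IsOpen W)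
    (hD : D.IsRegularOn W) (hf : ∀ x ∈ W, f x ≠ 0) : (dataWith D f).IsRegularOn W where
  symm := hD.symm
  pos := hD.pos
  smooth_γ := hD.smooth_γ
  smooth_s x hx := by
    have h0 : chartFun f x (extChartAt 𝓘(ℝ, E) x x) ≠ 0 := by
      rw [chartFun_self]; exact hf x hx
    refine (contMDiffAt_covec_iff.2 (ContDiffAt.congr_of_eventuallyEq ?_
      (hm.chartCovec_torsionWith hW hx))).contMDiffWithinAt
    exact (hD.localData hW hx).smooth_s.sub (((hm x hx).smooth_φ.inv h0).smul
      ((hm x hx).smooth_φ.fderiv_right (m := ∞) le_rfl))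
  smooth_h x hx := by
    have h0 : chartFun f x (extChartAt 𝓘(ℝ, E) x x) ≠ 0 := by
      rw [chartFun_self]; exact hf x hx
    refine (contMDiffAt_iff_contDiffAt_symm.2 (ContDiffAt.congr_of_eventuallyEq ?_
      (hm.chartFun_dataWith_h hW hD hf hx))).contMDiffWithinAt
    have hd := hD.localData hW hx
    have hi := (hm x hx).smooth_φ.inv h0
    have hw := (hm x hx).smooth_w
    exact (hd.smooth_h.add ((hi.pow 2).mul ((hd.smooth_G.clm_apply hw).clm_apply hw))).sub
      ((contDiffAt_const.mul hi).mul (hd.smooth_s.clm_apply hw))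

theorem MasterEqOn.inv (hm : MasterEqOn D f (gradient D.γ f) W) (hW : IsOpen W)
    (hD : D.IsRegularOn W) (hf : ∀ x ∈ W, f x ≠ 0) :
    MasterEqOn (dataWith D f) (fun x => 1 / f x) (gradient D.γ fun x => 1 / f x) W := by
  intro x hx
  have h0 : chartFun f x (extChartAt 𝓘(ℝ, E) x x) ≠ 0 := by
    rw [chartFun_self]; exact hf x hx
  have h := (hm x hx).inv (hD.localData hW hx) h0 (hm.chartCovec_torsionWith hW hx)
    (hm.chartFun_dataWith_h hW hD hf hx)
  have e : chartFun (E := E) (fun x => 1 / f x) x = fun z => (chartFun f x z)⁻¹ :=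
    funext fun z => one_div _
  rw [e]
  refine h.congr_vec ?_
  filter_upwards [eventually_symm_mem hW hx] with z hz
  rw [chartVec_apply, vecVal_gradient_inv (hm.mdifferentiableAt hz.2) (hf _ hz.2), map_smul,
    chartVec_apply]
  rfl

theorem IsHorizonField.isNearHorizonGeometry_dataWith (hZ : IsHorizonField Z f W) (hW : IsOpen W)
    (hD : D.IsRegularOn W) (hf : ∀ x ∈ W, f x ≠ 0) :
    IsNearHorizonGeometry (nhgMetric D) Z W (dataWith D f) :=
  isNearHorizonGeometry_of_eq hW hD hZ hf (fun _ _ => rfl) (fun _ _ => rfl) fun _ _ => rfl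

/-- The near-horizon geometry of the new metric with respect to the new generator is the original
one. -/
theorem IsHorizonField.isNearHorizonGeometry_original
    (hZ : IsHorizonField Z (fun x => 1 / f x) W) (hW : IsOpen W)
    (hD : (dataWith D f).IsRegularOn W) (hf : ∀ x ∈ W, f x ≠ 0)
    (hfs : ∀ x ∈ W, MDifferentiableAt 𝓘(ℝ, E) 𝓘(ℝ, ℝ) f x) :
    IsNearHorizonGeometry (nhgMetric (dataWith D f)) Z W D := by
  refine isNearHorizonGeometry_of_eq hW hD hZ (fun x hx => one_div_ne_zero (hf x hx))
    (fun _ _ => rfl) (fun x hx => ?_) fun x hx => ?_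
  -- `d(1/f) / (1/f) = -df / f`, so the two changes of torsion cancel.
  · rw [covecVal_differential_inv (hfs x hx) (hf x hx)]
    refine Eq.trans ?_ (congrArg (· - _) (covecVal_torsionWith D f x).symm)
    have h0 := hf x hx
    ext a
    simp only [sub_apply, smul_apply, smul_eq_mul]
    field_simp
    ring
  -- `h - 2|s|² + div s` is the same for both sets of data by construction, so `h` comes back
  -- without the master equations.
  · simp only [dataWith]
    ring

/-- The degenerate generator `degField`. -/
theorem MasterEqOn.isHorizonGenerator_degField (hm : MasterEqOn D f (gradient D.γ f) W)
    (hW : IsOpen W) (hD : D.IsRegularOn W) (hf : ∀ x ∈ W, f x ≠ 0) :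
    IsHorizonField (degField D.γ f) f W ∧
      IsHorizonGenerator (nhgMetric D) (degField D.γ f) 0 W := by
  refine hm.isHorizonGenerator hW hD hf fun u v x hx => ?_
  have h := hm.laplacian_eq hW hD hx
  have h1 : vecVal (degField D.γ f) (u, v, x) = ((u ^ 2 / 2 * laplacian D.γ f x, f x,
    -(u • vecVal (gradient D.γ f) x)) : ℝ × ℝ × E) := rfl
  rw [h1, h]
  congr 1
  ring

/-- `∂_v` is the field attached to the constant function `1`, whose gradient is zero; the master
equations are then trivial. -/
theorem isHorizonGenerator_etaField (hW : IsOpen W) (hD : D.IsRegularOn W) :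
    IsHorizonGenerator (nhgMetric D) etaField 0 W := by
  have hm : MasterEqOn D (fun _ => 1) (fun _ => (0 : E)) W := by
    intro x hx
    have e1 : chartFun (E := E) (fun _ : S => (1 : ℝ)) x = fun _ => 1 := rfl
    have e2 : chartVec (V := E) (I := 𝓘(ℝ, E)) (fun _ : S => (0 : E)) x = fun _ => 0 :=
      funext fun z => map_zero _
    rw [e1, e2]
    exact ⟨contDiffAt_const, contDiffAt_const, by simp, by simp, by simp, by simp⟩
  refine (hm.isHorizonGenerator hW hD (fun _ _ => one_ne_zero) fun u v x hx => ?_).2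
  have e : vecVal (V := E) (I := 𝓘(ℝ, E)) (fun _ : S => (0 : E)) x = 0 := rfl
  rw [e]
  simp
  rfl

end TransformedData

/-! ### The non-degenerate generator `v ∂_v - u ∂_u` -/

section NonDegenerate

variable {E : Type*} [NormedAddCommGroup E] [NormedSpace ℝ E] [FiniteDimensional ℝ E]
  {S : Type*} [TopologicalSpace S] [ChartedSpace E S] [IsManifold 𝓘(ℝ, E) ∞ S]
  {D : HorizonData E S} {W : Set S}

/-- Local form of `xiField`. -/
noncomputable def xiLocal : (ℝ × ℝ × E) →L[ℝ] (ℝ × ℝ × E) :=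
  (-ContinuousLinearMap.fst ℝ ℝ (ℝ × E)).prod
    (((ContinuousLinearMap.fst ℝ ℝ E).comp (ContinuousLinearMap.snd ℝ ℝ (ℝ × E))).prod 0)

theorem xiLocal_apply (y : ℝ × ℝ × E) : xiLocal y = (-y.1, y.2.1, 0) := rfl

theorem fderiv_xiLocal (y : ℝ × ℝ × E) : fderiv ℝ (xiLocal (E := E)) y = xiLocal :=
  ContinuousLinearMap.fderiv _

theorem LocalData.lie_xiLocal {G : E → E →L[ℝ] E →L[ℝ] ℝ} {s : E → E →L[ℝ] ℝ} {h : E → ℝ}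
    {y : ℝ × ℝ × E} (hd : LocalData G s h y.2.2) (a b : ℝ × ℝ × E) :
    fderiv ℝ (nhgLocal G s h) y (xiLocal y) a b
      + nhgLocal G s h y (fderiv ℝ xiLocal y a) b + nhgLocal G s h y a (fderiv ℝ xiLocal y b)
      = 0 := by
  rw [hd.fderiv_nhgLocal, nhgLocal_apply, nhgLocal_apply, fderiv_xiLocal]
  simp only [xiLocal_apply, map_zero, zero_apply]
  ring

theorem chartVec_xiField (p : ℝ × ℝ × S) :
    chartVec xiField p =ᶠ[𝓝 ((p.1, p.2.1, extChartAt 𝓘(ℝ, E) p.2.2 p.2.2) : ℝ × ℝ × E)]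
      xiLocal := by
  filter_upwards [(tendsto_snd_snd ((p.1, p.2.1, extChartAt 𝓘(ℝ, E) p.2.2 p.2.2) :
    ℝ × ℝ × E)).eventually (eventually_mem_target (I := 𝓘(ℝ, E)) p.2.2)] with y hy
  rw [chartVec_st xiField hy rfl, xiLocal_apply]
  simp [vecVal, xiField]

/-- The field vanishes on the cut `u = v = 0`, so its Killing horizon is the dense part `v ≠ 0`. It
generates the boosts `(u, v) ↦ (e^{-t} u, e^t v)`, under which the metric is invariant. -/
theorem isHorizonGenerator_xiField (hW : IsOpen W) (hD : D.IsRegularOn W) :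
    IsHorizonGenerator (nhgMetric D) xiField 1 W := by
  refine ⟨⟨fun p hp => (contMDiffAt_vec_iff.2 ?_).contMDiffWithinAt, fun p hp a b => ?_⟩,
    {p | p.2.1 ≠ 0}, ?_, ?_, ?_⟩
  · rw [extChartAt_st]
    exact xiLocal.contDiff.contDiffAt.congr_of_eventuallyEq (chartVec_xiField p)
  · exact (lieDeriv_nhgMetric D rfl (chartVec_xiField p) a b).trans
      (LocalData.lie_xiLocal (hD.localData hW hp) a b)
  · exact isOpen_ne_fun (by fun_prop) continuous_const
  · rintro ⟨u, v, x⟩ ⟨h0, hx⟩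
    obtain rfl : u = 0 := h0
    have hc : Continuous fun t : ℝ => ((0, t, x) : ℝ × ℝ × S) := by fun_prop
    exact map_mem_closure (f := fun t : ℝ => ((0, t, x) : ℝ × ℝ × S)) hc
      (dense_compl_singleton (0 : ℝ) v) fun t ht => ⟨ht, rfl, hx⟩
  · refine ⟨fun p hp h => ?_, fun p hp => ?_, fun p hp X hX => ?_, fun p hp => ?_⟩
    · exact hp.1 (congrArg (fun z : ℝ × ℝ × E => z.2.1) h)
    · obtain ⟨u, v, x⟩ := p
      obtain rfl : u = 0 := hp.2.1
      exact neg_zero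
    · obtain ⟨u, v, x⟩ := p
      obtain rfl : u = 0 := hp.2.1
      refine (nhgMetric_horizon_apply D v x _ _).trans ?_
      simp [hX, xiField]
    · obtain ⟨u, v, x⟩ := p
      obtain rfl : u = 0 := hp.2.1
      have hd := hD.localData hW hp.2.2
      have h1 : vecVal (V := ℝ × ℝ × E) (I := stModel E) xiField (0, v, x) = v • ((0, 1, 0) : ℝ × ℝ × E) := by
        simp [vecVal, xiField]
      have h2 : covDeriv (nhgMetric D) xiField (0, v, x) (vecVal (V := ℝ × ℝ × E) (I := stModel E) xiField (0, v, x)) =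
          vecVal (V := ℝ × ℝ × E) (I := stModel E) xiField (0, v, x) := by
        refine (covDeriv_nhgMetric D rfl (chartVec_xiField (0, v, x)) _).trans ?_
        rw [h1, fderiv_xiLocal]
        dsimp only
        rw [map_smul (christoffel _ _), map_smul, smul_apply, hd.christoffel_dv]
        simp [xiLocal_apply]
        rfl
      exact h2.trans (one_smul ℝ (vecVal (V := ℝ × ℝ × E) (I := stModel E) xiField (0, v, x))).symm

end NonDegenerate

/-! ### Unique continuation for the gradient of `f` -/

section UniqueContinuation

variable {E : Type*} [NormedAddCommGroup E] [NormedSpace ℝ E]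

theorem eventually_eq_zero_of_norm_fderiv_le {g : E → ℝ} {z₀ : E} {C : ℝ}
    (hg : ∀ᶠ z in 𝓝 z₀, DifferentiableAt ℝ g z ∧ ‖fderiv ℝ g z‖ ≤ C * ‖g z‖) (h0 : g z₀ = 0) :
    ∀ᶠ z in 𝓝 z₀, g z = 0 := by
  obtain ⟨r, hr, hB⟩ := Metric.eventually_nhds_iff_ball.1 hg
  filter_upwards [Metric.ball_mem_nhds z₀ hr] with z hz
  have hmem (t : ℝ) (ht : t ∈ Icc (0 : ℝ) 1) : z₀ + t • (z - z₀) ∈ Metric.ball z₀ r := by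
    rw [mem_ball_iff_norm] at hz ⊢
    rw [add_sub_cancel_left, norm_smul, Real.norm_of_nonneg ht.1]
    exact (mul_le_of_le_one_left (norm_nonneg _) ht.2).trans_lt hz
  have hd (t : ℝ) (ht : t ∈ Icc (0 : ℝ) 1) : HasDerivAt (fun t : ℝ => g (z₀ + t • (z - z₀)))
      (fderiv ℝ g (z₀ + t • (z - z₀)) (z - z₀)) t := by
    have h1 : HasDerivAt (fun t : ℝ => z₀ + t • (z - z₀)) (z - z₀) t := by
      simpa using ((hasDerivAt_id t).smul_const (z - z₀)).const_add z₀
    exact (hB _ (hmem t ht)).1.hasFDerivAt.comp_hasDerivAt t h1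
  -- Grönwall's inequality on the segment from `z₀` to `z`.
  have h := eq_zero_of_abs_deriv_le_mul_abs_self_of_eq_zero_right
    (f := fun t : ℝ => g (z₀ + t • (z - z₀))) (K := C * ‖z - z₀‖)
    (fun t ht => (hd t ht).continuousAt.continuousWithinAt)
    (fun t ht => (hd t (Ico_subset_Icc_self ht)).hasDerivWithinAt) (by simpa using h0)
    (fun t ht => by
      refine (ContinuousLinearMap.le_opNorm _ _).trans ?_
      rw [mul_right_comm]
      exact mul_le_mul_of_nonneg_right (hB _ (hmem t (Ico_subset_Icc_self ht))).2 (norm_nonneg _))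
    1 (right_mem_Icc.2 zero_le_one)
  simpa using h

theorem exists_pos_le_of_posDef [FiniteDimensional ℝ E] {B : E →L[ℝ] E →L[ℝ] ℝ}
    (hB : ∀ a, a ≠ 0 → 0 < B a a) : ∃ m > 0, ∀ a, m * ‖a‖ ^ 2 ≤ B a a := by
  obtain ⟨m, hm, h⟩ := (isCompact_sphere (0 : E) 1).exists_forall_le' (f := fun a => B a a) (a := 0)
    (by fun_prop) (fun a ha => hB a (by rintro rfl; simp at ha))
  refine ⟨m, hm, fun a => ?_⟩
  rcases eq_or_ne a 0 with rfl | ha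
  · simp
  have h1 := h (‖a‖⁻¹ • a) (by simp [norm_smul, ha])
  have h2 : 0 < ‖a‖ := norm_pos_iff.2 ha
  simp only [map_smul, smul_apply, smul_eq_mul] at h1
  calc m * ‖a‖ ^ 2 ≤ (‖a‖⁻¹ * (‖a‖⁻¹ * B a a)) * ‖a‖ ^ 2 := by gcongr
    _ = B a a := by field_simp

/-- Half of the lower bound at `z₀` absorbs the variation of `G`. -/
theorem eventually_exists_pos_le [FiniteDimensional ℝ E] {G : E → E →L[ℝ] E →L[ℝ] ℝ} {z₀ : E}
    (hG : ContinuousAt G z₀) (hB : ∀ a, a ≠ 0 → 0 < G z₀ a a) :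
    ∃ m > 0, ∀ᶠ z in 𝓝 z₀, ∀ a, m * ‖a‖ ^ 2 ≤ G z a a := by
  obtain ⟨m, hm, h⟩ := exists_pos_le_of_posDef hB
  refine ⟨m / 2, half_pos hm, ?_⟩
  filter_upwards [Metric.continuousAt_iff'.1 hG (m / 2) (half_pos hm)] with z hz a
  rw [dist_eq_norm] at hz
  have h1 := (le_abs_self _).trans ((G z₀ - G z).le_opNorm₂ a a)
  rw [sub_apply, sub_apply, norm_sub_rev] at h1
  have h2 : ‖G z - G z₀‖ * ‖a‖ * ‖a‖ ≤ m / 2 * ‖a‖ * ‖a‖ := by gcongr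
  have h3 := h a
  nlinarith

variable {S : Type*} [TopologicalSpace S] [ChartedSpace E S] [IsManifold 𝓘(ℝ, E) ∞ S]

/-- The zero set is closed by continuity and open by the local Grönwall estimate. -/
theorem eq_zero_of_norm_fderiv_le [ConnectedSpace S] {g : S → ℝ} (hc : Continuous g)
    (hg : ∀ x, ∃ C, ∀ᶠ z in 𝓝 (extChartAt 𝓘(ℝ, E) x x), DifferentiableAt ℝ (chartFun g x) z ∧
      ‖fderiv ℝ (chartFun g x) z‖ ≤ C * ‖chartFun g x z‖) {x₀ : S} (h0 : g x₀ = 0) (x : S) :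
    g x = 0 := by
  have hcl : IsClopen {x | g x = 0} := by
    refine ⟨isClosed_eq hc continuous_const, isOpen_iff_mem_nhds.2 fun y hy => ?_⟩
    obtain ⟨C, hC⟩ := hg y
    have h := eventually_eq_zero_of_norm_fderiv_le hC (by rw [chartFun_self]; exact hy)
    have h1 := (continuousAt_extChartAt (I := 𝓘(ℝ, E)) y).eventually h
    filter_upwards [h1, extChartAt_source_mem_nhds (I := 𝓘(ℝ, E)) y] with q hq hs
    rwa [chartFun, (extChartAt 𝓘(ℝ, E) y).left_inv hs] at hq
  have h := hcl.eq_univ ⟨x₀, h0⟩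
  exact h.symm.subset (mem_univ x)

variable [FiniteDimensional ℝ E] {D : HorizonData E S} {f : S → ℝ}

/-- The squared norm of a vector field. -/
noncomputable def normSq (γ : FormField 𝓘(ℝ, E) (M := S)) (w : VecField 𝓘(ℝ, E) (M := S)) (x : S) :
    ℝ :=
  formVal (V := E) (I := 𝓘(ℝ, E)) γ x (vecVal w x) (vecVal w x)

theorem chartFun_normSq (γ : FormField 𝓘(ℝ, E) (M := S)) (w : VecField 𝓘(ℝ, E) (M := S)) (x : S) :
    chartFun (normSq γ w) x =ᶠ[𝓝 (extChartAt 𝓘(ℝ, E) x x)]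
      fun z => chartForm γ x z (chartVec w x z) (chartVec w x z) := by
  filter_upwards [eventually_mem_target (I := 𝓘(ℝ, E)) x] with z hz
  exact (chartForm_chartVec γ w hz).symm

theorem MasterEqOn.contMDiff_normSq (hm : MasterEqOn D f w univ) (hD : D.IsRegularOn univ) :
    ContMDiff 𝓘(ℝ, E) 𝓘(ℝ, ℝ) ∞ (normSq D.γ w) := by
  intro x
  have hw := (hm x (mem_univ x)).smooth_w
  exact contMDiffAt_iff_contDiffAt_symm.2
    ((((hD.localData isOpen_univ (mem_univ x)).smooth_G.clm_apply hw).clm_apply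
      hw).congr_of_eventuallyEq (chartFun_normSq D.γ w x))

theorem MasterEqOn.differential_normSq (hm : MasterEqOn D f w univ) (hD : D.IsRegularOn univ)
    (x : S) (a : E) :
    covecVal (V := E) (I := 𝓘(ℝ, E)) (differential (normSq D.γ w)) x a =
      2 * (normSq D.γ w x * covecVal (V := E) (I := 𝓘(ℝ, E)) D.s x a
        + covecVal (V := E) (I := 𝓘(ℝ, E)) D.s x (vecVal w x)
          * covecVal (V := E) (I := 𝓘(ℝ, E)) (differential f) x a) := by
  have hd := hD.localData isOpen_univ (mem_univ x)
  have hmx := hm x (mem_univ x)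
  have h := (hd.fderiv_normSq hmx.smooth_w a).trans (hmx.fderiv_normSq hd a)
  rw [← (chartFun_normSq D.γ w x).fderiv_eq, ← covecVal_differential
    ((hm.contMDiff_normSq hD x).mdifferentiableAt (by simp)), ← covecVal_differential
    (hm.mdifferentiableAt (mem_univ x)), chartForm_self, chartCovec_self, chartVec_self] at h
  exact h

/-- In `dN = 2 (N s + s(w) df)`, with `N = |w|²`, the last term is quadratic in `w`, hence also
bounded by a multiple of `N`. -/
theorem MasterEqOn.norm_fderiv_normSq_le (hm : MasterEqOn D f (gradient D.γ f) univ)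
    (hD : D.IsRegularOn univ) (x : S) :
    ∃ C, ∀ᶠ z in 𝓝 (extChartAt 𝓘(ℝ, E) x x),
      DifferentiableAt ℝ (chartFun (normSq D.γ (gradient D.γ f)) x) z ∧
      ‖fderiv ℝ (chartFun (normSq D.γ (gradient D.γ f)) x) z‖ ≤
        C * ‖chartFun (normSq D.γ (gradient D.γ f)) x z‖ := by
  set w : VecField 𝓘(ℝ, E) (M := S) := gradient D.γ f
  have hd := hD.localData isOpen_univ (mem_univ x)
  have hN := hm.contMDiff_normSq hD
  obtain ⟨m, hm0, hlow⟩ := eventually_exists_pos_le hd.smooth_G.continuousAt hd.pos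
  have hs := hd.smooth_s.continuousAt.norm.eventually (gt_mem_nhds (lt_add_one _))
  have hG := hd.smooth_G.continuousAt.norm.eventually (gt_mem_nhds (lt_add_one _))
  set c := ‖chartCovec D.s x (extChartAt 𝓘(ℝ, E) x x)‖ + 1 with hc
  set b := ‖chartForm D.γ x (extChartAt 𝓘(ℝ, E) x x)‖ + 1 with hb
  have hc0 : 0 ≤ c := by positivity
  have hb0 : 0 ≤ b := by positivity
  -- Here `c` and `b` bound `s` and `γ` near the point, and `m ‖w‖² ≤ N`.
  refine ⟨2 * (c + c * b / m), ?_⟩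
  filter_upwards [eventually_mem_target (I := 𝓘(ℝ, E)) x, hlow, hs, hG,
    chartCovec_differential_eventuallyEq isOpen_univ hN.contMDiffOn (mem_univ x),
    (chartFun_normSq D.γ w x),
    ((contMDiffAt_iff_contDiffAt_symm.1 (hN x)).of_le (m := 1) (by simp)).eventually (by simp)]
    with z hz hlow hs hG hdN hNz hdiff
  refine ⟨hdiff.differentiableAt (by simp), ?_⟩
  have hgrad (a : E) : chartForm D.γ x z (chartVec w x z) a =
      chartCovec (V := E) (I := 𝓘(ℝ, E)) (differential f) x z a :=
    congrFun (congrArg DFunLike.coe (chartForm_sharp hz fun a => hD.pos _ (mem_univ _) a)) a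
  set ξ := chartVec w x z with hxi
  set N := chartFun (normSq D.γ w) x z with hN'
  have hN0 : m * ‖ξ‖ ^ 2 ≤ N := hNz ▸ hlow ξ
  have hN1 : 0 ≤ N := le_trans (by positivity) hN0
  rw [Real.norm_of_nonneg hN1, ← hdN]
  refine ContinuousLinearMap.opNorm_le_bound _ (by positivity) fun a => ?_
  have e : chartCovec (V := E) (I := 𝓘(ℝ, E)) (differential (normSq D.γ w)) x z a =
      2 * (N * chartCovec D.s x z a
        + chartCovec D.s x z ξ * chartForm D.γ x z ξ a) := by
    rw [hgrad, chartCovec_apply, hm.differential_normSq hD, hxi, chartCovec_chartVec _ _ hz]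
    rfl
  rw [e]
  have b1 : ‖chartCovec D.s x z a‖ ≤ c * ‖a‖ := (ContinuousLinearMap.le_opNorm _ _).trans (by gcongr)
  have b2 : ‖chartCovec D.s x z ξ‖ ≤ c * ‖ξ‖ := (ContinuousLinearMap.le_opNorm _ _).trans (by gcongr)
  have b3 : ‖chartForm D.γ x z ξ a‖ ≤ b * ‖ξ‖ * ‖a‖ :=
    (ContinuousLinearMap.le_opNorm₂ _ _ _).trans (by gcongr)
  have b4 : ‖ξ‖ ^ 2 ≤ N / m := by rw [le_div_iff₀ hm0]; linarith
  calc ‖2 * (N * chartCovec D.s x z a + chartCovec D.s x z ξ * chartForm D.γ x z ξ a)‖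
      ≤ 2 * (N * ‖chartCovec D.s x z a‖
        + ‖chartCovec D.s x z ξ‖ * ‖chartForm D.γ x z ξ a‖) := by
        rw [norm_mul, Real.norm_two]
        gcongr
        refine (norm_add_le _ _).trans ?_
        rw [norm_mul, norm_mul, Real.norm_of_nonneg hN1]
    _ ≤ 2 * (N * (c * ‖a‖) + (c * ‖ξ‖) * (b * ‖ξ‖ * ‖a‖)) := by gcongr
    _ = 2 * (N * (c * ‖a‖) + c * b * ‖a‖ * ‖ξ‖ ^ 2) := by ring
    _ ≤ 2 * (N * (c * ‖a‖) + c * b * ‖a‖ * (N / m)) := by gcongr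
    _ = 2 * (c + c * b / m) * N * ‖a‖ := by ring

/-- Unique continuation: the gradient has no zeros unless the function is constant. -/
theorem MasterEqOn.eq_const [ConnectedSpace S] (hm : MasterEqOn D f (gradient D.γ f) univ)
    (hD : D.IsRegularOn univ) {x₀ : S} (h0 : vecVal (gradient D.γ f) x₀ = 0) (x : S) :
    f x = f x₀ ∧ vecVal (gradient D.γ f) x = 0 := by
  have hw (x : S) : vecVal (gradient D.γ f) x = 0 := by
    have h := eq_zero_of_norm_fderiv_le (hm.contMDiff_normSq hD).continuous
      (hm.norm_fderiv_normSq_le hD) (x₀ := x₀) (by rw [normSq, h0, map_zero]) x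
    by_contra hne
    exact (hD.pos x (mem_univ x) _ hne).ne' h
  refine ⟨?_, hw x⟩
  have hf : ContMDiffOn 𝓘(ℝ, E) 𝓘(ℝ, ℝ) ∞ f univ := hm.contMDiffOn
  have hcont : Continuous f := (contMDiffOn_univ.1 hf).continuous
  -- With `df = 0` everywhere the same principle, with constant `0`, shows that `f` is constant.
  refine sub_eq_zero.1 (eq_zero_of_norm_fderiv_le (E := E) (g := fun x => f x - f x₀)
    (hcont.sub continuous_const) (fun y => ⟨0, ?_⟩) (x₀ := x₀) (sub_self _) x)
  filter_upwards [chartCovec_differential_eventuallyEq isOpen_univ hf (mem_univ y),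
    ((hm y (mem_univ y)).smooth_φ.of_le (m := 1) (by simp)).eventually (by simp)] with z hz hz'
  have hdf : fderiv ℝ (chartFun f y) z = 0 := by
    rw [← hz]
    refine ContinuousLinearMap.ext fun a => ?_
    rw [chartCovec_apply, ← metric_gradient hD f, hw, map_zero]
    rfl
  have h1 := (hz'.differentiableAt (by simp)).hasFDerivAt.sub_const (f x₀)
  refine ⟨h1.differentiableAt, ?_⟩
  have h2 : fderiv ℝ (chartFun (fun x => f x - f x₀) y) z = 0 := h1.fderiv.trans hdf
  rw [h2]
  simp

end UniqueContinuation

/-! ### Linear independence of the generators -/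

section Independence

variable {E : Type*} [NormedAddCommGroup E] [NormedSpace ℝ E] [FiniteDimensional ℝ E]
  {S : Type*} [TopologicalSpace S] [ChartedSpace E S] [IsManifold 𝓘(ℝ, E) ∞ S]
  {Z : VecField (stModel E) (M := ℝ × ℝ × S)} {D : HorizonData E S} {f : S → ℝ}

/-- A degenerate generator independent of `∂_v` has a function without critical points. -/
theorem IsHorizonField.gradient_ne_zero [ConnectedSpace S] (hH : IsHorizonField Z f univ)
    (hZ : SmoothVec Z univ) (hK : ∀ p a b, lieDeriv (nhgMetric D) Z p a b = 0)
    (hD : D.IsRegularOn univ) (hind : LinearIndependent ℝ ![etaField, Z]) (x : S) :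
    vecVal (gradient D.γ f) x ≠ 0 := by
  intro h0
  have hc := (hH.masterEqOn hZ hK hD).eq_const hD h0
  have h := LinearIndependent.pair_iff.1 hind (f x) (-1) (funext fun p => ?_)
  · exact one_ne_zero (neg_eq_zero.1 h.2)
  · obtain ⟨u, v, y⟩ := p
    have h1 := hH.vecVal_eq hZ hK hD u v y
    rw [(hc y).1, (hc y).2] at h1
    have h2 : f x • ((0, 1, 0) : ℝ × ℝ × E) + (-1 : ℝ) • vecVal Z (u, v, y) = 0 := by
      rw [h1]
      simp
    exact h2

/-- Three points above a single `x` suffice: at `(u, v) = (1, 0)` only the third field has an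
`S`-component, and the `v`-components at `(0, 0)` and `(0, 1)` settle the others. -/
theorem linearIndependent_generators {W : Set S} (hW : W.Nonempty) {γ : FormField 𝓘(ℝ, E) (M := S)}
    (hw : ∀ x ∈ W, vecVal (gradient γ f) x ≠ 0) :
    LinearIndependent ℝ (fun (i : Fin 3) (p : region W) =>
      (![xiField, etaField, degField γ f] : Fin 3 → VecField (stModel E) (M := ℝ × ℝ × S)) i p) := by
  obtain ⟨x, hx⟩ := hW
  rw [Fintype.linearIndependent_iff]
  intro g hg
  have h (u v : ℝ) : g 0 • ((-u, v, 0) : ℝ × ℝ × E) + g 1 • ((0, 1, 0) : ℝ × ℝ × E)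
      + g 2 • ((u ^ 2 / 2 * laplacian γ f x, f x, -(u • vecVal (gradient γ f) x)) : ℝ × ℝ × E)
      = 0 := by
    have h1 := congrFun hg (⟨(u, v, x), hx⟩ : region W)
    rw [Fin.sum_univ_three] at h1
    exact h1
  have h2 : g 2 = 0 := by
    have h3 := congrArg (fun z : ℝ × ℝ × E => z.2.2) (h 1 0)
    simpa [hw x hx] using h3
  have h1 : g 1 = 0 := by
    have h3 := congrArg (fun z : ℝ × ℝ × E => z.2.1) (h 0 0)
    simpa [h2] using h3
  have h0 : g 0 = 0 := by
    have h3 := congrArg (fun z : ℝ × ℝ × E => z.2.1) (h 0 1)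
    simpa [h1, h2] using h3
  intro i
  fin_cases i
  exacts [h0, h1, h2]

end Independence

end NHG

/-! ### The proposition -/

theorem mainTheorem8 {E : Type*} [NormedAddCommGroup E] [NormedSpace ℝ E] [FiniteDimensional ℝ E]
    {S : Type*} [TopologicalSpace S] [ChartedSpace E S] [IsManifold 𝓘(ℝ, E) ∞ S]
    [T2Space S] [SecondCountableTopology S] [ConnectedSpace S]
    -- the near-horizon geometry `g_NHG`, with `η = ∂_v`
    (D : NHG.HorizonData E S) (hD : D.IsRegularOn univ)
    -- a second degenerate generator `ζ` of `{u = 0}`, independent of `η`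
    (ζ : NHG.VecField (NHG.stModel E) (M := ℝ × ℝ × S))
    (hζ : NHG.IsHorizonGenerator (NHG.nhgMetric D) ζ 0 univ)
    (hind : LinearIndependent ℝ ![NHG.etaField, ζ])
    -- the function `f` with `ζ = f η` on the cut `{u = v = 0}`
    (f : S → ℝ) (hf : ∀ x, ζ (0, 0, x) = f x • NHG.etaField (E := E) (0, 0, x))
    -- a connected part of the cut on which `ζ` has no zeros
    (W : Set S) (hW : IsOpen W) (hWc : IsConnected W) (hfW : ∀ x ∈ W, f x ≠ 0) :
    -- the near-horizon geometry `g_NHG(ζ)` exists, with data `D'`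
    ∃ D' : NHG.HorizonData E S, D'.IsRegularOn W ∧
      NHG.IsNearHorizonGeometry (NHG.nhgMetric D) ζ W D' ∧
      -- the three Killing vectors of the multiple Killing horizon `{U = 0}`
      NHG.IsHorizonGenerator (NHG.nhgMetric D') NHG.xiField 1 W ∧
      NHG.IsHorizonGenerator (NHG.nhgMetric D') NHG.etaField 0 W ∧
      NHG.IsHorizonGenerator (NHG.nhgMetric D') (NHG.degField D'.γ (fun x => 1 / f x)) 0 W ∧
      LinearIndependent ℝ (fun (i : Fin 3) (p : NHG.region W) =>
        (![NHG.xiField, NHG.etaField, NHG.degField D'.γ (fun x => 1 / f x)] :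
          Fin 3 → NHG.VecField (NHG.stModel E) (M := ℝ × ℝ × S)) i p) ∧
      -- the near-horizon geometry of `g_NHG(ζ)` with respect to the third one is `g_NHG`
      NHG.IsNearHorizonGeometry (NHG.nhgMetric D') (NHG.degField D'.γ (fun x => 1 / f x)) W D := by
  have hval (x : S) : NHG.vecVal ζ (0, 0, x) = ((0, f x, 0) : ℝ × ℝ × E) := by
    have h : f x • ((0, 1, 0) : ℝ × ℝ × E) = (0, f x, 0) := by simp
    exact (hf x).trans h
  have hs : NHG.SmoothVec ζ univ := fun p _ =>
    (hζ.1.1 p (mem_univ p.2.2)).mono fun q _ => mem_univ q.2.2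
  have hK : ∀ p a b, NHG.lieDeriv (NHG.nhgMetric D) ζ p a b = 0 := fun p =>
    hζ.1.2 p (mem_univ p.2.2)
  have hH := hζ.isHorizonField hD hval
  have hDW : D.IsRegularOn W := ⟨fun x _ => hD.symm x (mem_univ x), fun x _ => hD.pos x (mem_univ x),
    hD.smooth_γ.mono (subset_univ W), hD.smooth_s.mono (subset_univ W),
    hD.smooth_h.mono (subset_univ W)⟩
  have hHW : NHG.IsHorizonField ζ f W :=
    ⟨fun p hp => hH.smooth p ⟨hp.1, mem_univ _⟩, fun v x _ => hH.eq v x (mem_univ x)⟩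
  have hm : NHG.MasterEqOn D f (NHG.gradient D.γ f) W := fun x _ =>
    hH.masterEqOn hs hK hD x (mem_univ x)
  have hD' := hm.isRegularOn_dataWith hW hDW hfW
  have hdeg := NHG.MasterEqOn.isHorizonGenerator_degField (D := NHG.dataWith D f)
    (hm.inv hW hDW hfW) hW hD' fun x hx => one_div_ne_zero (hfW x hx)
  refine ⟨NHG.dataWith D f, hD', hHW.isNearHorizonGeometry_dataWith hW hDW hfW,
    NHG.isHorizonGenerator_xiField hW hD', NHG.isHorizonGenerator_etaField hW hD', hdeg.2,
    NHG.linearIndependent_generators hWc.nonempty fun x hx => ?_,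
    hdeg.1.isNearHorizonGeometry_original hW hD' hfW fun x hx => hm.mdifferentiableAt hx⟩
  -- `grad (1/f) = -grad f / f²`, and `grad f` has no zeros on the connected `S`.
  rw [NHG.vecVal_gradient_inv (hm.mdifferentiableAt hx) (hfW x hx)]
  exact smul_ne_zero (neg_ne_zero.2 (pow_ne_zero 2 (inv_ne_zero (hfW x hx))))
    (hH.gradient_ne_zero hs hK hD hind x)
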